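/- Let $k>1$ be a real number. For a positive integer $n$ put $$R_{HL}(n)=\sum_{\substack{m_1,m_2\ge 1\\ m_1+m_2^2=n}}\Lambda(m_1),$$ where $\Lambda$ is the von Mangoldt function, let $\Gamma$ be the Euler Gamma-function, and for $u>0$ and $\nu\in\mathbb{C}$ with $\Re(\nu)>0$ let $$J_\nu(u)=\frac{(u/2)^\nu}{2\pi i}\int_{(1)}s^{-\nu-1}e^{s}e^{-u^2/(4s)}\,\mathrm{d}s$$ be the Bessel function of complex order $\nu$ (Sonine's representation; the integral is over the vertical line $\Re(s)=1$, and any line $\Re(s)=a$ with $a>0$ gives the same value). Then, for every integer $N\ge 1$, $$\begin{aligned} \sum_{n\le N}R_{HL}(n)\frac{(1-n/N)^k}{\Gamma(k+1)} ={}&\frac{\pi^{1/2}}2\,\frac{N^{3/2}}{\Gamma(k+5/2)}-\frac12\,\frac{N}{\Gamma(k+2)} -\frac{\pi^{1/2}}2\sum_{\rho}\frac{\Gamma(\rho)}{\Gamma(k+3/2+\rho)}N^{1/2+\rho}\\ &+\frac12\sum_{\rho}\frac{\Gamma(\rho)}{\Gamma(k+1+\rho)}N^{\rho} +\frac{N^{3/4-k/2}}{\pi^{k+1}}\sum_{\ell\ge1}\frac{J_{k+3/2}(2\pi\ell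 N^{1/2})}{\ell^{k+3/2}}\\ &-\frac{N^{1/4-k/2}}{\pi^{k}}\sum_{\rho}\Gamma(\rho)\frac{N^{\rho/2}}{\pi^{\rho}}\sum_{\ell\ge1}\frac{J_{k+1/2+\rho}(2\pi\ell N^{1/2})}{\ell^{k+1/2+\rho}} +O_k\bigl(N^{1/2}\bigr), \end{aligned}$$ where $\rho$ runs over the non-trivial zeros of the Riemann zeta-function (the zeros with $0<\Re(\rho)<1$), counted with multiplicity, the implied constant depends only on $k$, and all the series over $\rho$ and over $\ell$ (in the last term: the inner series for every $\rho$, and the outer series of their sums) converge absolutely. -/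

import Mathlib

noncomputable section

/-- The number of representations `n = m₁ + m₂²` with positive integers `m₁`, `m₂`, weighted by
the von Mangoldt function of `m₁`. -/
def hardyLittlewoodR (n : ℕ) : ℝ :=
  ∑ m ∈ Finset.Icc 1 n ×ˢ Finset.Icc 1 n with m.1 + m.2 ^ 2 = n,
    ArithmeticFunction.vonMangoldt m.1

/-- The Cesàro-weighted average of order `k` of `hardyLittlewoodR` up to `N`. -/
def cesaroHL (k : ℝ) (N : ℕ) : ℝ :=
  ∑ n ∈ Finset.Icc 1 N,
    hardyLittlewoodR n * ((1 - (n : ℝ) / (N : ℝ)) ^ k / Real.Gamma (k + 1))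

/-- The non-trivial zeros of the Riemann zeta function: its zeros in the open critical strip. -/
def zetaZeros : Set ℂ :=
  {s : ℂ | riemannZeta s = 0 ∧ 0 < s.re ∧ s.re < 1}

/-- The multiplicity of a zero of the Riemann zeta function. A sum in which `ρ` runs over the
non-trivial zeros counted with multiplicity is a sum over `zetaZeros` in which the term of `ρ`
carries this factor. -/
def zetaMult (ρ : ℂ) : ℕ := analyticOrderNatAt riemannZeta ρ

/-- The Bessel function `J_ν(u)`, for `0 < re ν` and `0 < u`, by Sonine's integral
`(u / 2) ^ ν / (2 π i) ∫ s ^ (-ν - 1) e ^ s e ^ (-u² / (4 s)) ds` over the upward vertical line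
`re s = 1`, parametrized as `s = 1 + i t`, so that `ds = i dt`. (The integral converges
absolutely, and any line `re s = a` with `0 < a` gives the same value.) -/
def besselJ (ν : ℂ) (u : ℝ) : ℂ :=
  ((u : ℂ) / 2) ^ ν / (2 * (Real.pi : ℂ) * Complex.I) *
    ∫ t : ℝ,
      (1 + (t : ℂ) * Complex.I) ^ (-ν - 1) * Complex.exp (1 + (t : ℂ) * Complex.I) *
        Complex.exp (-(u : ℂ) ^ 2 / (4 * (1 + (t : ℂ) * Complex.I))) * Complex.I

/-- The summand `J_ν(2 π ℓ N^{1/2}) / ℓ^ν` of the Bessel series. -/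
def besselTerm (ν : ℂ) (N : ℕ) (ℓ : ℕ+) : ℂ :=
  besselJ ν (2 * Real.pi * ((ℓ : ℕ) : ℝ) * Real.sqrt (N : ℝ)) / ((ℓ : ℕ) : ℂ) ^ ν

/-- The summand `Γ(ρ) / Γ(w + ρ) · N^{w' + ρ}` of the sums over the zeros, with multiplicity. -/
def gammaZeroTerm (w w' : ℂ) (N : ℕ) (ρ : zetaZeros) : ℂ :=
  (zetaMult ρ : ℂ) * (Complex.Gamma ρ / Complex.Gamma (w + ρ) * (N : ℂ) ^ (w' + (ρ : ℂ)))

/-- The summand `Γ(ρ) N^{ρ/2} π^{-ρ} ∑_{ℓ ≥ 1} J_{k+1/2+ρ}(2 π ℓ N^{1/2}) / ℓ^{k+1/2+ρ}` of the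
double series over the zeros and over `ℓ`, with multiplicity. -/
def besselZeroTerm (k : ℝ) (N : ℕ) (ρ : zetaZeros) : ℂ :=
  (zetaMult ρ : ℂ) *
    (Complex.Gamma ρ * ((N : ℂ) ^ ((ρ : ℂ) / 2) / (Real.pi : ℂ) ^ (ρ : ℂ)) *
      ∑' ℓ : ℕ+, besselTerm ((k : ℂ) + 1 / 2 + ρ) N ℓ)

end

/-!
The function `ψ₁ x = ∑ Λ(n) (x - n)⁺` differs from `x ^ 2 / 2 - ∑_ρ x ^ (ρ + 1) / (ρ (ρ + 1))` by
`O(1 + x)`: the Mellin transforms agree by the partial fraction expansion of `ζ'/ζ`, which comes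
from Jensen's bound on the number of zeros and the Borel–Carathéodory estimate for `ζ` divided by
its zeros. Integrating `ψ₁` against `(X - t) ^ (k - 2)` turns this into an expansion of the Riesz
mean `∑ Λ(n) (X - n) ^ k`, up to `O((1 + X) X ^ (k - 1))`, whose coefficients are quotients of Gamma
values.

The Cesàro average is `N ^ (-k)` times the sum of these Riesz means over `X = N - m ^ 2`, so each of
the at most `√N` values of `m` contributes an error `O(1)`. By Sonine's integral the Fourier
transform of `(N - x ^ 2)₊ ^ a` is a Bessel function, and Poisson summation in `m` yields the Bessel
series, both for the main term (`a = k + 1`) and for each zero (`a = k + ρ`).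
-/

section EntireFunctions

open Complex Metric Set Filter Topology

variable {f g : ℂ → ℂ}

lemma analyticOrderAt_ne_top_of_differentiable (hf : Differentiable ℂ f) {c : ℂ} (hc : f c ≠ 0)
    (z : ℂ) : analyticOrderAt f z ≠ ⊤ := by
  rw [Ne, AnalyticOnNhd.analyticOrderAt_eq_top_iff_eq_zero z fun w ↦ hf.analyticAt w]
  rintro rfl
  exact hc rfl

lemma finite_zeros_norm_le (hf : Differentiable ℂ f) {c : ℂ} (hc : f c ≠ 0) (R : ℝ) :
    {z : ℂ | f z = 0 ∧ ‖z‖ ≤ R}.Finite := by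
  have hcodiscrete := AnalyticOnNhd.preimage_zero_mem_codiscrete (fun w _ ↦ hf.analyticAt w) hc
  rw [mem_codiscrete'] at hcodiscrete
  have hclosed : IsClosed {z : ℂ | f z = 0} := isClosed_eq hf.continuous continuous_const
  have hdiscrete : IsDiscrete {z : ℂ | f z = 0} := by
    convert hcodiscrete.2 using 1
    ext z
    simp
  refine (((isCompact_closedBall (0 : ℂ) R).inter_right hclosed).finite
    (hdiscrete.mono inter_subset_right)).subset fun z hz ↦ ⟨?_, hz.1⟩
  simpa using hz.2

lemma exists_eq_pow_analyticOrderNatAt_mul (hg : Differentiable ℂ g) {a : ℂ}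
    (ha : analyticOrderAt g a ≠ ⊤) :
    ∃ q : ℂ → ℂ, Differentiable ℂ q ∧ q a ≠ 0 ∧
      ∀ z, g z = (z - a) ^ analyticOrderNatAt g a * q z := by
  obtain ⟨h, hh, hha, hev⟩ := (hg.analyticAt a).analyticOrderAt_ne_top.1 ha
  set n := analyticOrderNatAt g a
  set q : ℂ → ℂ := Function.update (fun z ↦ g z / (z - a) ^ n) a (h a) with hq
  have hqa : q a = h a := Function.update_self ..
  have hq_ne : ∀ z ≠ a, q z = g z / (z - a) ^ n := fun z hz ↦ Function.update_of_ne hz ..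
  refine ⟨q, fun z ↦ ?_, hqa ▸ hha, fun z ↦ ?_⟩
  · rcases eq_or_ne z a with rfl | hza
    · refine hh.differentiableAt.congr_of_eventuallyEq ?_
      filter_upwards [hev] with w hw
      rcases eq_or_ne w z with rfl | hwz
      · exact hqa
      · rw [hq_ne w hwz, hw, smul_eq_mul,
          mul_div_cancel_left₀ _ (pow_ne_zero _ (sub_ne_zero.2 hwz))]
    · have hdiv : DifferentiableAt ℂ (fun w ↦ g w / (w - a) ^ n) z :=
        (hg z).div (by fun_prop) (pow_ne_zero n (sub_ne_zero.2 hza))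
      refine hdiv.congr_of_eventuallyEq ?_
      filter_upwards [isOpen_ne.mem_nhds hza] with w hw using hq_ne w hw
  · rcases eq_or_ne z a with rfl | hza
    · rw [hqa]
      exact hev.self_of_nhds
    · rw [hq_ne z hza, mul_div_cancel₀ _ (pow_ne_zero _ (sub_ne_zero.2 hza))]

lemma exists_eq_prod_pow_analyticOrderNatAt_mul (hf : Differentiable ℂ f) {c : ℂ} (hc : f c ≠ 0)
    (F : Finset ℂ) :
    ∃ g : ℂ → ℂ, Differentiable ℂ g ∧ (∀ ρ ∈ F, g ρ ≠ 0) ∧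
      ∀ z, f z = (∏ ρ ∈ F, (z - ρ) ^ analyticOrderNatAt f ρ) * g z := by
  induction F using Finset.induction_on with
  | empty => exact ⟨f, hf, by simp, by simp⟩
  | insert a F ha ih =>
    obtain ⟨g, hg, hgF, hfg⟩ := ih
    set P : ℂ → ℂ := fun z ↦ ∏ ρ ∈ F, (z - ρ) ^ analyticOrderNatAt f ρ
    have hPd : Differentiable ℂ P := by fun_prop
    have hPa : P a ≠ 0 := Finset.prod_ne_zero_iff.2 fun ρ hρ ↦
      pow_ne_zero _ (sub_ne_zero.2 fun h ↦ ha (h ▸ hρ))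
    have hord : analyticOrderAt f a = analyticOrderAt g a := by
      rw [show f = P * g from funext hfg, analyticOrderAt_mul (hPd.analyticAt a) (hg.analyticAt a),
        analyticOrderAt_eq_zero.2 (Or.inr hPa), zero_add]
    obtain ⟨q, hq, hqa, hgq⟩ := exists_eq_pow_analyticOrderNatAt_mul hg
      (hord ▸ analyticOrderAt_ne_top_of_differentiable hf hc a)
    refine ⟨q, hq, fun ρ hρ ↦ ?_, fun z ↦ ?_⟩
    · rcases Finset.mem_insert.1 hρ with rfl | hρ
      · exact hqa
      · exact fun h ↦ hgF ρ hρ (by rw [hgq, h, mul_zero])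
    · rw [hfg, Finset.prod_insert ha, hgq z,
        show analyticOrderNatAt f a = analyticOrderNatAt g a by simp [analyticOrderNatAt, hord]]
      ring

lemma sum_analyticOrderNatAt_le_log_div_log (hf : Differentiable ℂ f) {c : ℂ} (hc : f c ≠ 0)
    {r R M : ℝ} (hr : 0 < r) (hrR : r < R) (hM : 1 ≤ M) (hb : ∀ z ∈ sphere c R, ‖f z‖ ≤ M)
    {F : Finset ℂ} (hF : ∀ ρ ∈ F, ρ ∈ closedBall c r) :
    (∑ ρ ∈ F, (analyticOrderNatAt f ρ : ℝ)) ≤ Real.log (M / ‖f c‖) / Real.log (R / r) := by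
  have ha : ∀ s : Set ℂ, AnalyticOnNhd ℂ f s := fun s z _ ↦ hf.analyticAt z
  have habs : |r| = r ∧ |R| = R := ⟨abs_of_pos hr, abs_of_pos (hr.trans hrR)⟩
  have hjensen := AnalyticOnNhd.sum_divisor_le (c := c) (r := r) (R := R) (M := M)
    (by rwa [habs.1]) (by rwa [habs.1, habs.2]) hM (ha _) hc (by rwa [habs.2])
  rw [habs.1] at hjensen
  refine le_trans ?_ hjensen
  set D := MeromorphicOn.divisor f (closedBall c r)
  have hfin : (D : ℂ → ℤ).support.Finite := D.finiteSupport (isCompact_closedBall ..)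
  have hD : ∀ z ∈ closedBall c r, D z = (analyticOrderNatAt f z : ℤ) := fun z hz ↦ by
    rw [MeromorphicOn.AnalyticOnNhd.divisor_apply (ha _) hz,
      ← Nat.cast_analyticOrderNatAt (analyticOrderAt_ne_top_of_differentiable hf hc z)]
    simp
  have hD0 : ∀ z, 0 ≤ D z := fun z ↦ by
    by_cases hz : z ∈ closedBall c r
    · rw [hD z hz]
      positivity
    · simp [D, hz]
  rw [finsum_eq_sum_of_support_subset D (s := F ∪ hfin.toFinset) (by
    intro z hz
    simp only [Finset.coe_union, Finite.coe_toFinset]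
    exact Or.inr hz)]
  push_cast
  calc (∑ ρ ∈ F, (analyticOrderNatAt f ρ : ℝ)) = ∑ ρ ∈ F, ((D ρ : ℤ) : ℝ) :=
        Finset.sum_congr rfl fun ρ hρ ↦ by rw [hD ρ (hF ρ hρ), Int.cast_natCast]
    _ ≤ _ := Finset.sum_le_sum_of_subset_of_nonneg Finset.subset_union_left
        fun z _ _ ↦ by exact_mod_cast hD0 z

lemma exists_eq_mul_exp_of_forall_ne_zero {c : ℂ} {r : ℝ} (hr : 0 < r)
    (hg : DifferentiableOn ℂ g (ball c r)) (hgz : ∀ z ∈ ball c r, g z ≠ 0) :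
    ∃ L : ℂ → ℂ, L c = 0 ∧ ∀ z ∈ ball c r, HasDerivAt L (logDeriv g z) z ∧
      g z = g c * cexp (L z) := by
  have hlog : DifferentiableOn ℂ (logDeriv g) (ball c r) :=
    (hg.deriv isOpen_ball).div hg hgz
  obtain ⟨L, hLc, hL⟩ := hlog.isExactOn_ball.with_val_at c 0
  refine ⟨L, hLc, fun z hz ↦ ⟨hL z hz, ?_⟩⟩
  have hd : ∀ w ∈ ball c r, HasDerivAt (fun w ↦ g w * cexp (-L w)) 0 w := fun w hw ↦ by
    refine ((hg.differentiableAt (isOpen_ball.mem_nhds hw)).hasDerivAt.mul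
      (hL w hw).neg.cexp).congr_deriv ?_
    have := hgz w hw
    simp only [logDeriv_apply]
    field_simp
    ring
  have hconst : g z * cexp (-L z) = g c * cexp (-L c) :=
    isOpen_ball.is_const_of_deriv_eq_zero (convex_ball c r).isPreconnected
      (fun w hw ↦ (hd w hw).differentiableAt.differentiableWithinAt)
      (fun w hw ↦ (hd w hw).deriv) hz (mem_ball_self hr)
  rw [hLc, neg_zero, Complex.exp_zero, mul_one] at hconst
  rw [← hconst, mul_assoc, ← Complex.exp_add, neg_add_cancel, Complex.exp_zero, mul_one]

/- Borel–Carathéodory bounds the logarithm of `g / g 0`, and Cauchy's estimate its derivative. -/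
lemma norm_logDeriv_le_of_forall_ne_zero {r M : ℝ} (hM : 0 < M)
    (hg : DifferentiableOn ℂ g (ball 0 r)) (hgz : ∀ z ∈ ball (0 : ℂ) r, g z ≠ 0)
    (hgb : ∀ z ∈ ball (0 : ℂ) r, ‖g z‖ ≤ Real.exp M * ‖g 0‖) {s : ℂ} (hs : ‖s‖ < r / 4) :
    ‖logDeriv g s‖ ≤ 8 * M / r := by
  have hr : 0 < r := by linarith [norm_nonneg s]
  obtain ⟨L, hL0, hL⟩ := exists_eq_mul_exp_of_forall_ne_zero hr hg hgz
  have hLd : DifferentiableOn ℂ L (ball 0 r) := fun z hz ↦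
    (hL z hz).1.differentiableAt.differentiableWithinAt
  have hre : MapsTo L (ball 0 r) {z | z.re ≤ M} := fun z hz ↦ by
    have h := hgb z hz
    rw [(hL z hz).2, norm_mul, Complex.norm_exp, mul_comm] at h
    exact Real.exp_le_exp.1 <|
      le_of_mul_le_mul_right h (norm_pos_iff.2 (hgz 0 (mem_ball_self hr)))
  have hbd : ∀ z, ‖z‖ ≤ r / 2 → ‖L z‖ ≤ 2 * M := fun z hz ↦ by
    refine (borelCaratheodory_zero hM hLd hre hr (by simpa using by linarith) hL0).trans ?_
    rw [div_le_iff₀ (by linarith)]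
    nlinarith [norm_nonneg z]
  have hnorm : ∀ z, ‖z - s‖ ≤ r / 4 → ‖z‖ ≤ r / 2 := fun z hz ↦ by
    linarith [norm_le_norm_add_norm_sub' z s]
  have hsub : closedBall s (r / 4) ⊆ ball 0 r := fun z hz ↦ by
    rw [mem_ball_zero_iff]
    linarith [hnorm z (by simpa [dist_eq_norm] using hz)]
  rw [← (hL s (hsub (mem_closedBall_self (by linarith)))).1.deriv]
  refine (norm_deriv_le_of_forall_mem_sphere_norm_le (C := 2 * M) (by positivity)
    (hLd.diffContOnCl_ball hsub) fun z hz ↦ hbd z (hnorm z ?_)).trans_eq ?_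
  · simpa [dist_eq_norm] using (mem_sphere.1 hz).le
  · field_simp
    ring

lemma norm_logDeriv_sub_logDeriv_zero_le {r M : ℝ} (hM : 0 < M)
    (hg : DifferentiableOn ℂ g (ball 0 r)) (hgz : ∀ z ∈ ball (0 : ℂ) r, g z ≠ 0)
    (hgb : ∀ z ∈ ball (0 : ℂ) r, ‖g z‖ ≤ Real.exp M * ‖g 0‖) {s : ℂ} (hs : ‖s‖ < r / 4) :
    ‖logDeriv g s - logDeriv g 0‖ ≤ 64 * M * ‖s‖ / r ^ 2 := by
  have hr : 0 < r := by linarith [norm_nonneg s]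
  have hlog : DifferentiableOn ℂ (logDeriv g) (ball 0 (r / 4)) :=
    ((hg.deriv isOpen_ball).div hg hgz).mono (ball_subset_ball (by linarith))
  have hmaps : MapsTo (logDeriv g) (ball 0 (r / 4)) (closedBall (logDeriv g 0) (16 * M / r)) := by
    intro w hw
    rw [mem_closedBall, dist_eq_norm]
    refine (norm_sub_le _ _).trans ?_
    have hbw := norm_logDeriv_le_of_forall_ne_zero hM hg hgz hgb (mem_ball_zero_iff.1 hw)
    have hb0 := norm_logDeriv_le_of_forall_ne_zero (s := 0) hM hg hgz hgb (by simpa using hr)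
    have : 16 * M / r = 8 * M / r + 8 * M / r := by ring
    linarith
  have hschwarz := dist_le_div_mul_dist_of_mapsTo_ball hlog hmaps (mem_ball_zero_iff.2 hs)
  rw [dist_eq_norm, dist_zero_right] at hschwarz
  refine hschwarz.trans_eq ?_
  field_simp
  ring

lemma logDeriv_prod_sub_pow (m : ℂ → ℕ) {F : Finset ℂ} {z : ℂ} (hz : z ∉ F) :
    logDeriv (fun z ↦ ∏ ρ ∈ F, (z - ρ) ^ m ρ) z = ∑ ρ ∈ F, (m ρ : ℂ) * (1 / (z - ρ)) := by
  rw [logDeriv_prod]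
  · refine Finset.sum_congr rfl fun ρ _ ↦ ?_
    rw [logDeriv_fun_pow (by fun_prop)]
    simp [logDeriv_apply]
  · exact fun ρ hρ ↦ pow_ne_zero _ (sub_ne_zero.2 fun h ↦ hz (h ▸ hρ))
  · exact fun ρ _ ↦ by fun_prop

lemma norm_prod_sub_pow_zero_le (m : ℂ → ℕ) {F : Finset ℂ} {R : ℝ} (hF : ∀ ρ ∈ F, ‖ρ‖ ≤ R / 2)
    {z : ℂ} (hz : ‖z‖ = R) :
    ‖∏ ρ ∈ F, (0 - ρ) ^ m ρ‖ ≤ ‖∏ ρ ∈ F, (z - ρ) ^ m ρ‖ := by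
  simp only [norm_prod, norm_pow]
  refine Finset.prod_le_prod (fun ρ _ ↦ by positivity) fun ρ hρ ↦ ?_
  have : ‖(0 : ℂ) - ρ‖ ≤ ‖z - ρ‖ := by
    rw [zero_sub, norm_neg]
    linarith [hF ρ hρ, norm_sub_norm_le z ρ]
  gcongr

lemma norm_quotient_le_of_eq_prod_mul (hg : Differentiable ℂ g) {m : ℂ → ℕ} {F : Finset ℂ}
    (hfg : ∀ z, f z = (∏ ρ ∈ F, (z - ρ) ^ m ρ) * g z) (h0 : f 0 ≠ 0) {R B : ℝ} (hR : 0 < R)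
    (hF : ∀ ρ ∈ F, ‖ρ‖ ≤ R / 2) (hb : ∀ z, ‖z‖ = R → ‖f z‖ ≤ Real.exp B) {z : ℂ}
    (hz : z ∈ ball 0 R) :
    ‖g z‖ ≤ Real.exp (B + |Real.log ‖f 0‖|) * ‖g 0‖ := by
  set P : ℂ → ℂ := fun z ↦ ∏ ρ ∈ F, (z - ρ) ^ m ρ
  have hP0 : P 0 ≠ 0 := fun h ↦ h0 (by rw [hfg]; exact mul_eq_zero_of_left h _)
  have hexp : Real.exp B ≤ Real.exp (B + |Real.log ‖f 0‖|) * ‖f 0‖ := by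
    nth_rewrite 2 [← Real.exp_log (norm_pos_iff.2 h0)]
    rw [← Real.exp_add]
    exact Real.exp_le_exp.2 (by linarith [neg_abs_le (Real.log ‖f 0‖)])
  have hsphere : ∀ w, ‖w‖ = R → ‖g w‖ ≤ Real.exp (B + |Real.log ‖f 0‖|) * ‖g 0‖ := fun w hw ↦ by
    refine le_of_mul_le_mul_left ?_ (norm_pos_iff.2 hP0)
    calc ‖P 0‖ * ‖g w‖ ≤ ‖P w‖ * ‖g w‖ := by
          gcongr
          exact norm_prod_sub_pow_zero_le m hF hw
      _ = ‖f w‖ := by rw [hfg, norm_mul]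
      _ ≤ Real.exp (B + |Real.log ‖f 0‖|) * ‖f 0‖ := (hb w hw).trans hexp
      _ = ‖P 0‖ * (Real.exp (B + |Real.log ‖f 0‖|) * ‖g 0‖) := by
          rw [hfg 0, norm_mul]
          ring
  refine norm_le_of_forall_mem_frontier_norm_le isBounded_ball hg.diffContOnCl (fun w hw ↦ ?_)
    (subset_closure hz)
  rw [frontier_ball _ hR.ne'] at hw
  exact hsphere w (by simpa using hw)

lemma norm_logDeriv_sub_sum_le (hf : Differentiable ℂ f) (h0 : f 0 ≠ 0) {R B : ℝ}
    (hB : 0 ≤ B) (hb : ∀ z, ‖z‖ = R → ‖f z‖ ≤ Real.exp B) {s : ℂ} (hs : ‖s‖ < R / 8)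
    (hfs : f s ≠ 0) {F : Finset ℂ} (hF : ∀ ρ, ρ ∈ F ↔ f ρ = 0 ∧ ‖ρ‖ ≤ R / 2) :
    ‖logDeriv f s - logDeriv f 0
        - ∑ ρ ∈ F, (analyticOrderNatAt f ρ : ℂ) * (1 / (s - ρ) + 1 / ρ)‖
      ≤ 256 * (B + |Real.log ‖f 0‖| + 1) * ‖s‖ / R ^ 2 := by
  have hR : 0 < R := by linarith [norm_nonneg s]
  obtain ⟨g, hg, hgF, hfg⟩ := exists_eq_prod_pow_analyticOrderNatAt_mul hf h0 F
  set P : ℂ → ℂ := fun z ↦ ∏ ρ ∈ F, (z - ρ) ^ analyticOrderNatAt f ρ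
  have hPd : Differentiable ℂ P := by fun_prop
  have hnotMem : ∀ z, f z ≠ 0 → z ∉ F := fun z hz h ↦ hz ((hF z).1 h).1
  have hlogf : ∀ z, f z ≠ 0 → logDeriv f z
      = ∑ ρ ∈ F, (analyticOrderNatAt f ρ : ℂ) * (1 / (z - ρ)) + logDeriv g z := fun z hz ↦ by
    have hne := hfg z ▸ hz
    rw [← logDeriv_prod_sub_pow _ (hnotMem z hz),
      ← logDeriv_mul z (left_ne_zero_of_mul hne) (right_ne_zero_of_mul hne) (hPd z) (hg z)]
    exact congrArg (logDeriv · z) (funext hfg)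
  have hg_ne : ∀ z ∈ ball (0 : ℂ) (R / 2), g z ≠ 0 := fun z hz h ↦
    hgF z ((hF z).2 ⟨by rw [hfg, h, mul_zero], (mem_ball_zero_iff.1 hz).le⟩) h
  have hg_le : ∀ z ∈ ball (0 : ℂ) (R / 2),
      ‖g z‖ ≤ Real.exp (B + |Real.log ‖f 0‖| + 1) * ‖g 0‖ := fun z hz ↦
    (norm_quotient_le_of_eq_prod_mul hg hfg h0 hR (fun ρ hρ ↦ ((hF ρ).1 hρ).2) hb
      (ball_subset_ball (by linarith) hz)).trans (by
      have := Real.exp_le_exp.2 (le_add_of_nonneg_right zero_le_one :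
        B + |Real.log ‖f 0‖| ≤ B + |Real.log ‖f 0‖| + 1)
      gcongr)
  have hkey := norm_logDeriv_sub_logDeriv_zero_le (s := s) (by positivity) hg.differentiableOn
    hg_ne hg_le (by linarith)
  convert hkey using 1
  · rw [hlogf s hfs, hlogf 0 h0]
    simp only [mul_add, Finset.sum_add_distrib, zero_sub, one_div, inv_neg, mul_neg,
      Finset.sum_neg_distrib]
    ring_nf
  · field_simp
    ring

/- Dyadic decomposition according to the size of `φ`. -/
lemma summable_div_rpow_of_sum_le_rpow {ι : Type*} {m φ : ι → ℝ} {K τ σ : ℝ} (hτσ : τ < σ)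
    (hm : ∀ i, 0 ≤ m i) (hφ : ∀ i, 1 ≤ φ i) (hK : 0 ≤ K)
    (hcount : ∀ R : ℝ, 1 ≤ R → ∀ F : Finset ι, (∀ i ∈ F, φ i ≤ R) → ∑ i ∈ F, m i ≤ K * R ^ τ)
    (hσ : 0 ≤ σ) : Summable fun i ↦ m i / φ i ^ σ := by
  have hφ0 : ∀ i, 0 < φ i := fun i ↦ one_pos.trans_le (hφ i)
  set q : ℝ := 2 ^ (τ - σ)
  have hgeom : Summable fun j : ℕ ↦ K * 2 ^ τ * q ^ j :=
    (summable_geometric_of_lt_one (by positivity)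
      (Real.rpow_lt_one_of_one_lt_of_neg one_lt_two (sub_neg.2 hτσ))).mul_left _
  choose J hJ_le hJ_lt using fun i ↦ exists_nat_pow_near (hφ i) (one_lt_two (α := ℝ))
  refine summable_of_sum_le (c := ∑' j : ℕ, K * 2 ^ τ * q ^ j)
    (fun i ↦ div_nonneg (hm i) (Real.rpow_nonneg (hφ0 i).le σ)) fun F ↦ ?_
  rw [← Finset.sum_fiberwise_of_maps_to (t := F.image J) (g := J)
    fun x hx ↦ Finset.mem_image_of_mem J hx]
  refine le_trans (Finset.sum_le_sum fun j _ ↦ ?_)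
    (hgeom.sum_le_tsum (F.image J) fun j _ ↦ by positivity)
  calc ∑ i ∈ F with J i = j, m i / φ i ^ σ
      ≤ ∑ i ∈ F with J i = j, m i / ((2 : ℝ) ^ j) ^ σ := by
        refine Finset.sum_le_sum fun i hi ↦ ?_
        have := (Finset.mem_filter.1 hi).2 ▸ hJ_le i
        gcongr
        exact hm i
    _ = (∑ i ∈ F with J i = j, m i) / ((2 : ℝ) ^ j) ^ σ := by rw [Finset.sum_div]
    _ ≤ K * (2 ^ (j + 1)) ^ τ / ((2 : ℝ) ^ j) ^ σ := by
        gcongr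
        exact hcount _ (one_le_pow₀ one_le_two) _ fun i hi ↦
          ((Finset.mem_filter.1 hi).2 ▸ hJ_lt i).le
    _ = K * 2 ^ τ * q ^ j := by
        rw [pow_succ, Real.mul_rpow (by positivity) zero_le_two, ← Real.rpow_pow_comm zero_le_two,
          ← Real.rpow_pow_comm zero_le_two, show q = 2 ^ τ / 2 ^ σ from Real.rpow_sub two_pos τ σ,
          div_pow]
        ring

section OrderLessThanTwo

variable {C τ : ℝ}

lemma summable_analyticOrderNatAt_div_sq (hf : Differentiable ℂ f) (h0 : f 0 ≠ 0) (hC : 0 ≤ C)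
    (hτ : 0 ≤ τ) (hτ2 : τ < 2) (hb : ∀ z, ‖f z‖ ≤ Real.exp (C * (1 + ‖z‖) ^ τ)) :
    Summable fun ρ : ℂ ↦ (analyticOrderNatAt f ρ : ℝ) / (1 + ‖ρ‖) ^ 2 := by
  have : 0 < Real.log 2 := Real.log_pos one_lt_two
  suffices h : Summable fun ρ : ℂ ↦ (analyticOrderNatAt f ρ : ℝ) / (1 + ‖ρ‖) ^ (2 : ℝ) by
    simpa only [Real.rpow_two] using h
  refine summable_div_rpow_of_sum_le_rpow (K := (C * 3 ^ τ + |Real.log ‖f 0‖|) / Real.log 2) hτ2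
    (fun _ ↦ Nat.cast_nonneg _) (fun ρ ↦ by linarith [norm_nonneg ρ]) (by positivity)
    (fun R hR F hF ↦ ?_) zero_le_two
  have hjensen := sum_analyticOrderNatAt_le_log_div_log (R := 2 * R) (F := F) hf h0
    (by linarith) (by linarith) (Real.one_le_exp (x := C * (1 + 2 * R) ^ τ) (by positivity))
    (fun z hz ↦ by simpa [mem_sphere_zero_iff_norm.1 hz] using hb z)
    (fun ρ hρ ↦ by simpa using by linarith [hF ρ hρ])
  rw [mul_div_cancel_right₀ _ (by linarith), Real.log_div (Real.exp_pos _).ne'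
    (norm_ne_zero_iff.2 h0), Real.log_exp] at hjensen
  refine hjensen.trans ?_
  rw [div_mul_eq_mul_div]
  gcongr
  calc C * (1 + 2 * R) ^ τ - Real.log ‖f 0‖
      ≤ C * (3 * R) ^ τ + |Real.log ‖f 0‖| * R ^ τ := by
        have : C * (1 + 2 * R) ^ τ ≤ C * (3 * R) ^ τ := by
          gcongr
          linarith
        have := le_mul_of_one_le_right (abs_nonneg (Real.log ‖f 0‖)) (Real.one_le_rpow hR hτ)
        linarith [neg_abs_le (Real.log ‖f 0‖)]
    _ = (C * 3 ^ τ + |Real.log ‖f 0‖|) * R ^ τ := by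
        rw [Real.mul_rpow (by norm_num) (by linarith)]
        ring

lemma norm_one_div_sub_add_one_div_le {s ρ : ℂ} (h : 2 * ‖s‖ + 1 < ‖ρ‖) :
    ‖1 / (s - ρ) + 1 / ρ‖ ≤ 8 * ‖s‖ / (1 + ‖ρ‖) ^ 2 := by
  have hρ : 0 < ‖ρ‖ := by linarith [norm_nonneg s]
  have hsρ : ‖ρ‖ / 2 ≤ ‖s - ρ‖ := by
    rw [norm_sub_rev]
    linarith [norm_sub_norm_le ρ s]
  have hρ0 : ρ ≠ 0 := norm_pos_iff.1 hρ
  have hsρ0 : s - ρ ≠ 0 := norm_pos_iff.1 (by linarith)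
  have hsum : 1 / (s - ρ) + 1 / ρ = s / ((s - ρ) * ρ) := by
    field_simp
    ring
  have hsq : (1 + ‖ρ‖) ^ 2 ≤ 8 * (‖s - ρ‖ * ‖ρ‖) := by nlinarith [norm_nonneg s]
  rw [hsum, norm_div, norm_mul, div_le_div_iff₀ (by positivity) (by positivity)]
  nlinarith [norm_nonneg s]

lemma finite_subtype_zeros_norm_le (hf : Differentiable ℂ f) {c : ℂ} (hc : f c ≠ 0) (R : ℝ) :
    {ρ : {z : ℂ | f z = 0} | ‖(ρ : ℂ)‖ ≤ R}.Finite := by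
  refine Set.Finite.of_finite_image ((finite_zeros_norm_le hf hc R).subset ?_)
    Subtype.val_injective.injOn
  rintro _ ⟨ρ, hρ, rfl⟩
  exact ⟨ρ.2, hρ⟩

lemma summable_analyticOrderNatAt_mul_one_div (hf : Differentiable ℂ f) (h0 : f 0 ≠ 0)
    (hC : 0 ≤ C) (hτ : 0 ≤ τ) (hτ2 : τ < 2) (hb : ∀ z, ‖f z‖ ≤ Real.exp (C * (1 + ‖z‖) ^ τ))
    (s : ℂ) :
    Summable fun ρ : {z : ℂ | f z = 0} ↦
      (analyticOrderNatAt f ρ : ℂ) * (1 / (s - (ρ : ℂ)) + 1 / (ρ : ℂ)) := by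
  refine Summable.of_norm_bounded_eventually (((summable_analyticOrderNatAt_div_sq hf h0 hC hτ hτ2
    hb).subtype {z : ℂ | f z = 0}).mul_left (8 * ‖s‖)) ?_
  filter_upwards [(finite_subtype_zeros_norm_le hf h0 (2 * ‖s‖ + 1)).compl_mem_cofinite] with ρ hρ
  rw [norm_mul, Complex.norm_natCast]
  calc (analyticOrderNatAt f ρ : ℝ) * ‖1 / (s - (ρ : ℂ)) + 1 / (ρ : ℂ)‖
      ≤ (analyticOrderNatAt f ρ : ℝ) * (8 * ‖s‖ / (1 + ‖(ρ : ℂ)‖) ^ 2) := by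
        gcongr
        exact norm_one_div_sub_add_one_div_le (not_le.1 hρ)
    _ = 8 * ‖s‖ * ((analyticOrderNatAt f ρ : ℝ) / (1 + ‖(ρ : ℂ)‖) ^ 2) := by ring

lemma tendsto_toFinset_le_atTop {ι : Type*} {φ : ι → ℝ} (h : ∀ n : ℕ, {i | φ i ≤ n}.Finite) :
    Tendsto (fun n ↦ (h n).toFinset) atTop atTop := by
  refine tendsto_atTop_finset_of_monotone (fun m n hmn i hi ↦ ?_) fun i ↦ ?_
  · simp only [Finite.mem_toFinset, mem_ofPred_eq] at hi ⊢
    exact hi.trans (Nat.cast_le.2 hmn)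
  · obtain ⟨n, hn⟩ := exists_nat_ge (φ i)
    exact ⟨n, (Finite.mem_toFinset _).2 hn⟩

lemma tendsto_sum_zeros_norm_le (hf : Differentiable ℂ f) (h0 : f 0 ≠ 0) (hC : 0 ≤ C)
    (hτ : 0 ≤ τ) (hτ2 : τ < 2) (hb : ∀ z, ‖f z‖ ≤ Real.exp (C * (1 + ‖z‖) ^ τ)) {s : ℂ}
    (hfs : f s ≠ 0) :
    Tendsto (fun n : ℕ ↦ ∑ ρ ∈ (finite_subtype_zeros_norm_le hf h0 n).toFinset,
        (analyticOrderNatAt f ρ : ℂ) * (1 / (s - (ρ : ℂ)) + 1 / (ρ : ℂ)))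
      atTop (𝓝 (logDeriv f s - logDeriv f 0)) := by
  rw [tendsto_iff_norm_sub_tendsto_zero]
  set K := |Real.log ‖f 0‖| + 1 with hK
  have hlim : Tendsto (fun n : ℕ ↦ 64 * (C * 3 ^ τ + K) * ‖s‖ * (n : ℝ) ^ (-(2 - τ)))
      atTop (𝓝 0) := by
    simpa using ((tendsto_rpow_neg_atTop (sub_pos.2 hτ2)).comp
      tendsto_natCast_atTop_atTop).const_mul (64 * (C * 3 ^ τ + K) * ‖s‖)
  refine squeeze_zero' (Eventually.of_forall fun _ ↦ norm_nonneg _) ?_ hlim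
  obtain ⟨n₀, hn₀⟩ := exists_nat_gt (4 * ‖s‖)
  filter_upwards [eventually_ge_atTop (max n₀ 1)] with n hn
  have hn1 : (1 : ℝ) ≤ n := by exact_mod_cast (le_max_right _ _).trans hn
  have hn0 : 4 * ‖s‖ < n := hn₀.trans_le (by exact_mod_cast (le_max_left _ _).trans hn)
  have happrox := norm_logDeriv_sub_sum_le hf h0 (R := 2 * n) (B := C * (1 + 2 * (n : ℝ)) ^ τ)
    (by positivity) (fun z hz ↦ hz ▸ hb z) (s := s) (by linarith) hfs
    (F := (finite_subtype_zeros_norm_le hf h0 n).toFinset.map (Function.Embedding.subtype _))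
    (fun ρ ↦ by
      rw [mul_div_cancel_left₀ _ two_ne_zero]
      simp only [Finset.mem_map, Finite.mem_toFinset, Function.Embedding.subtype_apply]
      exact ⟨fun ⟨a, ha, hρ⟩ ↦ hρ ▸ ⟨a.2, ha⟩, fun h ↦ ⟨⟨ρ, h.1⟩, h.2, rfl⟩⟩)
  rw [Finset.sum_map, norm_sub_rev] at happrox
  refine happrox.trans ?_
  have hgrowth : C * (1 + 2 * (n : ℝ)) ^ τ ≤ C * 3 ^ τ * (n : ℝ) ^ τ := by
    rw [mul_assoc, ← Real.mul_rpow (by norm_num) (by linarith)]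
    gcongr
    linarith
  have hK_le : K ≤ K * (n : ℝ) ^ τ :=
    le_mul_of_one_le_right (by positivity) (Real.one_le_rpow hn1 hτ)
  calc 256 * (C * (1 + 2 * (n : ℝ)) ^ τ + |Real.log ‖f 0‖| + 1) * ‖s‖ / (2 * (n : ℝ)) ^ 2
      = 64 * (C * (1 + 2 * (n : ℝ)) ^ τ + K) * ‖s‖ / (n : ℝ) ^ 2 := by
        rw [hK]
        field_simp
        ring
    _ ≤ 64 * (C * 3 ^ τ * (n : ℝ) ^ τ + K * (n : ℝ) ^ τ) * ‖s‖ / (n : ℝ) ^ 2 := by gcongr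
    _ = 64 * (C * 3 ^ τ + K) * ‖s‖ * (n : ℝ) ^ (-(2 - τ)) := by
        rw [neg_sub, Real.rpow_sub (by linarith), Real.rpow_two]
        ring

theorem hasSum_logDeriv_sub_logDeriv_zero (hf : Differentiable ℂ f) (h0 : f 0 ≠ 0) (hC : 0 ≤ C)
    (hτ : 0 ≤ τ) (hτ2 : τ < 2) (hb : ∀ z, ‖f z‖ ≤ Real.exp (C * (1 + ‖z‖) ^ τ)) {s : ℂ}
    (hfs : f s ≠ 0) :
    HasSum (fun ρ : {z : ℂ | f z = 0} ↦
        (analyticOrderNatAt f ρ : ℂ) * (1 / (s - (ρ : ℂ)) + 1 / (ρ : ℂ)))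
      (logDeriv f s - logDeriv f 0) := by
  have hsum := (summable_analyticOrderNatAt_mul_one_div hf h0 hC hτ hτ2 hb s).hasSum
  have hlim := hsum.comp (tendsto_toFinset_le_atTop fun n : ℕ ↦
    finite_subtype_zeros_norm_le hf h0 n)
  rwa [tendsto_nhds_unique hlim (tendsto_sum_zeros_norm_le hf h0 hC hτ hτ2 hb hfs)] at hsum

end OrderLessThanTwo

end EntireFunctions

section ZetaFunction

open Complex Metric Set Filter Topology MeasureTheory

lemma riemannZeta₁_eq_sub_mul {s : ℂ} (hs : s ≠ 1) :
    riemannZeta₁ s = (s - 1) * riemannZeta s := by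
  rw [riemannZeta_eq_inv_sub_mul hs, mul_inv_cancel_left₀ (sub_ne_zero.2 hs)]

lemma riemannZeta₁_eventuallyEq {s : ℂ} (hs : s ≠ 1) :
    riemannZeta₁ =ᶠ[𝓝 s] fun s ↦ (s - 1) * riemannZeta s := by
  filter_upwards [isOpen_ne.mem_nhds hs] with w hw using riemannZeta₁_eq_sub_mul hw

lemma riemannZeta₁_zero_ne_zero : riemannZeta₁ 0 ≠ 0 := by
  rw [riemannZeta₁_eq_sub_mul zero_ne_one, riemannZeta_zero]
  norm_num

lemma riemannZeta₁_eq_zero_iff {s : ℂ} : riemannZeta₁ s = 0 ↔ riemannZeta s = 0 := by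
  by_cases hs : s = 1
  · simp [hs, riemannZeta_one_ne_zero]
  · simp [riemannZeta₁_eq_sub_mul hs, sub_ne_zero.2 hs]

lemma analyticOrderNatAt_riemannZeta₁ {s : ℂ} (hs : s ≠ 1) :
    analyticOrderNatAt riemannZeta₁ s = analyticOrderNatAt riemannZeta s := by
  have h : analyticOrderAt riemannZeta₁ s = analyticOrderAt riemannZeta s := by
    rw [analyticOrderAt_congr (riemannZeta₁_eventuallyEq hs)]
    change analyticOrderAt ((fun s : ℂ ↦ s - 1) * riemannZeta) s = _
    rw [analyticOrderAt_mul (by fun_prop) (analyticOn_riemannZeta s hs),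
      analyticOrderAt_eq_zero (f := fun s : ℂ ↦ s - 1).2 (Or.inr (sub_ne_zero.2 hs)), zero_add]
  simp [analyticOrderNatAt, h]

/-- The fractional part on `(1, ∞)`, extended by zero. Its Mellin transform continues `ζ` to the
half-plane `0 < re s`. -/
noncomputable def fractIoi (x : ℝ) : ℂ :=
  (Ioi (1 : ℝ)).indicator (fun x ↦ ((Int.fract x : ℝ) : ℂ)) x

lemma measurable_fractIoi : Measurable fractIoi := by
  unfold fractIoi
  exact (Complex.measurable_ofReal.comp measurable_fract).indicator measurableSet_Ioi

lemma norm_fractIoi_le (x : ℝ) : ‖fractIoi x‖ ≤ 1 := by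
  unfold fractIoi
  by_cases hx : x ∈ Ioi (1 : ℝ)
  · rw [indicator_of_mem hx, norm_real, Real.norm_eq_abs, abs_of_nonneg (Int.fract_nonneg x)]
    exact (Int.fract_lt_one x).le
  · simp [indicator_of_notMem hx]

lemma mellin_fractIoi (s : ℂ) :
    mellin fractIoi (-s) = ∫ x in Ioi (1 : ℝ), (x : ℂ) ^ (-s - 1) * ((Int.fract x : ℝ) : ℂ) := by
  have : ∀ x : ℝ, (x : ℂ) ^ (-s - 1) • fractIoi x =
      (Ioi (1 : ℝ)).indicator (fun x : ℝ ↦ (x : ℂ) ^ (-s - 1) * ((Int.fract x : ℝ) : ℂ)) x := by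
    intro x
    unfold fractIoi
    by_cases hx : x ∈ Ioi (1 : ℝ) <;> simp [hx]
  simp only [mellin, this]
  rw [setIntegral_indicator measurableSet_Ioi, Ioi_inter_Ioi]
  norm_num

lemma integrableOn_cpow_mul_fract {s : ℂ} (hs : 0 < s.re) :
    IntegrableOn (fun x : ℝ ↦ (x : ℂ) ^ (-s - 1) * ((Int.fract x : ℝ) : ℂ)) (Ioi 1) := by
  refine (integrableOn_Ioi_cpow_of_lt (a := -s - 1) (by simp; linarith) zero_lt_one).mul_bdd
    (c := 1) (Complex.measurable_ofReal.comp measurable_fract).aestronglyMeasurable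
    (Eventually.of_forall fun x ↦ ?_)
  rw [norm_real, Real.norm_eq_abs, abs_of_nonneg (Int.fract_nonneg x)]
  exact (Int.fract_lt_one x).le

lemma norm_mellin_fractIoi_le {s : ℂ} (hs : 0 < s.re) : ‖mellin fractIoi (-s)‖ ≤ 1 / s.re := by
  rw [mellin_fractIoi]
  have h1 : ‖∫ x in Ioi (1 : ℝ), (x : ℂ) ^ (-s - 1) * ((Int.fract x : ℝ) : ℂ)‖
      ≤ ∫ x in Ioi (1 : ℝ), x ^ (-s.re - 1) := by
    refine norm_integral_le_of_norm_le (integrableOn_Ioi_rpow_of_lt (by linarith) zero_lt_one) ?_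
    refine (ae_restrict_iff' measurableSet_Ioi).2 (Eventually.of_forall fun x hx ↦ ?_)
    have hx0 : (0 : ℝ) < x := zero_lt_one.trans hx
    rw [norm_mul, norm_cpow_eq_rpow_re_of_pos hx0, norm_real, Real.norm_eq_abs,
      abs_of_nonneg (Int.fract_nonneg x)]
    simp only [sub_re, neg_re, one_re]
    exact mul_le_of_le_one_right (by positivity) (Int.fract_lt_one x).le
  refine h1.trans_eq ?_
  rw [integral_Ioi_rpow_of_lt (by linarith) zero_lt_one]
  simp

lemma differentiableAt_mellin_fractIoi {s : ℂ} (hs : 0 < s.re) :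
    DifferentiableAt ℂ (fun s ↦ mellin fractIoi (-s)) s := by
  have : DifferentiableAt ℂ (mellin fractIoi) (-s) := by
    refine mellin_differentiableAt_of_isBigO_rpow (a := 0) (b := -s.re - 1) ?_ ?_
      (by simpa using hs) ?_ (by simp)
    · refine LocallyIntegrable.locallyIntegrableOn ?_ _
      exact (locallyIntegrable_const (1 : ℝ)).mono measurable_fractIoi.aestronglyMeasurable
        (Eventually.of_forall fun x ↦ by simpa using norm_fractIoi_le x)
    · refine Asymptotics.IsBigO.of_bound 1 (Eventually.of_forall fun x ↦ ?_)
      simpa using norm_fractIoi_le x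
    · refine Asymptotics.IsBigO.of_bound 1 ?_
      filter_upwards [mem_nhdsWithin_of_mem_nhds (Iio_mem_nhds zero_lt_one)] with x hx
      have : fractIoi x = 0 := indicator_of_notMem (by simpa using (mem_Iio.1 hx).le) _
      rw [this]
      simp only [norm_zero]
      positivity
  exact this.comp s differentiableAt_id.neg

lemma riemannZeta₁_eq_of_one_lt_re {s : ℂ} (hs : 1 < s.re) :
    riemannZeta₁ s = s - s * (s - 1) * mellin fractIoi (-s) := by
  have hs1 : s ≠ 1 := by rintro rfl; simp at hs
  have hs10 := sub_ne_zero.2 hs1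
  rw [riemannZeta₁_eq_sub_mul hs1, ← LSeries_one_eq_riemannZeta hs,
    LSeries_eq_mul_integral' 1 zero_le_one hs (by
      simp only [Pi.one_apply, norm_one, Finset.sum_const, Nat.card_Icc, add_tsub_cancel_right,
        nsmul_eq_mul, mul_one, Real.rpow_one]
      exact Asymptotics.isBigO_refl _ _), mellin_fractIoi]
  have h1 : ∫ t in Ioi (1 : ℝ), (∑ k ∈ Finset.Icc 1 ⌊t⌋₊, (1 : ℕ → ℂ) k) * (t : ℂ) ^ (-(s + 1)) =
      ∫ t in Ioi (1 : ℝ), ((t : ℂ) ^ (-s) - (t : ℂ) ^ (-s - 1) * ((Int.fract t : ℝ) : ℂ)) := by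
    refine setIntegral_congr_fun measurableSet_Ioi fun t ht ↦ ?_
    have ht0 : (0 : ℝ) < t := zero_lt_one.trans ht
    have ht0' : (t : ℂ) ≠ 0 := by exact_mod_cast ht0.ne'
    have hfl : ((⌊t⌋₊ : ℕ) : ℂ) = (t : ℂ) - ((Int.fract t : ℝ) : ℂ) := by
      rw [← ofReal_sub, Int.self_sub_fract, ← natCast_floor_eq_intCast_floor ht0.le, ofReal_natCast]
    have hp : (t : ℂ) ^ (-s) = (t : ℂ) ^ (-s - 1) * t := by
      rw [cpow_sub _ _ ht0', cpow_one]
      field_simp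
    simp only [Pi.one_apply, Finset.sum_const, Nat.card_Icc, add_tsub_cancel_right, nsmul_eq_mul,
      mul_one, hfl]
    rw [hp, show -(s + 1) = -s - 1 by ring]
    ring
  rw [h1, integral_sub (integrableOn_Ioi_cpow_of_lt (by simpa using hs) zero_lt_one)
    (integrableOn_cpow_mul_fract (by linarith)),
    integral_Ioi_cpow_of_lt (by simpa using hs) zero_lt_one]
  have : -s + 1 ≠ 0 := by rw [show -s + 1 = -(s - 1) by ring]; exact neg_ne_zero.2 hs10
  simp only [ofReal_one, one_cpow]
  field_simp
  ring

lemma riemannZeta₁_eq_of_re_pos {s : ℂ} (hs : 0 < s.re) :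
    riemannZeta₁ s = s - s * (s - 1) * mellin fractIoi (-s) := by
  have hopen : IsOpen {s : ℂ | 0 < s.re} := isOpen_lt continuous_const continuous_re
  have hconv : Convex ℝ {s : ℂ | 0 < s.re} := convex_halfSpace_re_gt 0
  refine AnalyticOnNhd.eqOn_of_preconnected_of_eventuallyEq (U := {s : ℂ | 0 < s.re}) (z₀ := 2)
    (f := riemannZeta₁) (g := fun s ↦ s - s * (s - 1) * mellin fractIoi (-s))
    (fun z _ ↦ differentiable_riemannZeta₁.analyticAt z) ?_ hconv.isPreconnected (by simp) ?_ hs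
  · refine DifferentiableOn.analyticOnNhd (fun z hz ↦ ?_) hopen
    have := differentiableAt_mellin_fractIoi hz
    exact DifferentiableAt.differentiableWithinAt (by fun_prop)
  · have : {s : ℂ | 1 < s.re} ∈ 𝓝 (2 : ℂ) :=
      (isOpen_lt continuous_const continuous_re).mem_nhds (by simp)
    filter_upwards [this] with z hz using riemannZeta₁_eq_of_one_lt_re hz

lemma norm_riemannZeta₁_le_of_half_le_re {s : ℂ} (hs : 1 / 2 ≤ s.re) :
    ‖riemannZeta₁ s‖ ≤ 3 * (1 + ‖s‖) ^ 2 := by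
  have hs0 : 0 < s.re := by linarith
  rw [riemannZeta₁_eq_of_re_pos hs0]
  have h1 : ‖mellin fractIoi (-s)‖ ≤ 2 := (norm_mellin_fractIoi_le hs0).trans (by
    rw [div_le_iff₀ hs0]; linarith)
  have h2 : ‖s - 1‖ ≤ ‖s‖ + 1 := by simpa using norm_sub_le s 1
  calc ‖s - s * (s - 1) * mellin fractIoi (-s)‖ ≤ ‖s‖ + ‖s‖ * ‖s - 1‖ * ‖mellin fractIoi (-s)‖ := by
        simpa [norm_mul] using norm_sub_le s (s * (s - 1) * mellin fractIoi (-s))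
    _ ≤ ‖s‖ + ‖s‖ * (‖s‖ + 1) * 2 := by gcongr
    _ ≤ _ := by nlinarith [norm_nonneg s]

lemma norm_Gamma_le_Gamma_re {w : ℂ} (hw : 0 < w.re) : ‖Gamma w‖ ≤ Real.Gamma w.re := by
  rw [Complex.Gamma_eq_integral hw, Complex.GammaIntegral, Real.Gamma_eq_integral hw]
  refine norm_integral_le_of_norm_le (Real.GammaIntegral_convergent hw) ?_
  refine (ae_restrict_iff' measurableSet_Ioi).2 (Eventually.of_forall fun x hx ↦ ?_)
  rw [norm_mul, norm_cpow_eq_rpow_re_of_pos hx, norm_real, Real.norm_eq_abs,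
    abs_of_pos (Real.exp_pos _)]
  simp

lemma gamma_le_exp_rpow {x : ℝ} (hx : 1 / 2 ≤ x) :
    Real.Gamma x ≤ 2 * Real.exp (2 * (x + 2) ^ (3 / 2 : ℝ)) := by
  have hx0 : 0 < x := by linarith
  have h1 : Real.Gamma (x + 2) = (x + 1) * (x * Real.Gamma x) := by
    rw [show x + 2 = (x + 1) + 1 by ring, Real.Gamma_add_one (by linarith),
      Real.Gamma_add_one hx0.ne']
  have hG := Real.Gamma_pos_of_pos hx0
  have h2 : Real.Gamma x ≤ 2 * Real.Gamma (x + 2) := by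
    rw [h1]
    nlinarith [mul_pos hx0 hG]
  set n := ⌈x⌉₊
  have hnx : x ≤ n := Nat.le_ceil x
  have hnx' : (n : ℝ) < x + 1 := Nat.ceil_lt_add_one hx0.le
  have h3 : Real.Gamma (x + 2) ≤ Real.Gamma ((n + 1 : ℕ) + 1) :=
    Real.Gamma_strictMonoOn_Ici.monotoneOn (by simp; linarith) (by simp; linarith)
      (by push_cast; linarith)
  rw [Real.Gamma_nat_eq_factorial] at h3
  have h4 : (((n + 1).factorial : ℕ) : ℝ) ≤ ((n + 1 : ℕ) : ℝ) ^ (n + 1) := by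
    exact_mod_cast Nat.factorial_le_pow (n + 1)
  have h5 : ((n + 1 : ℕ) : ℝ) ^ (n + 1) ≤ Real.exp (2 * (x + 2) ^ (3 / 2 : ℝ)) := by
    have hy : (0 : ℝ) < ((n + 1 : ℕ) : ℝ) := by positivity
    have hyx : ((n + 1 : ℕ) : ℝ) ≤ x + 2 := by push_cast; linarith
    rw [← Real.exp_log (pow_pos hy _), Real.log_pow]
    apply Real.exp_le_exp.2
    have hlog := Real.log_le_rpow_div hy.le (ε := 1 / 2) (by norm_num)
    calc ((n + 1 : ℕ) : ℝ) * Real.log ((n + 1 : ℕ) : ℝ)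
        ≤ ((n + 1 : ℕ) : ℝ) * (((n + 1 : ℕ) : ℝ) ^ (1 / 2 : ℝ) / (1 / 2)) := by gcongr
      _ = 2 * ((n + 1 : ℕ) : ℝ) ^ (3 / 2 : ℝ) := by
          rw [show (3 / 2 : ℝ) = 1 + 1 / 2 by norm_num, Real.rpow_add hy, Real.rpow_one]
          ring
      _ ≤ _ := by gcongr
  linarith

lemma norm_cos_le_exp_norm (z : ℂ) : ‖Complex.cos z‖ ≤ Real.exp ‖z‖ := by
  have h1 : ‖cexp (z * I)‖ ≤ Real.exp ‖z‖ := (norm_exp_le_exp_norm _).trans (by simp)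
  have h2 : ‖cexp (-z * I)‖ ≤ Real.exp ‖z‖ := (norm_exp_le_exp_norm _).trans (by simp)
  rw [Complex.cos, norm_div, Complex.norm_ofNat]
  have := norm_add_le (cexp (z * I)) (cexp (-z * I))
  linarith

lemma two_mul_rpow_three_halves_le {x : ℝ} (hx : 0 ≤ x) :
    (2 * x) ^ (3 / 2 : ℝ) ≤ 4 * x ^ (3 / 2 : ℝ) := by
  rw [Real.mul_rpow zero_le_two hx]
  gcongr
  calc (2 : ℝ) ^ (3 / 2 : ℝ) ≤ 2 ^ (2 : ℝ) :=
        Real.rpow_le_rpow_of_exponent_le one_le_two (by norm_num)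
    _ = 4 := by norm_num

lemma le_rpow_three_halves {x : ℝ} (hx : 1 ≤ x) : x ≤ x ^ (3 / 2 : ℝ) :=
  Real.self_le_rpow_of_one_le hx (by norm_num)

lemma three_mul_one_add_sq_le_exp {y : ℝ} (hy : 0 ≤ y) :
    3 * (1 + y) ^ 2 ≤ Real.exp (2 * (1 + y)) := by
  calc 3 * (1 + y) ^ 2 ≤ Real.exp 2 * Real.exp y ^ 2 := by
        gcongr
        · linarith [Real.add_one_le_exp (2 : ℝ)]
        · linarith [Real.add_one_le_exp y]
    _ = Real.exp (2 * (1 + y)) := by rw [← Real.exp_nat_mul, ← Real.exp_add]; push_cast; ring_nf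

lemma norm_Gamma_le_exp_rpow {w : ℂ} (hw : 1 / 2 ≤ w.re) :
    ‖Gamma w‖ ≤ Real.exp (9 * (1 + ‖w‖) ^ (3 / 2 : ℝ)) := by
  set Y := (1 + ‖w‖) ^ (3 / 2 : ℝ)
  have hY : 1 + ‖w‖ ≤ Y := le_rpow_three_halves (by linarith [norm_nonneg w])
  have hre : (w.re + 2) ^ (3 / 2 : ℝ) ≤ 4 * Y :=
    (Real.rpow_le_rpow (by linarith) (by linarith [re_le_norm w, norm_nonneg w])
      (by norm_num)).trans (two_mul_rpow_three_halves_le (by positivity))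
  calc ‖Gamma w‖ ≤ 2 * Real.exp (2 * (w.re + 2) ^ (3 / 2 : ℝ)) :=
        (norm_Gamma_le_Gamma_re (by linarith)).trans (gamma_le_exp_rpow hw)
    _ ≤ Real.exp Y * Real.exp (8 * Y) := by
        refine mul_le_mul ?_ (Real.exp_le_exp.2 (by linarith)) (by positivity) (by positivity)
        linarith [Real.add_one_le_exp Y, norm_nonneg w]
    _ = Real.exp (9 * Y) := by rw [← Real.exp_add]; ring_nf

lemma norm_riemannZeta_le_exp_rpow {w : ℂ} (hw : 1 / 2 ≤ w.re) (hw1 : 1 ≤ ‖w - 1‖) :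
    ‖riemannZeta w‖ ≤ Real.exp (2 * (1 + ‖w‖) ^ (3 / 2 : ℝ)) := by
  have hne : w ≠ 1 := fun h ↦ by norm_num [h] at hw1
  rw [riemannZeta_eq_inv_sub_mul hne, norm_mul, norm_inv]
  calc ‖w - 1‖⁻¹ * ‖riemannZeta₁ w‖ ≤ 1 * ‖riemannZeta₁ w‖ := by
        gcongr
        exact inv_le_one_of_one_le₀ hw1
    _ ≤ 3 * (1 + ‖w‖) ^ 2 := by rw [one_mul]; exact norm_riemannZeta₁_le_of_half_le_re hw
    _ ≤ Real.exp (2 * (1 + ‖w‖)) := three_mul_one_add_sq_le_exp (norm_nonneg w)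
    _ ≤ Real.exp (2 * (1 + ‖w‖) ^ (3 / 2 : ℝ)) := by
        gcongr
        exact le_rpow_three_halves (by linarith [norm_nonneg w])

lemma norm_riemannZeta_one_sub_le {w : ℂ} (hw : 1 / 2 ≤ w.re) (hw1 : 1 ≤ ‖w - 1‖) :
    ‖riemannZeta (1 - w)‖ ≤ Real.exp (14 * (1 + ‖w‖) ^ (3 / 2 : ℝ)) := by
  have hw0 : 0 < w.re := by linarith
  have hne : w ≠ 1 := fun h ↦ by norm_num [h] at hw1
  set Y := (1 + ‖w‖) ^ (3 / 2 : ℝ)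
  have hY : 1 + ‖w‖ ≤ Y := le_rpow_three_halves (by linarith [norm_nonneg w])
  have h2 : 2 ≤ Real.exp Y := by linarith [Real.add_one_le_exp Y, norm_nonneg w]
  have hpow : ‖(2 * (Real.pi : ℂ)) ^ (-w)‖ ≤ 1 := by
    rw [show (2 * (Real.pi : ℂ)) = ((2 * Real.pi : ℝ) : ℂ) by push_cast; rfl,
      norm_cpow_eq_rpow_re_of_pos (by positivity)]
    exact Real.rpow_le_one_of_one_le_of_nonpos (by linarith [Real.pi_gt_three])
      (by rw [neg_re]; linarith)
  have hGamma := norm_Gamma_le_exp_rpow hw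
  have hcos : ‖cos (Real.pi * w / 2)‖ ≤ Real.exp (2 * Y) := by
    refine (norm_cos_le_exp_norm _).trans (Real.exp_le_exp.2 ?_)
    rw [norm_div, norm_mul, norm_real, Real.norm_eq_abs, abs_of_pos Real.pi_pos, norm_ofNat]
    nlinarith [Real.pi_le_four, norm_nonneg w]
  have hzeta := norm_riemannZeta_le_exp_rpow hw hw1
  have hpole : ∀ n : ℕ, w ≠ -n := fun n hn ↦ by
    have : w.re ≤ 0 := by simp [hn]
    linarith
  rw [riemannZeta_one_sub hpole hne]
  calc _ = 2 * ‖(2 * (Real.pi : ℂ)) ^ (-w)‖ * ‖Gamma w‖ * ‖cos (Real.pi * w / 2)‖ *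
        ‖riemannZeta w‖ := by simp only [norm_mul, norm_ofNat]
    _ ≤ Real.exp Y * 1 * Real.exp (9 * Y) * Real.exp (2 * Y) * Real.exp (2 * Y) := by gcongr
    _ = Real.exp (14 * Y) := by
        rw [mul_one, ← Real.exp_add, ← Real.exp_add, ← Real.exp_add]
        ring_nf

lemma exists_norm_riemannZeta₁_le :
    ∃ C : ℝ, 0 ≤ C ∧ ∀ z, ‖riemannZeta₁ z‖ ≤ Real.exp (C * (1 + ‖z‖) ^ (3 / 2 : ℝ)) := by
  obtain ⟨A, hA⟩ := (isCompact_closedBall (0 : ℂ) 1).exists_bound_of_continuousOn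
    differentiable_riemannZeta₁.continuous.continuousOn
  refine ⟨|A| + 60, by positivity, fun z ↦ ?_⟩
  set X := (1 + ‖z‖) ^ (3 / 2 : ℝ)
  have hX : 1 + ‖z‖ ≤ X := le_rpow_three_halves (by linarith [norm_nonneg z])
  have hX1 : 1 ≤ X := by linarith [norm_nonneg z]
  have hAX : |A| ≤ |A| * X := le_mul_of_one_le_right (abs_nonneg A) hX1
  rcases le_or_gt ‖z‖ 1 with hz | hz
  · calc ‖riemannZeta₁ z‖ ≤ |A| := (hA z (by simpa using hz)).trans (le_abs_self A)
      _ ≤ Real.exp |A| := by linarith [Real.add_one_le_exp |A|]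
      _ ≤ Real.exp ((|A| + 60) * X) := Real.exp_le_exp.2 (by linarith)
  rcases le_or_gt (1 / 2) z.re with hre | hre
  · calc ‖riemannZeta₁ z‖ ≤ Real.exp (2 * (1 + ‖z‖)) :=
          (norm_riemannZeta₁_le_of_half_le_re hre).trans
            (three_mul_one_add_sq_le_exp (norm_nonneg z))
      _ ≤ Real.exp ((|A| + 60) * X) := Real.exp_le_exp.2 (by linarith [abs_nonneg A])
  · have hne : z ≠ 1 := fun h ↦ by norm_num [h] at hre
    have hz1 : ‖z - 1‖ ≤ 1 + ‖z‖ := by simpa [add_comm] using norm_sub_le z 1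
    have hw : ‖1 - z‖ ≤ 1 + ‖z‖ := by rwa [norm_sub_rev]
    have hY : (1 + ‖1 - z‖) ^ (3 / 2 : ℝ) ≤ 4 * X :=
      (Real.rpow_le_rpow (by positivity) (by linarith) (by norm_num)).trans
        (two_mul_rpow_three_halves_le (by positivity))
    have hzeta := norm_riemannZeta_one_sub_le (w := 1 - z) (by rw [sub_re, one_re]; linarith)
      (by simpa using hz.le)
    rw [sub_sub_cancel] at hzeta
    rw [riemannZeta₁_eq_sub_mul hne, norm_mul]
    calc ‖z - 1‖ * ‖riemannZeta z‖ ≤ Real.exp X * Real.exp (14 * (4 * X)) := by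
          gcongr
          · linarith [Real.add_one_le_exp X]
          · exact hzeta.trans (by gcongr)
      _ = Real.exp (57 * X) := by rw [← Real.exp_add]; ring_nf
      _ ≤ Real.exp ((|A| + 60) * X) := Real.exp_le_exp.2 (by linarith [abs_nonneg A])

lemma re_lt_one_of_riemannZeta_eq_zero {ρ : ℂ} (h : riemannZeta ρ = 0) : ρ.re < 1 := by
  by_contra! h1
  exact riemannZeta_ne_zero_of_one_le_re h1 h

lemma exists_eq_neg_two_mul_of_riemannZeta_eq_zero {ρ : ℂ} (h : riemannZeta ρ = 0)
    (hre : ρ.re ≤ 0) : ∃ n : ℕ, ρ = -2 * (n + 1) := by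
  obtain ⟨w, rfl⟩ : ∃ w, ρ = 1 - w := ⟨1 - ρ, by ring⟩
  have hw : 1 ≤ w.re := by simpa using hre
  have hw1 : w ≠ 1 := by
    rintro rfl
    norm_num [riemannZeta_zero] at h
  have hpole : ∀ n : ℕ, w ≠ -n := fun n hn ↦ by
    have : w.re ≤ 0 := by simp [hn]
    linarith
  have hcos : cos (Real.pi * w / 2) = 0 := by
    have hpow : (2 * (Real.pi : ℂ)) ^ (-w) ≠ 0 := by simp [cpow_eq_zero_iff, Real.pi_ne_zero]
    simpa [riemannZeta_one_sub hpole hw1, riemannZeta_ne_zero_of_one_le_re hw,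
      Complex.Gamma_ne_zero hpole, hpow] using h
  obtain ⟨k, hk⟩ := Complex.cos_eq_zero_iff.1 hcos
  have hwk : w = ((2 * k + 1 : ℤ) : ℂ) := by
    have hpi : (Real.pi : ℂ) ≠ 0 := mod_cast Real.pi_ne_zero
    field_simp at hk
    simpa using hk
  have hk1 : 1 ≤ k := by
    have h1 : 1 ≤ 2 * k + 1 := by
      rw [hwk, intCast_re] at hw
      exact_mod_cast hw
    have h0 : k ≠ 0 := by
      rintro rfl
      exact hw1 (by simp [hwk])
    lia
  obtain ⟨n, rfl⟩ := Int.exists_add_of_le hk1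
  exact ⟨n, by rw [hwk]; push_cast; ring⟩

lemma ne_one_of_mem_riemannZetaZeros (ρ : riemannZetaZeros) : (ρ : ℂ) ≠ 1 := fun h ↦
  riemannZeta_one_ne_zero (h ▸ ρ.2)

lemma summable_analyticOrderNatAt_riemannZeta_div_sq :
    Summable fun ρ : riemannZetaZeros ↦
      (analyticOrderNatAt riemannZeta ρ : ℝ) / (1 + ‖(ρ : ℂ)‖) ^ 2 := by
  obtain ⟨C, hC, hb⟩ := exists_norm_riemannZeta₁_le
  refine ((summable_analyticOrderNatAt_div_sq differentiable_riemannZeta₁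
    riemannZeta₁_zero_ne_zero hC (by norm_num) (by norm_num) hb).subtype
      riemannZetaZeros).congr fun ρ ↦ ?_
  rw [Function.comp_apply, analyticOrderNatAt_riemannZeta₁ (ne_one_of_mem_riemannZetaZeros ρ)]

theorem hasSum_logDeriv_riemannZeta {s : ℂ} (hs1 : s ≠ 1) (hs : riemannZeta s ≠ 0) :
    HasSum (fun ρ : riemannZetaZeros ↦
      (analyticOrderNatAt riemannZeta ρ : ℂ) * (1 / (s - (ρ : ℂ)) + 1 / (ρ : ℂ)))
      (1 / (s - 1) + logDeriv riemannZeta s - logDeriv riemannZeta₁ 0) := by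
  obtain ⟨C, hC, hb⟩ := exists_norm_riemannZeta₁_le
  have h := hasSum_logDeriv_sub_logDeriv_zero differentiable_riemannZeta₁
    riemannZeta₁_zero_ne_zero hC (by norm_num) (by norm_num) hb (s := s)
    (by rwa [Ne, riemannZeta₁_eq_zero_iff])
  have hset : {z : ℂ | riemannZeta₁ z = 0} = riemannZetaZeros := by
    ext z
    exact riemannZeta₁_eq_zero_iff
  have hlog : logDeriv riemannZeta₁ s = 1 / (s - 1) + logDeriv riemannZeta s := by
    rw [(logDeriv_congr_nhds (riemannZeta₁_eventuallyEq hs1)).self_of_nhds,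
      logDeriv_mul (f := fun s : ℂ ↦ s - 1) s (sub_ne_zero.2 hs1) hs (by fun_prop)
        (differentiableAt_riemannZeta hs1)]
    simp [logDeriv_apply]
  rw [hset, hlog] at h
  refine h.congr_fun fun ρ ↦ ?_
  rw [analyticOrderNatAt_riemannZeta₁ (ne_one_of_mem_riemannZetaZeros ρ)]

end ZetaFunction

section PowerIntegrals

open Complex Set MeasureTheory

variable {a c : ℝ} {s : ℂ}

lemma integrableOn_and_integral_Ioi_sub_mul_cpow (hc : 0 < c) (hs : 0 < s.re) :
    IntegrableOn (fun x : ℝ ↦ ((x : ℂ) - c) * (x : ℂ) ^ (-s - 2)) (Ioi c) ∧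
      ∫ x in Ioi c, ((x : ℂ) - c) * (x : ℂ) ^ (-s - 2) = (c : ℂ) ^ (-s) / (s * (s + 1)) := by
  have hint1 := integrableOn_Ioi_cpow_of_lt (a := -s - 1) (by simp; linarith) hc
  have hint2 :=
    (integrableOn_Ioi_cpow_of_lt (a := -s - 2) (by simp; linarith) hc).const_mul (c : ℂ)
  have hsplit : ∀ x ∈ Ioi c, (x : ℂ) ^ (-s - 1) - c * (x : ℂ) ^ (-s - 2)
      = ((x : ℂ) - c) * (x : ℂ) ^ (-s - 2) := by
    intro x hx
    have hx0 : (x : ℂ) ≠ 0 := by exact_mod_cast (hc.trans hx).ne'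
    rw [show -s - 1 = (-s - 2) + 1 by ring, cpow_add _ _ hx0, cpow_one]
    ring
  have hc0 : (c : ℂ) ≠ 0 := by exact_mod_cast hc.ne'
  have hs0 : s ≠ 0 := ne_zero_of_re_pos hs
  have hs1 : s + 1 ≠ 0 := ne_zero_of_re_pos (by simp; linarith)
  have hs1' : -s - 1 ≠ 0 := by rwa [show -s - 1 = -(s + 1) by ring, neg_ne_zero]
  refine ⟨(hint1.sub hint2).congr_fun hsplit measurableSet_Ioi, ?_⟩
  rw [← setIntegral_congr_fun measurableSet_Ioi hsplit, integral_sub hint1 hint2,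
    integral_const_mul, integral_Ioi_cpow_of_lt (by simp; linarith) hc,
    integral_Ioi_cpow_of_lt (by simp; linarith) hc, show -s - 1 + 1 = -s by ring,
    show -s - 2 + 1 = -s - 1 by ring, cpow_sub _ _ hc0, cpow_one]
  field_simp
  ring

lemma integrableOn_and_integral_Ioi_max_sub_mul_cpow (hac : a ≤ c) (hc : 0 < c) (hs : 0 < s.re) :
    IntegrableOn (fun x : ℝ ↦ ((max (x - c) 0 : ℝ) : ℂ) * (x : ℂ) ^ (-s - 2)) (Ioi a) ∧
      ∫ x in Ioi a, ((max (x - c) 0 : ℝ) : ℂ) * (x : ℂ) ^ (-s - 2)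
        = (c : ℂ) ^ (-s) / (s * (s + 1)) := by
  obtain ⟨hint, hval⟩ := integrableOn_and_integral_Ioi_sub_mul_cpow hc hs
  have hIoi : ∀ x ∈ Ioi c, ((x : ℂ) - c) * (x : ℂ) ^ (-s - 2)
      = ((max (x - c) 0 : ℝ) : ℂ) * (x : ℂ) ^ (-s - 2) := by
    intro x hx
    rw [max_eq_left (sub_nonneg.2 (mem_Ioi.1 hx).le), ofReal_sub]
  have hsdiff : ∀ x ∈ Ioi a \ Ioi c,
      ((max (x - c) 0 : ℝ) : ℂ) * (x : ℂ) ^ (-s - 2) = 0 := by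
    intro x hx
    rw [max_eq_right (sub_nonpos.2 (not_lt.1 hx.2)), ofReal_zero, zero_mul]
  refine ⟨IntegrableOn.of_forall_sdiff_eq_zero (hint.congr_fun hIoi measurableSet_Ioi)
    measurableSet_Ioi hsdiff, ?_⟩
  rw [setIntegral_eq_of_subset_of_forall_sdiff_eq_zero measurableSet_Ioi (Ioi_subset_Ioi hac)
    hsdiff, ← setIntegral_congr_fun measurableSet_Ioi hIoi, hval]

lemma integral_Ioi_norm_max_sub_mul_cpow (ha : 0 ≤ a) (hac : a ≤ c) (hc : 0 < c)
    (hs : 0 < s.re) :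
    ∫ x in Ioi a, ‖((max (x - c) 0 : ℝ) : ℂ) * (x : ℂ) ^ (-s - 2)‖
      = c ^ (-s.re) / (s.re * (s.re + 1)) := by
  have hval := (integrableOn_and_integral_Ioi_max_sub_mul_cpow (s := s.re) hac hc
    (by simpa using hs)).2
  rw [← ofReal_neg, ← ofReal_cpow hc.le] at hval
  suffices h : ∀ x ∈ Ioi a, ((max (x - c) 0 : ℝ) : ℂ) * (x : ℂ) ^ ((-s.re : ℝ) - 2 : ℂ)
      = (‖((max (x - c) 0 : ℝ) : ℂ) * (x : ℂ) ^ (-s - 2)‖ : ℝ) by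
    rw [setIntegral_congr_fun measurableSet_Ioi h, integral_complex_ofReal] at hval
    exact_mod_cast hval
  intro x hx
  have hx0 : 0 < x := ha.trans_lt hx
  rw [norm_mul, norm_cpow_eq_rpow_re_of_pos hx0, norm_real, Real.norm_of_nonneg (le_max_right _ _),
    ofReal_mul, ofReal_cpow hx0.le]
  simp

lemma integral_Ioi_tsum_mul_max_sub_mul_cpow {f : ℕ → ℂ} (hf0 : f 0 = 0)
    (hf : LSeriesSummable f s) (hs : 0 < s.re) :
    ∫ x in Ioi (1 : ℝ), (∑' n : ℕ, f n * (max (x - n) 0 : ℝ)) * (x : ℂ) ^ (-s - 2)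
      = LSeries f s / (s * (s + 1)) := by
  have hint (n : ℕ) (hn : 0 < n) := integrableOn_and_integral_Ioi_max_sub_mul_cpow
    (a := 1) (c := n) (by exact_mod_cast hn) (by exact_mod_cast hn) hs
  have hnorm (n : ℕ) (hn : 0 < n) := integral_Ioi_norm_max_sub_mul_cpow (c := n)
    zero_le_one (by exact_mod_cast hn) (by exact_mod_cast hn) hs
  have hterm_int (n : ℕ) : IntegrableOn
      (fun x : ℝ ↦ f n * (((max (x - n) 0 : ℝ) : ℂ) * (x : ℂ) ^ (-s - 2))) (Ioi 1) := by
    rcases n.eq_zero_or_pos with rfl | hn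
    · simp [hf0]
    · exact (hint n hn).1.const_mul _
  have hterm_norm (n : ℕ) :
      ∫ x in Ioi (1 : ℝ), ‖f n * (((max (x - n) 0 : ℝ) : ℂ) * (x : ℂ) ^ (-s - 2))‖
        = ‖LSeries.term f s n‖ / (s.re * (s.re + 1)) := by
    rcases n.eq_zero_or_pos with rfl | hn
    · simp [hf0]
    · simp_rw [norm_mul (f n)]
      rw [integral_const_mul, hnorm n hn, LSeries.norm_term_eq, if_neg hn.ne',
        Real.rpow_neg n.cast_nonneg]
      ring
  have hterm (n : ℕ) :
      ∫ x in Ioi (1 : ℝ), f n * (((max (x - n) 0 : ℝ) : ℂ) * (x : ℂ) ^ (-s - 2))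
        = LSeries.term f s n / (s * (s + 1)) := by
    rcases n.eq_zero_or_pos with rfl | hn
    · simp [hf0]
    · rw [integral_const_mul, (hint n hn).2, LSeries.term_def₀ hf0, ofReal_natCast]
      ring
  have hsummable : Summable fun n : ℕ ↦
      ∫ x in Ioi (1 : ℝ), ‖f n * (((max (x - n) 0 : ℝ) : ℂ) * (x : ℂ) ^ (-s - 2))‖ := by
    simp only [hterm_norm]
    exact hf.norm.div_const _
  rw [LSeries, ← tsum_div_const, ← tsum_congr hterm,
    integral_tsum_of_summable_integral_norm hterm_int hsummable]
  simp only [← tsum_mul_right, mul_assoc]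

lemma integrableOn_and_integral_Ioi_cpow_sub_one_mul_cpow {z : ℂ} (hz : z.re < s.re)
    (hs : -1 < s.re) :
    IntegrableOn (fun x : ℝ ↦ ((x : ℂ) ^ (z + 1) - 1) * (x : ℂ) ^ (-s - 2)) (Ioi 1) ∧
      ∫ x in Ioi (1 : ℝ), ((x : ℂ) ^ (z + 1) - 1) * (x : ℂ) ^ (-s - 2)
        = (z + 1) / ((s - z) * (s + 1)) := by
  have hint1 : IntegrableOn (fun x : ℝ ↦ (x : ℂ) ^ (z - s - 1)) (Ioi 1) :=
    integrableOn_Ioi_cpow_of_lt (by simp; linarith) zero_lt_one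
  have hint2 : IntegrableOn (fun x : ℝ ↦ (x : ℂ) ^ (-s - 2)) (Ioi 1) :=
    integrableOn_Ioi_cpow_of_lt (by simp; linarith) zero_lt_one
  have hsplit : ∀ x ∈ Ioi (1 : ℝ), (x : ℂ) ^ (z - s - 1) - (x : ℂ) ^ (-s - 2)
      = ((x : ℂ) ^ (z + 1) - 1) * (x : ℂ) ^ (-s - 2) := by
    intro x hx
    have hx0 : (x : ℂ) ≠ 0 := by exact_mod_cast (zero_lt_one.trans (mem_Ioi.1 hx)).ne'
    rw [show z - s - 1 = (z + 1) + (-s - 2) by ring, cpow_add _ _ hx0]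
    ring
  have hsz : s - z ≠ 0 := ne_zero_of_re_pos (by simpa using hz)
  have hs1 : s + 1 ≠ 0 := ne_zero_of_re_pos (by simp; linarith)
  refine ⟨(hint1.sub hint2).congr_fun hsplit measurableSet_Ioi, ?_⟩
  rw [← setIntegral_congr_fun measurableSet_Ioi hsplit, integral_sub hint1 hint2,
    integral_Ioi_cpow_of_lt (by simp; linarith) zero_lt_one,
    integral_Ioi_cpow_of_lt (by simp; linarith) zero_lt_one,
    show z - s - 1 + 1 = -(s - z) by ring, show -s - 2 + 1 = -(s + 1) by ring]
  simp only [ofReal_one, one_cpow]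
  field_simp
  ring

lemma integral_Ioi_sub_one_polynomial_mul_cpow (b : ℂ) (hs : 1 < s.re) :
    ∫ x in Ioi (1 : ℝ), (((x : ℂ) - 1) ^ 2 / 2 - b * ((x : ℂ) - 1)) * (x : ℂ) ^ (-s - 2)
      = (1 / (s - 1) - b) / (s * (s + 1)) := by
  obtain ⟨hint1, hval1⟩ := integrableOn_and_integral_Ioi_cpow_sub_one_mul_cpow (z := 1) (s := s)
    (by simpa using hs) (by linarith)
  obtain ⟨hint0, hval0⟩ := integrableOn_and_integral_Ioi_cpow_sub_one_mul_cpow (z := 0) (s := s)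
    (by simp; linarith) (by linarith)
  have hsplit (x : ℝ) : (((x : ℂ) - 1) ^ 2 / 2 - b * ((x : ℂ) - 1)) * (x : ℂ) ^ (-s - 2)
      = 1 / 2 * (((x : ℂ) ^ (1 + 1 : ℂ) - 1) * (x : ℂ) ^ (-s - 2))
        - (1 + b) * (((x : ℂ) ^ (0 + 1 : ℂ) - 1) * (x : ℂ) ^ (-s - 2)) := by
    rw [one_add_one_eq_two, zero_add, cpow_ofNat, cpow_one]
    ring
  have hs0 : s ≠ 0 := ne_zero_of_re_pos (by linarith)
  have hs1 : s + 1 ≠ 0 := ne_zero_of_re_pos (by simp; linarith)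
  have hs1' : s - 1 ≠ 0 := ne_zero_of_re_pos (by simpa using hs)
  simp only [hsplit]
  rw [integral_sub (hint1.const_mul _) (hint0.const_mul _), integral_const_mul,
    integral_const_mul, hval1, hval0, sub_zero]
  field_simp
  ring

lemma integrableOn_Ioi_mul_cpow_of_norm_le {g : ℝ → ℂ} {A : ℝ} {n : ℕ} (ha : 0 < a)
    (hg : ContinuousOn g (Ioi a)) (hgn : ∀ x, a < x → ‖g x‖ ≤ A * x ^ n)
    (hs : s.re + n < -1) :
    IntegrableOn (fun x : ℝ ↦ g x * (x : ℂ) ^ s) (Ioi a) := by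
  have hcont : ContinuousOn (fun x : ℝ ↦ g x * (x : ℂ) ^ s) (Ioi a) :=
    hg.mul fun x hx ↦ (continuousAt_ofReal_cpow_const _ _
      (Or.inr (ha.trans hx).ne')).continuousWithinAt
  refine Integrable.mono' ((integrableOn_Ioi_rpow_of_lt hs ha).const_mul A)
    (hcont.aestronglyMeasurable measurableSet_Ioi)
    ((ae_restrict_iff' measurableSet_Ioi).2 (Filter.Eventually.of_forall fun x hx ↦ ?_))
  have hx0 : 0 < x := ha.trans hx
  rw [norm_mul, norm_cpow_eq_rpow_re_of_pos hx0, add_comm, Real.rpow_add hx0, Real.rpow_natCast,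
    ← mul_assoc]
  exact mul_le_mul_of_nonneg_right (hgn x hx) (Real.rpow_nonneg hx0.le _)

lemma eqOn_of_forall_integral_Ioi_mul_cpow_eq {f g : ℝ → ℂ} {σ : ℝ} (ha : 0 ≤ a)
    (hf : ContinuousOn f (Ioi a)) (hg : ContinuousOn g (Ioi a))
    (hfi : ∀ w : ℂ, w.re = σ → IntegrableOn (fun x : ℝ ↦ f x * (x : ℂ) ^ w) (Ioi a))
    (hgi : ∀ w : ℂ, w.re = σ → IntegrableOn (fun x : ℝ ↦ g x * (x : ℂ) ^ w) (Ioi a))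
    (h : ∀ w : ℂ, w.re = σ →
      ∫ x in Ioi a, f x * (x : ℂ) ^ w = ∫ x in Ioi a, g x * (x : ℂ) ^ w) :
    EqOn f g (Ioi a) := by
  set E : ℝ → ℂ := (Ioi a).indicator (f - g)
  have hE (w : ℂ) : (fun x : ℝ ↦ (x : ℂ) ^ (w - 1) • E x) = (Ioi a).indicator
      fun x : ℝ ↦ f x * (x : ℂ) ^ (w - 1) - g x * (x : ℂ) ^ (w - 1) := by
    ext x
    by_cases hx : x ∈ Ioi a
    · simp only [E, indicator_of_mem hx, Pi.sub_apply, smul_eq_mul]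
      ring
    · simp only [E, indicator_of_notMem hx, smul_zero]
  have hmellin (w : ℂ) (hw : w.re = σ + 1) : mellin E w = 0 := by
    have hre : (w - 1).re = σ := by simp [hw]
    rw [mellin, hE, setIntegral_indicator measurableSet_Ioi, Ioi_inter_Ioi, max_eq_right ha,
      integral_sub (hfi _ hre) (hgi _ hre), h _ hre, sub_self]
  have hconv : MellinConvergent E ((σ + 1 : ℝ) : ℂ) := by
    have hre : (((σ + 1 : ℝ) : ℂ) - 1).re = σ := by simp
    rw [MellinConvergent, hE]
    exact ((integrable_indicator_iff measurableSet_Ioi).2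
      ((hfi _ hre).sub (hgi _ hre))).integrableOn
  have hzero (y : ℝ) : mellin E ((σ + 1 : ℝ) + y * I) = 0 := hmellin _ (by simp)
  intro x hx
  have hEx : ContinuousAt E x := ((hf.sub hg).continuousAt (Ioi_mem_nhds hx)).congr
    (eqOn_indicator.symm.eventuallyEq_of_mem (Ioi_mem_nhds hx))
  have hinv := mellinInv_mellin_eq (σ + 1) E (ha.trans_lt hx) hconv
    (by simp only [VerticalIntegrable, hzero]; exact integrable_zero _ _ _) hEx
  simp only [mellinInv, hzero, smul_zero, integral_zero] at hinv
  simpa [E, indicator_of_mem hx, sub_eq_zero] using hinv.symm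

end PowerIntegrals

section ExplicitFormula

open Complex Metric Set Filter Topology MeasureTheory
open ArithmeticFunction (vonMangoldt)

/-- The integrated Chebyshev function `∑_{n ≤ x} Λ(n) (x - n)`. -/
noncomputable def psiOne (x : ℝ) : ℝ :=
  ∑ n ∈ Finset.Ioc 0 ⌊x⌋₊, vonMangoldt n * (x - n)

lemma hasSum_psiOne (x : ℝ) : HasSum (fun n : ℕ ↦ vonMangoldt n * max (x - n) 0) (psiOne x) := by
  have hpsi : psiOne x = ∑ n ∈ Finset.Ioc 0 ⌊x⌋₊, vonMangoldt n * max (x - n) 0 := by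
    refine Finset.sum_congr rfl fun n hn ↦ ?_
    obtain ⟨hn0, hnx⟩ := Finset.mem_Ioc.1 hn
    rw [max_eq_left (sub_nonneg.2 ((Nat.le_floor_iff' hn0.ne').1 hnx))]
  rw [hpsi]
  refine hasSum_sum_of_ne_finset_zero fun n hn ↦ ?_
  rcases n.eq_zero_or_pos with rfl | hn0
  · simp
  · have hnx : x < n := Nat.lt_of_floor_lt (by simpa [hn0] using hn)
    rw [max_eq_right (sub_nonpos.2 hnx.le), mul_zero]

lemma psiOne_eq_sum_Ioc {x : ℝ} {M : ℕ} (hM : x ≤ M + 1) :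
    psiOne x = ∑ n ∈ Finset.Ioc 0 M, vonMangoldt n * max (x - n) 0 := by
  refine (hasSum_psiOne x).unique (hasSum_sum_of_ne_finset_zero fun n hn ↦ ?_)
  rcases n.eq_zero_or_pos with rfl | hn0
  · simp
  · have hMn : (M : ℝ) + 1 ≤ n := by exact_mod_cast show M < n by simpa [hn0] using hn
    rw [max_eq_right (by linarith), mul_zero]

lemma psiOne_nonneg (x : ℝ) : 0 ≤ psiOne x :=
  (hasSum_psiOne x).nonneg fun _ ↦
    mul_nonneg ArithmeticFunction.vonMangoldt_nonneg (le_max_right _ _)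

lemma psiOne_eq_zero {x : ℝ} (hx : x ≤ 1) : psiOne x = 0 := by
  simp [psiOne_eq_sum_Ioc (M := 0) (by simpa using hx)]

lemma continuous_psiOne : Continuous psiOne := by
  refine continuous_iff_continuousAt.2 fun x ↦ ?_
  obtain ⟨M, hM⟩ := exists_nat_gt x
  have hloc : (fun y : ℝ ↦ ∑ n ∈ Finset.Ioc 0 M, vonMangoldt n * max (y - n) 0) =ᶠ[𝓝 x]
      psiOne := by
    filter_upwards [Iio_mem_nhds hM] with y hy
    exact (psiOne_eq_sum_Ioc (by linarith [mem_Iio.1 hy])).symm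
  exact ContinuousAt.congr (by fun_prop) hloc

lemma psiOne_le_mul_sq {x : ℝ} (hx : 0 ≤ x) : psiOne x ≤ (Real.log 4 + 4) * x ^ 2 :=
  calc psiOne x ≤ Chebyshev.psi x * x := by
        rw [psiOne, Chebyshev.psi, Finset.sum_mul]
        exact Finset.sum_le_sum fun n _ ↦ mul_le_mul_of_nonneg_left
          (sub_le_self _ n.cast_nonneg) ArithmeticFunction.vonMangoldt_nonneg
    _ ≤ (Real.log 4 + 4) * x * x := by
        gcongr
        exact Chebyshev.psi_le_const_mul_self hx
    _ = (Real.log 4 + 4) * x ^ 2 := by ring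

lemma integral_psiOne_mul_cpow {s : ℂ} (hs : 1 < s.re) :
    ∫ x in Ioi (1 : ℝ), (psiOne x : ℂ) * (x : ℂ) ^ (-s - 2)
      = -logDeriv riemannZeta s / (s * (s + 1)) := by
  rw [logDeriv_apply, ← neg_div,
    ← ArithmeticFunction.LSeries_vonMangoldt_eq_deriv_riemannZeta_div hs,
    ← integral_Ioi_tsum_mul_max_sub_mul_cpow (by simp)
      (ArithmeticFunction.LSeriesSummable_vonMangoldt hs) (zero_lt_one.trans hs)]
  congr! 3 with x
  rw [← (hasSum_psiOne x).tsum_eq, ofReal_tsum]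
  simp only [ofReal_mul]

lemma countable_riemannZetaZeros : Countable riemannZetaZeros :=
  (IsLindelof.countable_of_isDiscrete (HereditarilyLindelofSpace.isLindelof riemannZetaZeros)
    isDiscrete_riemannZetaZeros).to_subtype

lemma ne_zero_of_mem_riemannZetaZeros (ρ : riemannZetaZeros) : (ρ : ℂ) ≠ 0 := by
  intro h
  have hζ := mem_riemannZetaZeros.1 ρ.2
  norm_num [h, riemannZeta_zero] at hζ

lemma add_one_ne_zero_of_mem_riemannZetaZeros (ρ : riemannZetaZeros) : (ρ : ℂ) + 1 ≠ 0 := by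
  intro h
  have hρ : (ρ : ℂ) = -1 := eq_neg_of_add_eq_zero_left h
  obtain ⟨n, hn⟩ := exists_eq_neg_two_mul_of_riemannZeta_eq_zero ρ.2 (by simp [hρ])
  have hnat : (2 * (n + 1) : ℕ) = (1 : ℕ) := by
    have hcast : (1 : ℂ) = 2 * (n + 1) := by linear_combination hρ - hn
    exact_mod_cast hcast.symm
  lia

/-- The multiplicity of a zero `ρ` of the zeta function divided by `ρ (ρ + 1)`: the coefficient of
`x ^ (ρ + 1)` in the explicit formula for `psiOne`. -/
noncomputable def zeroWeight (ρ : ℂ) : ℂ :=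
  analyticOrderNatAt riemannZeta ρ / (ρ * (ρ + 1))

lemma summable_norm_zeroWeight : Summable fun ρ : riemannZetaZeros ↦ ‖zeroWeight ρ‖ := by
  refine Summable.of_norm_bounded_eventually
    (summable_analyticOrderNatAt_riemannZeta_div_sq.mul_left 8) ?_
  have hfin : {ρ : riemannZetaZeros | ‖(ρ : ℂ)‖ ≤ 2}.Finite :=
    (((isCompact_closedBall (0 : ℂ) 2).inter_riemannZetaZeros_finite).subset
      (by rintro _ ⟨ρ, hρ, rfl⟩; exact ⟨by simpa using hρ, ρ.2⟩)).of_finite_image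
        Subtype.val_injective.injOn
  filter_upwards [hfin.compl_mem_cofinite] with ρ hρ
  have hρ2 : 2 < ‖(ρ : ℂ)‖ := not_le.1 hρ
  have hρ1 : ‖(ρ : ℂ)‖ - 1 ≤ ‖(ρ : ℂ) + 1‖ := by simpa using norm_sub_norm_le (ρ : ℂ) (-1)
  have hle : (1 + ‖(ρ : ℂ)‖) ^ 2 ≤ 8 * (‖(ρ : ℂ)‖ * ‖(ρ : ℂ) + 1‖) := by nlinarith
  rw [norm_norm, zeroWeight, norm_div, norm_mul, Complex.norm_natCast, ← mul_div_assoc,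
    div_le_div_iff₀ (by nlinarith) (by positivity)]
  linarith [mul_le_mul_of_nonneg_left hle
    (Nat.cast_nonneg (α := ℝ) (analyticOrderNatAt riemannZeta ρ))]

lemma norm_cpow_add_one_sub_one_le {x : ℝ} (hx : 1 ≤ x) {z : ℂ} (hz : z.re ≤ 1) :
    ‖(x : ℂ) ^ (z + 1) - 1‖ ≤ 2 * x ^ 2 := by
  have hcpow : ‖(x : ℂ) ^ (z + 1)‖ ≤ x ^ 2 := by
    rw [norm_cpow_eq_rpow_re_of_pos (by linarith), ← Real.rpow_natCast]
    refine Real.rpow_le_rpow_of_exponent_le hx ?_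
    simp only [add_re, one_re, Nat.cast_ofNat]
    linarith
  have hsub := norm_sub_le ((x : ℂ) ^ (z + 1)) 1
  rw [norm_one] at hsub
  nlinarith

lemma norm_zeroWeight_mul_le {x : ℝ} (hx : 1 ≤ x) (ρ : riemannZetaZeros) :
    ‖zeroWeight ρ * ((x : ℂ) ^ ((ρ : ℂ) + 1) - 1)‖ ≤ ‖zeroWeight ρ‖ * (2 * x ^ 2) := by
  rw [norm_mul]
  gcongr
  exact norm_cpow_add_one_sub_one_le hx (re_lt_one_of_riemannZeta_eq_zero ρ.2).le

lemma summable_zeroWeight_mul {x : ℝ} (hx : 1 ≤ x) :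
    Summable fun ρ : riemannZetaZeros ↦ zeroWeight ρ * ((x : ℂ) ^ ((ρ : ℂ) + 1) - 1) :=
  (summable_norm_zeroWeight.mul_right _).of_norm_bounded (norm_zeroWeight_mul_le hx)

/-- The contribution of all zeros of the zeta function to `psiOne`, normalised to vanish at `1`. -/
noncomputable def zeroSum (x : ℝ) : ℂ :=
  ∑' ρ : riemannZetaZeros, zeroWeight ρ * ((x : ℂ) ^ ((ρ : ℂ) + 1) - 1)

lemma norm_zeroSum_le {x : ℝ} (hx : 1 ≤ x) :
    ‖zeroSum x‖ ≤ (∑' ρ : riemannZetaZeros, ‖zeroWeight ρ‖) * 2 * x ^ 2 := by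
  rw [mul_assoc, ← tsum_mul_right]
  exact tsum_of_norm_bounded (summable_norm_zeroWeight.mul_right _).hasSum
    (norm_zeroWeight_mul_le hx)

lemma continuousOn_zeroSum : ContinuousOn zeroSum (Ioi 1) := by
  intro x hx
  have hloc : ContinuousOn zeroSum (Ioo 1 (x + 1)) := by
    refine continuousOn_tsum
      (u := fun ρ : riemannZetaZeros ↦ ‖zeroWeight ρ‖ * (2 * (x + 1) ^ 2)) (fun ρ y hy ↦ ?_)
      (summable_norm_zeroWeight.mul_right _) fun ρ y hy ↦ ?_
    · have hy0 : y ≠ 0 := by linarith [hy.1]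
      exact (((continuousAt_ofReal_cpow_const _ _ (Or.inr hy0)).sub
        continuousAt_const).const_mul _).continuousWithinAt
    · have hy0 : 0 ≤ y := by linarith [hy.1]
      refine (norm_zeroWeight_mul_le hy.1.le ρ).trans ?_
      gcongr
      exact hy.2.le
  exact (hloc.continuousAt (Ioo_mem_nhds hx (lt_add_one x))).continuousWithinAt

lemma integral_zeroSum_mul_cpow {s : ℂ} (hs : 1 < s.re) :
    ∫ x in Ioi (1 : ℝ), zeroSum x * (x : ℂ) ^ (-s - 2)
      = (1 / (s - 1) + logDeriv riemannZeta s - logDeriv riemannZeta₁ 0) / (s * (s + 1)) := by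
  have := countable_riemannZetaZeros
  have hint (ρ : riemannZetaZeros) := integrableOn_and_integral_Ioi_cpow_sub_one_mul_cpow
    (z := ρ) (s := s) ((re_lt_one_of_riemannZeta_eq_zero ρ.2).trans hs) (by linarith)
  have hbound_int : IntegrableOn (fun x : ℝ ↦ 2 * x ^ (-s.re)) (Ioi 1) :=
    (integrableOn_Ioi_rpow_of_lt (by linarith) zero_lt_one).const_mul 2
  have hbound (ρ : riemannZetaZeros) : ∀ x ∈ Ioi (1 : ℝ),
      ‖zeroWeight ρ * (((x : ℂ) ^ ((ρ : ℂ) + 1) - 1) * (x : ℂ) ^ (-s - 2))‖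
        ≤ ‖zeroWeight ρ‖ * (2 * x ^ (-s.re)) := by
    intro x hx
    have hx0 : 0 < x := zero_lt_one.trans hx
    rw [← mul_assoc, norm_mul, norm_cpow_eq_rpow_re_of_pos hx0]
    have hrpow : x ^ (-s.re) = x ^ 2 * x ^ (-s - 2).re := by
      rw [← Real.rpow_natCast x 2, ← Real.rpow_add hx0]
      simp
    rw [hrpow, ← mul_assoc, ← mul_assoc, mul_assoc ‖zeroWeight ρ‖]
    gcongr
    exact norm_zeroWeight_mul_le (le_of_lt hx) ρ
  have hsummable : Summable fun ρ : riemannZetaZeros ↦ ∫ x in Ioi (1 : ℝ),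
      ‖zeroWeight ρ * (((x : ℂ) ^ ((ρ : ℂ) + 1) - 1) * (x : ℂ) ^ (-s - 2))‖ := by
    refine Summable.of_nonneg_of_le (fun ρ ↦ integral_nonneg fun _ ↦ norm_nonneg _)
      (fun ρ ↦ setIntegral_mono_on ((hint ρ).1.const_mul _).norm (hbound_int.const_mul _)
        measurableSet_Ioi (hbound ρ)) ?_
    simp only [integral_const_mul]
    exact summable_norm_zeroWeight.mul_right _
  have hζ := (hasSum_logDeriv_riemannZeta (s := s) (by rintro rfl; simp at hs)
    (riemannZeta_ne_zero_of_one_lt_re hs)).div_const (s * (s + 1))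
  simp only [zeroSum, ← tsum_mul_right, mul_assoc (zeroWeight _)]
  rw [← integral_tsum_of_summable_integral_norm (fun ρ ↦ (hint ρ).1.const_mul _) hsummable,
    ← hζ.tsum_eq]
  refine tsum_congr fun ρ ↦ ?_
  have hρ0 := ne_zero_of_mem_riemannZetaZeros ρ
  have hρ1 := add_one_ne_zero_of_mem_riemannZetaZeros ρ
  have hs0 : s ≠ 0 := ne_zero_of_re_pos (by linarith)
  have hs1 : s + 1 ≠ 0 := ne_zero_of_re_pos (by simp; linarith)
  have hsρ : s - ρ ≠ 0 := ne_zero_of_re_pos (by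
    simpa using (re_lt_one_of_riemannZeta_eq_zero ρ.2).trans hs)
  rw [integral_const_mul, (hint ρ).2, zeroWeight]
  field_simp
  ring

lemma norm_sub_one_polynomial_le (b : ℂ) {x : ℝ} (hx : 1 ≤ x) :
    ‖((x : ℂ) - 1) ^ 2 / 2 - b * ((x : ℂ) - 1)‖ ≤ (1 + ‖b‖) * x ^ 2 := by
  have hx1 : ‖(x : ℂ) - 1‖ = x - 1 := by
    rw [← ofReal_one, ← ofReal_sub, norm_real, Real.norm_of_nonneg (by linarith)]
  refine (norm_sub_le _ _).trans ?_
  rw [norm_mul, norm_div, norm_pow, hx1, Complex.norm_ofNat, add_mul]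
  refine add_le_add (by nlinarith) ?_
  gcongr
  nlinarith

/-- Both sides have the same Mellin transform on the line `re s = 2`, where `ζ' / ζ` is given by its
Dirichlet series as well as by its partial fraction expansion. -/
theorem psiOne_eq_sub_zeroSum {x : ℝ} (hx : 1 ≤ x) :
    (psiOne x : ℂ)
      = ((x : ℂ) - 1) ^ 2 / 2 - logDeriv riemannZeta₁ 0 * ((x : ℂ) - 1) - zeroSum x := by
  rcases hx.eq_or_lt with rfl | hx
  · simp [psiOne_eq_zero le_rfl, zeroSum]
  set b := logDeriv riemannZeta₁ 0
  have hcont_psi : ContinuousOn (fun y : ℝ ↦ (psiOne y : ℂ)) (Ioi 1) :=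
    (continuous_ofReal.comp continuous_psiOne).continuousOn
  have hcont_poly : ContinuousOn
      (fun y : ℝ ↦ ((y : ℂ) - 1) ^ 2 / 2 - b * ((y : ℂ) - 1)) (Ioi 1) := by fun_prop
  have hint_psi (w : ℂ) (hw : w.re = -4) :
      IntegrableOn (fun y : ℝ ↦ (psiOne y : ℂ) * (y : ℂ) ^ w) (Ioi 1) := by
    refine integrableOn_Ioi_mul_cpow_of_norm_le (A := Real.log 4 + 4) (n := 2) zero_lt_one
      hcont_psi (fun y hy ↦ ?_) (by norm_num [hw])
    rw [norm_real, Real.norm_of_nonneg (psiOne_nonneg y)]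
    exact psiOne_le_mul_sq (by linarith)
  have hint_zero (w : ℂ) (hw : w.re = -4) :
      IntegrableOn (fun y : ℝ ↦ zeroSum y * (y : ℂ) ^ w) (Ioi 1) :=
    integrableOn_Ioi_mul_cpow_of_norm_le zero_lt_one continuousOn_zeroSum
      (fun y hy ↦ norm_zeroSum_le hy.le) (by norm_num [hw])
  have hint_poly (w : ℂ) (hw : w.re = -4) : IntegrableOn
      (fun y : ℝ ↦ (((y : ℂ) - 1) ^ 2 / 2 - b * ((y : ℂ) - 1)) * (y : ℂ) ^ w) (Ioi 1) :=
    integrableOn_Ioi_mul_cpow_of_norm_le zero_lt_one hcont_poly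
      (fun y hy ↦ norm_sub_one_polynomial_le b hy.le) (by norm_num [hw])
  refine eqOn_of_forall_integral_Ioi_mul_cpow_eq (σ := -4) zero_le_one hcont_psi
    (hcont_poly.sub continuousOn_zeroSum) hint_psi (fun w hw ↦ ?_) (fun w hw ↦ ?_) hx
  · simpa only [Pi.sub_apply, sub_mul _ (zeroSum _)] using!
      (hint_poly w hw).sub (hint_zero w hw)
  · obtain ⟨s, rfl⟩ : ∃ s, w = -s - 2 := ⟨-w - 2, by ring⟩
    have hs : 1 < s.re := by
      simp only [sub_re, neg_re, re_ofNat] at hw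
      linarith
    simp only [Pi.sub_apply, sub_mul _ (zeroSum _)]
    rw [integral_sub (hint_poly _ hw) (hint_zero _ hw), integral_psiOne_mul_cpow hs,
      integral_Ioi_sub_one_polynomial_mul_cpow b hs, integral_zeroSum_mul_cpow hs]
    ring

end ExplicitFormula

section NontrivialZeros

open Complex Set MeasureTheory

lemma zetaZeros_subset : zetaZeros ⊆ riemannZetaZeros := fun _ h ↦ h.1

lemma countable_zetaZeros : Countable zetaZeros :=
  have := countable_riemannZetaZeros
  (inclusion_injective zetaZeros_subset).countable

lemma summable_norm_zeroWeight_zetaZeros : Summable fun ρ : zetaZeros ↦ ‖zeroWeight ρ‖ :=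
  Summable.comp_injective (f := fun ρ : riemannZetaZeros ↦ ‖zeroWeight ρ‖)
    (i := inclusion zetaZeros_subset) summable_norm_zeroWeight
    (inclusion_injective zetaZeros_subset)

lemma norm_cpow_add_one_le {t : ℝ} (ht : 0 ≤ t) {z : ℂ} (hz0 : 0 ≤ z.re) (hz1 : z.re ≤ 1) :
    ‖(t : ℂ) ^ (z + 1)‖ ≤ 1 + t ^ 2 := by
  rw [norm_cpow_eq_rpow_re_of_nonneg ht (by simp; linarith)]
  simp only [add_re, one_re]
  rcases le_total t 1 with h | h
  · have := Real.rpow_le_one ht h (z := z.re + 1) (by linarith)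
    nlinarith
  · have := Real.rpow_le_rpow_of_exponent_le h (by linarith : z.re + 1 ≤ 2)
    rw [Real.rpow_two] at this
    linarith

/-- The contribution of the non-trivial zeros of the zeta function to `psiOne`. -/
noncomputable def nontrivialZeroSum (t : ℝ) : ℂ :=
  ∑' ρ : zetaZeros, zeroWeight ρ * (t : ℂ) ^ ((ρ : ℂ) + 1)

lemma norm_zeroWeight_mul_cpow_le {t X : ℝ} (ht : 0 ≤ t) (htX : t ≤ X) (ρ : zetaZeros) :
    ‖zeroWeight ρ * (t : ℂ) ^ ((ρ : ℂ) + 1)‖ ≤ ‖zeroWeight ρ‖ * (1 + X ^ 2) := by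
  rw [norm_mul]
  gcongr
  refine (norm_cpow_add_one_le ht ρ.2.2.1.le ρ.2.2.2.le).trans ?_
  gcongr

lemma hasSum_nontrivialZeroSum {t : ℝ} (ht : 0 ≤ t) :
    HasSum (fun ρ : zetaZeros ↦ zeroWeight ρ * (t : ℂ) ^ ((ρ : ℂ) + 1)) (nontrivialZeroSum t) :=
  ((summable_norm_zeroWeight_zetaZeros.mul_right _).of_norm_bounded
    (norm_zeroWeight_mul_cpow_le ht le_rfl)).hasSum

lemma norm_nontrivialZeroSum_le {t X : ℝ} (ht : 0 ≤ t) (htX : t ≤ X) :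
    ‖nontrivialZeroSum t‖ ≤ (∑' ρ : zetaZeros, ‖zeroWeight ρ‖) * (1 + X ^ 2) := by
  rw [← tsum_mul_right]
  exact tsum_of_norm_bounded (summable_norm_zeroWeight_zetaZeros.mul_right _).hasSum
    (norm_zeroWeight_mul_cpow_le ht htX)

lemma continuous_zeroWeight_mul_cpow (ρ : zetaZeros) :
    Continuous fun t : ℝ ↦ zeroWeight ρ * (t : ℂ) ^ ((ρ : ℂ) + 1) :=
  continuous_const.mul (continuous_ofReal_cpow_const (by simpa using by linarith [ρ.2.2.1]))

lemma continuousOn_nontrivialZeroSum (X : ℝ) : ContinuousOn nontrivialZeroSum (Icc 0 X) :=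
  continuousOn_tsum (fun ρ ↦ (continuous_zeroWeight_mul_cpow ρ).continuousOn)
    (summable_norm_zeroWeight_zetaZeros.mul_right (1 + X ^ 2))
    fun ρ _ ht ↦ norm_zeroWeight_mul_cpow_le ht.1 ht.2 ρ

open Classical in
lemma hasSum_ite_nontrivialZeroSum {t : ℝ} (ht : 0 ≤ t) :
    HasSum (fun ρ : riemannZetaZeros ↦
      if 0 < (ρ : ℂ).re then zeroWeight ρ * (t : ℂ) ^ ((ρ : ℂ) + 1) else 0)
      (nontrivialZeroSum t) := by
  refine ((inclusion_injective zetaZeros_subset).hasSum_iff fun ρ hρ ↦ if_neg fun hre ↦ hρ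
    ⟨⟨ρ, ρ.2, hre, re_lt_one_of_riemannZeta_eq_zero ρ.2⟩, rfl⟩).1 ?_
  refine (hasSum_nontrivialZeroSum ht).congr_fun fun ρ ↦ ?_
  simp [ρ.2.2.1]

lemma norm_nontrivialZeroSum_sub_zeroSum_le {t : ℝ} (ht : 1 ≤ t) :
    ‖nontrivialZeroSum t - zeroSum t‖ ≤ 2 * ∑' ρ : riemannZetaZeros, ‖zeroWeight ρ‖ := by
  classical
  have ht0 : 0 < t := by linarith
  have hsub := (hasSum_ite_nontrivialZeroSum ht0.le).sub (summable_zeroWeight_mul ht).hasSum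
  rw [zeroSum, ← hsub.tsum_eq, ← tsum_mul_left]
  refine tsum_of_norm_bounded (summable_norm_zeroWeight.mul_left 2).hasSum fun ρ ↦ ?_
  split_ifs with hρ
  · rw [← mul_sub, sub_sub_cancel, mul_one]
    linarith [norm_nonneg (zeroWeight ρ)]
  · obtain ⟨n, hn⟩ := exists_eq_neg_two_mul_of_riemannZeta_eq_zero ρ.2 (not_lt.1 hρ)
    have hcpow : ‖(t : ℂ) ^ ((ρ : ℂ) + 1)‖ ≤ 1 := by
      rw [norm_cpow_eq_rpow_re_of_pos ht0]
      refine Real.rpow_le_one_of_one_le_of_nonpos ht ?_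
      have : (0 : ℝ) ≤ n := n.cast_nonneg
      simp [hn]
      linarith
    have hnorm : ‖(t : ℂ) ^ ((ρ : ℂ) + 1) - 1‖ ≤ 2 := by
      refine (norm_sub_le _ _).trans ?_
      rw [norm_one]
      linarith
    rw [zero_sub, norm_neg, norm_mul, mul_comm 2]
    gcongr

lemma norm_psiOne_sub_sq_add_nontrivialZeroSum_le_of_le_one {t : ℝ} (ht0 : 0 ≤ t) (ht1 : t ≤ 1) :
    ‖(psiOne t : ℂ) - (t : ℂ) ^ 2 / 2 + nontrivialZeroSum t‖
      ≤ 1 + 2 * ∑' ρ : zetaZeros, ‖zeroWeight ρ‖ := by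
  have hsq : ‖(t : ℂ) ^ 2 / 2‖ ≤ 1 := by
    rw [norm_div, norm_pow, norm_real, Real.norm_of_nonneg ht0, Complex.norm_ofNat]
    nlinarith
  have hsum := norm_nontrivialZeroSum_le ht0 ht1
  rw [psiOne_eq_zero ht1, ofReal_zero, zero_sub]
  refine (norm_add_le _ _).trans ?_
  rw [norm_neg]
  linarith

lemma norm_psiOne_sub_sq_add_nontrivialZeroSum_le_of_one_le {t : ℝ} (ht : 1 ≤ t) :
    ‖(psiOne t : ℂ) - (t : ℂ) ^ 2 / 2 + nontrivialZeroSum t‖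
      ≤ 2 * ∑' ρ : riemannZetaZeros, ‖zeroWeight ρ‖
        + (1 + ‖logDeriv riemannZeta₁ 0‖) * (1 + t) := by
  have ht0 : 0 ≤ t := by linarith
  set b := logDeriv riemannZeta₁ 0
  have hsplit : (psiOne t : ℂ) - (t : ℂ) ^ 2 / 2 + nontrivialZeroSum t
      = (nontrivialZeroSum t - zeroSum t) + ((1 / 2 - (t : ℂ)) - b * ((t : ℂ) - 1)) := by
    rw [psiOne_eq_sub_zeroSum ht]
    ring
  have hlin : ‖(1 / 2 : ℂ) - t‖ ≤ 1 + t := by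
    refine (norm_sub_le _ _).trans ?_
    rw [norm_real, Real.norm_of_nonneg ht0]
    norm_num
  have hb : ‖b * ((t : ℂ) - 1)‖ ≤ ‖b‖ * (1 + t) := by
    rw [norm_mul]
    gcongr
    refine (norm_sub_le _ _).trans ?_
    rw [norm_real, Real.norm_of_nonneg ht0, norm_one, add_comm]
  rw [hsplit]
  refine (norm_add_le _ _).trans (add_le_add (norm_nontrivialZeroSum_sub_zeroSum_le ht) ?_)
  linarith [norm_sub_le ((1 / 2 : ℂ) - t) (b * ((t : ℂ) - 1))]

theorem exists_norm_psiOne_sub_sq_add_nontrivialZeroSum_le : ∃ C : ℝ, 0 ≤ C ∧ ∀ t : ℝ, 0 ≤ t →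
    ‖(psiOne t : ℂ) - (t : ℂ) ^ 2 / 2 + nontrivialZeroSum t‖ ≤ C * (1 + t) := by
  set S := ∑' ρ : riemannZetaZeros, ‖zeroWeight ρ‖
  set S' := ∑' ρ : zetaZeros, ‖zeroWeight ρ‖
  set b := logDeriv riemannZeta₁ 0
  have hS : 0 ≤ S := tsum_nonneg fun _ ↦ norm_nonneg _
  have hS' : 0 ≤ S' := tsum_nonneg fun _ ↦ norm_nonneg _
  have hb : 0 ≤ ‖b‖ := norm_nonneg b
  refine ⟨1 + 2 * S' + 2 * S + ‖b‖, by positivity, fun t ht ↦ ?_⟩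
  rcases le_total t 1 with ht1 | ht1
  · have := norm_psiOne_sub_sq_add_nontrivialZeroSum_le_of_le_one ht ht1
    nlinarith
  · have := norm_psiOne_sub_sq_add_nontrivialZeroSum_le_of_one_le ht1
    nlinarith

end NontrivialZeros

section RieszMeans

open Complex Set MeasureTheory
open ArithmeticFunction (vonMangoldt)

lemma intervalIntegrable_sub_cpow {X : ℝ} {b : ℂ} (hb : -1 < b.re) (c : ℝ) :
    IntervalIntegrable (fun t : ℝ ↦ ((X : ℂ) - t) ^ b) volume c X := by
  simpa using (intervalIntegral.intervalIntegrable_cpow' (a := X - c) (b := 0) hb).comp_sub_left X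

lemma integral_cpow_mul_sub_cpow {a b : ℂ} (ha : -1 < a.re) (hb : -1 < b.re) {X : ℝ}
    (hX : 0 < X) :
    ∫ t in (0 : ℝ)..X, (t : ℂ) ^ a * ((X : ℂ) - t) ^ b =
      Gamma (b + 1) * (Gamma (a + 1) / Gamma (a + b + 2) * (X : ℂ) ^ (a + b + 1)) := by
  have h := betaIntegral_scaled (a + 1) (b + 1) hX
  have hG := Gamma_mul_Gamma_eq_betaIntegral (s := a + 1) (t := b + 1)
    (by simp; linarith) (by simp; linarith)
  have hne : Gamma (a + b + 2) ≠ 0 := Gamma_ne_zero_of_re_pos (by simp; linarith)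
  rw [show a + 1 + (b + 1) = a + b + 2 by ring] at h hG
  rw [add_sub_cancel_right, add_sub_cancel_right, show a + b + 2 - 1 = a + b + 1 by ring] at h
  rw [h]
  field_simp
  linear_combination -(X : ℂ) ^ (a + b + 1) * hG

lemma norm_integral_mul_sub_cpow_le {f : ℝ → ℂ} {A X : ℝ} {b : ℂ} (hb : -1 < b.re) (hX : 0 ≤ X)
    (hf : ∀ t ∈ Ioo 0 X, ‖f t‖ ≤ A) :
    ‖∫ t in (0 : ℝ)..X, f t * ((X : ℂ) - t) ^ b‖ ≤ A * (X ^ (b.re + 1) / (b.re + 1)) := by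
  have hint : ∫ t in (0 : ℝ)..X, A * (X - t) ^ b.re = A * (X ^ (b.re + 1) / (b.re + 1)) := by
    rw [intervalIntegral.integral_const_mul,
      intervalIntegral.integral_comp_sub_left (fun u : ℝ ↦ u ^ b.re) X, sub_self, sub_zero,
      integral_rpow (Or.inl hb), Real.zero_rpow (by linarith), sub_zero]
  have hi : IntervalIntegrable (fun t : ℝ ↦ A * (X - t) ^ b.re) volume 0 X := by
    simpa using ((intervalIntegral.intervalIntegrable_rpow' (a := X) (b := 0)
      hb).comp_sub_left X).const_mul A
  rw [← hint]
  refine intervalIntegral.norm_integral_le_of_norm_le hX ?_ hi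
  filter_upwards [Measure.ae_ne volume X] with t htX ht
  have htlt : t < X := lt_of_le_of_ne ht.2 htX
  rw [norm_mul, ← ofReal_sub, norm_cpow_eq_rpow_re_of_pos (sub_pos.2 htlt)]
  exact mul_le_mul_of_nonneg_right (hf t ⟨ht.1, htlt⟩) (Real.rpow_nonneg (by linarith) _)

lemma integral_max_sub_mul_sub_cpow {b : ℂ} (hb : -1 < b.re) {c X : ℝ} (hc : 0 ≤ c)
    (hcX : c ≤ X) :
    ∫ t in (0 : ℝ)..X, ((max (t - c) 0 : ℝ) : ℂ) * ((X : ℂ) - t) ^ b =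
      Gamma (b + 1) * (((X - c : ℝ) : ℂ) ^ (b + 2) / Gamma (b + 3)) := by
  have hK : IntervalIntegrable
      (fun t : ℝ ↦ ((max (t - c) 0 : ℝ) : ℂ) * ((X : ℂ) - t) ^ b) volume 0 X :=
    (intervalIntegrable_sub_cpow hb 0).continuousOn_mul (by fun_prop)
  have hmem : c ∈ uIcc 0 X := by simpa [uIcc_of_le (hc.trans hcX)] using ⟨hc, hcX⟩
  have hleft : ∫ t in (0 : ℝ)..c, ((max (t - c) 0 : ℝ) : ℂ) * ((X : ℂ) - t) ^ b = 0 := by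
    refine intervalIntegral.integral_zero_ae (Filter.Eventually.of_forall fun t ht ↦ ?_)
    rw [uIoc_of_le hc] at ht
    simp [max_eq_right (sub_nonpos.2 ht.2)]
  have hright : ∫ t in c..X, ((max (t - c) 0 : ℝ) : ℂ) * ((X : ℂ) - t) ^ b =
      ∫ u in (0 : ℝ)..(X - c), (u : ℂ) ^ (1 : ℂ) * (((X - c : ℝ) : ℂ) - u) ^ b := by
    rw [← sub_self c, ← intervalIntegral.integral_comp_sub_right
      (fun u : ℝ ↦ (u : ℂ) ^ (1 : ℂ) * (((X - c : ℝ) : ℂ) - u) ^ b) c]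
    refine intervalIntegral.integral_congr fun t ht ↦ ?_
    rw [uIcc_of_le hcX] at ht
    simp [max_eq_left (sub_nonneg.2 ht.1)]
  rw [← intervalIntegral.integral_add_adjacent_intervals
    (hK.mono_set (uIcc_subset_uIcc_left hmem)) (hK.mono_set (uIcc_subset_uIcc_right hmem)),
    hleft, hright, zero_add]
  rcases hcX.eq_or_lt with rfl | hlt
  · have : b + 2 ≠ 0 := fun h ↦ by
      have := congrArg re h
      simp only [add_re, re_ofNat, zero_re] at this
      linarith
    simp [zero_cpow this]
  · rw [integral_cpow_mul_sub_cpow (by simp) hb (sub_pos.2 hlt),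
      show (1 : ℂ) + 1 = 2 by norm_num, show 1 + b + 2 = b + 3 by ring,
      show 1 + b + 1 = b + 2 by ring, show Gamma 2 = 1 by simp]
    ring

/-- The Riesz mean of order `k` of the von Mangoldt function at `X`, normalised by
`Γ (k + 1)`; it vanishes for `X < 1`. -/
noncomputable def rieszMean (k X : ℝ) : ℝ :=
  ∑ n ∈ Finset.Ioc 0 ⌊X⌋₊, vonMangoldt n * ((X - n) ^ k / Real.Gamma (k + 1))

lemma rieszMean_zero (k : ℝ) : rieszMean k 0 = 0 := by simp [rieszMean]

lemma integral_psiOne_mul_sub_cpow {k : ℝ} (hk : 1 < k) {X : ℝ} (hX : 0 ≤ X) :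
    ∫ t in (0 : ℝ)..X, (psiOne t : ℂ) * ((X : ℂ) - t) ^ ((k : ℂ) - 2) =
      Gamma ((k : ℂ) - 1) * rieszMean k X := by
  have hre : -1 < ((k : ℂ) - 2).re := by simp; linarith
  have hpsi : ∫ t in (0 : ℝ)..X, (psiOne t : ℂ) * ((X : ℂ) - t) ^ ((k : ℂ) - 2) =
      ∫ t in (0 : ℝ)..X, ∑ n ∈ Finset.Ioc 0 ⌊X⌋₊, (vonMangoldt n : ℂ) *
        (((max (t - n) 0 : ℝ) : ℂ) * ((X : ℂ) - t) ^ ((k : ℂ) - 2)) := by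
    refine intervalIntegral.integral_congr fun t ht ↦ ?_
    rw [uIcc_of_le hX] at ht
    simp only [psiOne_eq_sum_Ioc (ht.2.trans (Nat.lt_floor_add_one X).le), ofReal_sum, ofReal_mul,
      Finset.sum_mul, mul_assoc]
  rw [hpsi, intervalIntegral.integral_finsetSum fun n _ ↦
    ((intervalIntegrable_sub_cpow hre 0).continuousOn_mul (by fun_prop)).const_mul _,
    rieszMean, ofReal_sum, Finset.mul_sum]
  refine Finset.sum_congr rfl fun n hn ↦ ?_
  have hnX : (n : ℝ) ≤ X := (Nat.le_floor_iff hX).1 (Finset.mem_Ioc.1 hn).2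
  rw [intervalIntegral.integral_const_mul,
    integral_max_sub_mul_sub_cpow hre (Nat.cast_nonneg n) hnX, ofReal_mul, ofReal_div,
    ofReal_cpow (sub_nonneg.2 hnX), ← Gamma_ofReal, ofReal_add, ofReal_one,
    show (k : ℂ) - 2 + 1 = k - 1 by ring, show (k : ℂ) - 2 + 2 = k by ring,
    show (k : ℂ) - 2 + 3 = k + 1 by ring]
  ring

/-- The coefficient `m(ρ) Γ(ρ) / Γ(k + 1 + ρ)` of the zero `ρ`, of multiplicity `m(ρ)`, in the
explicit formula for the Riesz mean of order `k`. -/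
noncomputable def rieszCoeff (k : ℂ) (ρ : zetaZeros) : ℂ :=
  zetaMult ρ * (Gamma ρ / Gamma (k + 1 + ρ))

variable {k : ℂ} {X : ℝ}

lemma integral_zeroWeight_mul_cpow_mul_sub_cpow (hk : 1 < k.re) (hX : 0 < X) (ρ : zetaZeros) :
    ∫ t in (0 : ℝ)..X, zeroWeight ρ * (t : ℂ) ^ ((ρ : ℂ) + 1) * ((X : ℂ) - t) ^ (k - 2) =
      Gamma (k - 1) * (rieszCoeff k ρ * (X : ℂ) ^ (k + ρ)) := by
  have hρ : 0 < (ρ : ℂ).re := ρ.2.2.1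
  have hρ0 : (ρ : ℂ) ≠ 0 := ne_zero_of_re_pos hρ
  have hρ1 : (ρ : ℂ) + 1 ≠ 0 := ne_zero_of_re_pos (by simp; linarith)
  simp only [mul_assoc, intervalIntegral.integral_const_mul]
  rw [integral_cpow_mul_sub_cpow (by simp; linarith) (by simp; linarith) hX, Gamma_add_one _ hρ1,
    Gamma_add_one _ hρ0, rieszCoeff, zeroWeight, zetaMult, show k - 2 + 1 = k - 1 by ring,
    show (ρ : ℂ) + 1 + (k - 2) + 2 = k + 1 + ρ by ring,
    show (ρ : ℂ) + 1 + (k - 2) + 1 = k + ρ by ring]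
  field_simp

lemma intervalIntegrable_nontrivialZeroSum_mul (hk : 1 < k.re) (hX : 0 ≤ X) :
    IntervalIntegrable (fun t : ℝ ↦ nontrivialZeroSum t * ((X : ℂ) - t) ^ (k - 2)) volume 0 X :=
  (intervalIntegrable_sub_cpow (by simp; linarith) 0).continuousOn_mul
    (by rw [uIcc_of_le hX]; exact continuousOn_nontrivialZeroSum X)

lemma hasSum_rieszCoeff_mul_cpow (hk : 1 < k.re) (hX : 0 < X) :
    HasSum (fun ρ : zetaZeros ↦ Gamma (k - 1) * (rieszCoeff k ρ * (X : ℂ) ^ (k + ρ)))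
      (∫ t in (0 : ℝ)..X, nontrivialZeroSum t * ((X : ℂ) - t) ^ (k - 2)) := by
  have := countable_zetaZeros
  have hK : IntervalIntegrable (fun t : ℝ ↦ ((X : ℂ) - t) ^ (k - 2)) volume 0 X :=
    intervalIntegrable_sub_cpow (by simp; linarith) 0
  have hsum : Summable fun ρ : zetaZeros ↦ ‖zeroWeight ρ‖ * (1 + X ^ 2) :=
    summable_norm_zeroWeight_zetaZeros.mul_right _
  simp only [← integral_zeroWeight_mul_cpow_mul_sub_cpow hk hX]
  refine intervalIntegral.hasSum_integral_of_dominated_convergence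
    (fun ρ t ↦ ‖zeroWeight ρ‖ * (1 + X ^ 2) * ‖((X : ℂ) - t) ^ (k - 2)‖)
    (fun ρ ↦ ?_) (fun ρ ↦ .of_forall fun t ht ↦ ?_)
    (.of_forall fun t _ ↦ hsum.mul_right _) ?_ (.of_forall fun t ht ↦ ?_)
  · exact (hK.continuousOn_mul
      (continuous_zeroWeight_mul_cpow ρ).continuousOn).def'.aestronglyMeasurable
  · rw [uIoc_of_le hX.le] at ht
    rw [norm_mul]
    gcongr
    exact norm_zeroWeight_mul_cpow_le ht.1.le ht.2 ρ
  · simp only [tsum_mul_right]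
    exact hK.norm.const_mul _
  · rw [uIoc_of_le hX.le] at ht
    exact (hasSum_nontrivialZeroSum ht.1.le).mul_right _

lemma summable_rieszCoeff (hk : 1 < k.re) : Summable (rieszCoeff k) := by
  have h := (hasSum_rieszCoeff_mul_cpow hk zero_lt_one).summable
  have hG : Gamma (k - 1) ≠ 0 := Gamma_ne_zero_of_re_pos (by simp; linarith)
  simpa [summable_mul_left_iff hG] using h

lemma integral_sq_div_two_mul_sub_cpow (hk : 1 < k.re) (hX : 0 < X) :
    ∫ t in (0 : ℝ)..X, (t : ℂ) ^ 2 / 2 * ((X : ℂ) - t) ^ (k - 2) =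
      Gamma (k - 1) * ((X : ℂ) ^ (k + 1) / Gamma (k + 2)) := by
  have h := integral_cpow_mul_sub_cpow (a := 2) (b := k - 2) (by norm_num)
    (by simp; linarith) hX
  simp only [cpow_ofNat] at h
  simp only [div_mul_eq_mul_div, intervalIntegral.integral_div]
  rw [h, show (2 : ℂ) + 1 = 3 by norm_num, show k - 2 + 1 = k - 1 by ring,
    show 2 + (k - 2) + 2 = k + 2 by ring, show 2 + (k - 2) + 1 = k + 1 by ring,
    show Gamma 3 = 2 by simp]
  ring

lemma Gamma_mul_rieszMean_sub_add_tsum {k : ℝ} (hk : 1 < k) (hX : 0 < X) :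
    Gamma ((k : ℂ) - 1) * ((rieszMean k X : ℂ) - (X : ℂ) ^ ((k : ℂ) + 1) / Gamma ((k : ℂ) + 2) +
        ∑' ρ, rieszCoeff k ρ * (X : ℂ) ^ ((k : ℂ) + ρ)) =
      ∫ t in (0 : ℝ)..X, ((psiOne t : ℂ) - (t : ℂ) ^ 2 / 2 + nontrivialZeroSum t) *
        ((X : ℂ) - t) ^ ((k : ℂ) - 2) := by
  have hK : IntervalIntegrable (fun t : ℝ ↦ ((X : ℂ) - t) ^ ((k : ℂ) - 2)) volume 0 X :=
    intervalIntegrable_sub_cpow (by simp; linarith) 0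
  have hpsi : IntervalIntegrable
      (fun t : ℝ ↦ (psiOne t : ℂ) * ((X : ℂ) - t) ^ ((k : ℂ) - 2)) volume 0 X :=
    hK.continuousOn_mul (continuous_ofReal.comp continuous_psiOne).continuousOn
  have hsq : IntervalIntegrable
      (fun t : ℝ ↦ (t : ℂ) ^ 2 / 2 * ((X : ℂ) - t) ^ ((k : ℂ) - 2)) volume 0 X :=
    hK.continuousOn_mul (by fun_prop)
  simp only [add_mul, sub_mul]
  rw [intervalIntegral.integral_add (hpsi.sub hsq)
      (intervalIntegrable_nontrivialZeroSum_mul (by simpa) hX.le),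
    intervalIntegral.integral_sub hpsi hsq, integral_psiOne_mul_sub_cpow hk hX.le,
    integral_sq_div_two_mul_sub_cpow (by simpa) hX,
    ← (hasSum_rieszCoeff_mul_cpow (by simpa) hX).tsum_eq, tsum_mul_left]
  ring

theorem exists_norm_rieszMean_sub_add_tsum_le {k : ℝ} (hk : 1 < k) :
    ∃ C : ℝ, 0 ≤ C ∧ ∀ X : ℝ, 0 ≤ X →
      ‖(rieszMean k X : ℂ) - (X : ℂ) ^ ((k : ℂ) + 1) / Gamma ((k : ℂ) + 2) +
        ∑' ρ, rieszCoeff k ρ * (X : ℂ) ^ ((k : ℂ) + ρ)‖ ≤ C * ((1 + X) * X ^ (k - 1)) := by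
  obtain ⟨C, hC, hbound⟩ := exists_norm_psiOne_sub_sq_add_nontrivialZeroSum_le
  have hk1 : 0 < k - 1 := sub_pos.2 hk
  have hΓ : 0 < ‖Gamma ((k : ℂ) - 1)‖ :=
    norm_pos_iff.2 (Gamma_ne_zero_of_re_pos (by simpa using hk))
  refine ⟨C / (k - 1) / ‖Gamma ((k : ℂ) - 1)‖, by positivity, fun X hX ↦ ?_⟩
  rcases hX.eq_or_lt with rfl | hX
  · have hpow (s : ℂ) (hs : 0 < s.re) : (0 : ℂ) ^ ((k : ℂ) + s) = 0 :=
      zero_cpow (ne_zero_of_re_pos (by simp; linarith))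
    simp [rieszMean_zero, hpow 1, fun ρ : zetaZeros ↦ hpow ρ ρ.2.2.1, hk1.ne']
  · rw [div_mul_eq_mul_div, le_div_iff₀ hΓ, mul_comm, ← norm_mul,
      Gamma_mul_rieszMean_sub_add_tsum hk hX]
    refine (norm_integral_mul_sub_cpow_le (A := C * (1 + X)) (by simp; linarith) hX.le
      fun t ht ↦ (hbound t ht.1.le).trans ?_).trans_eq ?_
    · gcongr
      exact ht.2.le
    · rw [show ((k : ℂ) - 2).re + 1 = k - 1 by simp; ring]
      ring

end RieszMeans

section VerticalLine

open Complex MeasureTheory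

lemma one_add_mul_I_mem_slitPlane (t : ℝ) : 1 + (t : ℂ) * I ∈ slitPlane := Or.inl (by simp)

lemma one_add_mul_I_ne_zero (t : ℝ) : 1 + (t : ℂ) * I ≠ 0 :=
  slitPlane_ne_zero (one_add_mul_I_mem_slitPlane t)

lemma norm_one_add_mul_I_rpow (t x : ℝ) : ‖1 + (t : ℂ) * I‖ ^ x = (1 + t ^ 2) ^ (x / 2) := by
  have hnorm : ‖1 + (t : ℂ) * I‖ = √(1 + t ^ 2) := by simpa using norm_add_mul_I 1 t
  rw [hnorm, Real.sqrt_eq_rpow, ← Real.rpow_mul (by positivity), one_div_mul_eq_div]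

lemma norm_one_add_mul_I_cpow_le (t : ℝ) (w : ℂ) :
    ‖(1 + (t : ℂ) * I) ^ w‖ ≤ Real.exp (Real.pi * |w.im|) * (1 + t ^ 2) ^ (w.re / 2) := by
  have harg : |(1 + (t : ℂ) * I).arg * w.im| ≤ Real.pi * |w.im| := by
    rw [abs_mul]
    gcongr
    exact abs_arg_le_pi _
  rw [norm_cpow_of_ne_zero (one_add_mul_I_ne_zero t), norm_one_add_mul_I_rpow, div_eq_mul_inv,
    ← Real.exp_neg, mul_comm]
  gcongr
  exact (neg_le_abs _).trans harg

lemma continuous_one_add_mul_I_cpow (w : ℂ) : Continuous fun t : ℝ ↦ (1 + (t : ℂ) * I) ^ w :=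
  continuous_iff_continuousAt.2 fun t ↦
    ContinuousAt.cpow (by fun_prop) continuousAt_const (one_add_mul_I_mem_slitPlane t)

lemma integrable_one_add_sq_rpow {r : ℝ} (hr : r < -1) :
    Integrable fun t : ℝ ↦ (1 + t ^ 2) ^ (r / 2) := by
  simpa using integrable_rpow_neg_one_add_norm_sq (E := ℝ) (μ := volume) (r := -r)
    (by rw [Module.finrank_self]; push_cast; linarith)

lemma integrable_one_add_mul_I_cpow {w : ℂ} (hw : w.re < -1) :
    Integrable fun t : ℝ ↦ (1 + (t : ℂ) * I) ^ w :=
  ((integrable_one_add_sq_rpow hw).const_mul (Real.exp (Real.pi * |w.im|))).mono'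
    (continuous_one_add_mul_I_cpow w).aestronglyMeasurable
    (.of_forall fun t ↦ norm_one_add_mul_I_cpow_le t w)

end VerticalLine

section LaplaceTransform

open Complex Set Filter Topology MeasureTheory
open scoped FourierTransform

lemma continuousOn_cpow_mul_exp_neg (b r : ℂ) :
    ContinuousOn (fun t : ℝ ↦ (t : ℂ) ^ b * cexp (-(r * t))) (Ioi 0) :=
  ContinuousOn.mul (fun t ht ↦ (continuousAt_ofReal_cpow_const t b
    (Or.inr (ne_of_gt ht))).continuousWithinAt) (by fun_prop)

lemma norm_cpow_mul_exp_neg (b r : ℂ) {t : ℝ} (ht : 0 < t) :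
    ‖(t : ℂ) ^ b * cexp (-(r * t))‖ = t ^ b.re * Real.exp (-r.re * t) := by
  simp [norm_cpow_eq_rpow_re_of_pos ht, Complex.norm_exp]

lemma integrableOn_rpow_mul_exp_neg {x c : ℝ} (hx : -1 < x) (hc : 0 < c) :
    IntegrableOn (fun t : ℝ ↦ t ^ x * Real.exp (-c * t)) (Ioi 0) := by
  simpa using integrableOn_rpow_mul_exp_neg_mul_rpow (p := 1) hx zero_lt_one hc

lemma integrableOn_cpow_mul_exp_neg {b r : ℂ} (hb : -1 < b.re) (hr : 0 < r.re) :
    IntegrableOn (fun t : ℝ ↦ (t : ℂ) ^ b * cexp (-(r * t))) (Ioi 0) :=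
  Integrable.mono' (integrableOn_rpow_mul_exp_neg hb hr)
    ((continuousOn_cpow_mul_exp_neg b r).aestronglyMeasurable measurableSet_Ioi)
    (ae_restrict_of_forall_mem measurableSet_Ioi fun _ ht ↦ (norm_cpow_mul_exp_neg b r ht).le)

lemma differentiableAt_integral_cpow_mul_exp_neg {b z : ℂ} (hb : -1 < b.re) (hz : 0 < z.re) :
    DifferentiableAt ℂ (fun r : ℂ ↦ ∫ t in Ioi (0 : ℝ), (t : ℂ) ^ b * cexp (-(r * t))) z := by
  have hmem : {r : ℂ | z.re / 2 < r.re} ∈ 𝓝 z :=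
    (isOpen_lt continuous_const continuous_re).mem_nhds (half_lt_self hz)
  refine (hasDerivAt_integral_of_dominated_loc_of_deriv_le (μ := volume.restrict (Ioi 0))
    (F := fun (r : ℂ) (t : ℝ) ↦ (t : ℂ) ^ b * cexp (-(r * t)))
    (F' := fun (r : ℂ) (t : ℝ) ↦ -((t : ℂ) ^ (b + 1) * cexp (-(r * t))))
    (bound := fun t ↦ t ^ (b + 1).re * Real.exp (-(z.re / 2) * t)) hmem
    (.of_forall fun r ↦ (continuousOn_cpow_mul_exp_neg b r).aestronglyMeasurable measurableSet_Ioi)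
    (integrableOn_cpow_mul_exp_neg hb hz)
    ((continuousOn_cpow_mul_exp_neg _ z).aestronglyMeasurable measurableSet_Ioi).neg
    (ae_restrict_of_forall_mem measurableSet_Ioi fun t (ht : 0 < t) r (hr : z.re / 2 < r.re) ↦ ?_)
    (integrableOn_rpow_mul_exp_neg (by simp only [add_re, one_re]; linarith) (half_pos hz))
    (ae_restrict_of_forall_mem measurableSet_Ioi fun t (ht : 0 < t) r _ ↦ ?_)).2.differentiableAt
  · rw [norm_neg, norm_cpow_mul_exp_neg _ r ht]
    gcongr
  · have hlin : HasDerivAt (fun r : ℂ ↦ -(r * t)) (-(t : ℂ)) r := by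
      simpa using ((hasDerivAt_id r).mul_const (t : ℂ)).fun_neg
    refine (hlin.cexp.const_mul ((t : ℂ) ^ b)).congr_deriv ?_
    rw [cpow_add _ _ (ofReal_ne_zero.2 ht.ne'), cpow_one]
    ring

lemma integral_cpow_mul_exp_neg {a r : ℂ} (ha : 0 < a.re) (hr : 0 < r.re) :
    ∫ t in Ioi (0 : ℝ), (t : ℂ) ^ (a - 1) * cexp (-(r * t)) = r ^ (-a) * Gamma a := by
  have hopen : IsOpen {r : ℂ | 0 < r.re} := isOpen_lt continuous_const continuous_re
  have hleft : AnalyticOnNhd ℂ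
      (fun r : ℂ ↦ ∫ t in Ioi (0 : ℝ), (t : ℂ) ^ (a - 1) * cexp (-(r * t))) {r | 0 < r.re} :=
    DifferentiableOn.analyticOnNhd (fun z hz ↦ (differentiableAt_integral_cpow_mul_exp_neg
      (by simpa using ha) hz).differentiableWithinAt) hopen
  have hright : AnalyticOnNhd ℂ (fun r : ℂ ↦ r ^ (-a) * Gamma a) {r | 0 < r.re} :=
    DifferentiableOn.analyticOnNhd (fun z hz ↦ ((differentiableAt_id.cpow
      (differentiableAt_const _) (Or.inl hz)).mul_const _).differentiableWithinAt) hopen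
  have hreal : ∀ x : ℝ, 0 < x →
      ∫ t in Ioi (0 : ℝ), (t : ℂ) ^ (a - 1) * cexp (-(x * t)) = (x : ℂ) ^ (-a) * Gamma a := by
    intro x hx
    rw [integral_cpow_mul_exp_neg_mul_Ioi ha (by simpa using hx), one_div,
      inv_cpow _ _ (by rw [arg_ofReal_of_nonneg hx.le]; exact Real.pi_ne_zero.symm), cpow_neg]
  have htend : Tendsto (fun x : ℝ ↦ (x : ℂ)) (𝓝[≠] 1) (𝓝[≠] 1) := by
    refine tendsto_nhdsWithin_of_tendsto_nhds_of_eventually_within _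
      ((continuous_ofReal.tendsto' 1 1 ofReal_one).mono_left nhdsWithin_le_nhds) ?_
    filter_upwards [self_mem_nhdsWithin] with x hx
    simpa using hx
  refine hleft.eqOn_of_preconnected_of_frequently_eq hright
    (convex_halfSpace_re_gt 0).isPreconnected (z₀ := 1) (by simp)
    (htend.frequently (Eventually.frequently ?_)) hr
  filter_upwards [eventually_nhdsWithin_of_eventually_nhds (lt_mem_nhds one_pos)] with x hx
  exact hreal x hx

/-- The truncated power `x₊ ^ a` with a complex exponent. It vanishes at `x ≤ 0` when `0 < re a`. -/
noncomputable def posCpow (a : ℂ) (x : ℝ) : ℂ := ((max x 0 : ℝ) : ℂ) ^ a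

lemma posCpow_of_nonneg (a : ℂ) {x : ℝ} (hx : 0 ≤ x) : posCpow a x = (x : ℂ) ^ a := by
  rw [posCpow, max_eq_left hx]

lemma posCpow_of_nonpos {a : ℂ} (ha : 0 < a.re) {x : ℝ} (hx : x ≤ 0) : posCpow a x = 0 := by
  rw [posCpow, max_eq_right hx, ofReal_zero, zero_cpow (ne_zero_of_re_pos ha)]

lemma continuous_posCpow {a : ℂ} (ha : 0 < a.re) : Continuous (posCpow a) :=
  (continuous_ofReal_cpow_const ha).comp (continuous_id.max continuous_const)

lemma posCpow_mul {c : ℝ} (hc : 0 ≤ c) (a : ℂ) (x : ℝ) :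
    posCpow a (c * x) = (c : ℂ) ^ a * posCpow a x := by
  have hmax : max (c * x) 0 = c * max x 0 := by rw [mul_max_of_nonneg _ _ hc, mul_zero]
  rw [posCpow, posCpow, hmax, ofReal_mul, mul_cpow_ofReal_nonneg hc (le_max_right _ _)]

lemma posCpow_mul_exp_neg_eq_indicator {a : ℂ} (ha : 0 < a.re) (r : ℂ) :
    (fun x : ℝ ↦ posCpow a x * cexp (-(r * x))) =
      (Ioi (0 : ℝ)).indicator fun x : ℝ ↦ (x : ℂ) ^ a * cexp (-(r * x)) := by
  funext x
  rcases lt_or_ge 0 x with hx | hx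
  · rw [indicator_of_mem (mem_Ioi.2 hx), posCpow_of_nonneg a hx.le]
  · rw [indicator_of_notMem (notMem_Ioi.2 hx), posCpow_of_nonpos ha hx, zero_mul]

lemma integrable_posCpow_mul_exp_neg {a r : ℂ} (ha : 0 < a.re) (hr : 0 < r.re) :
    Integrable fun x : ℝ ↦ posCpow a x * cexp (-(r * x)) := by
  rw [posCpow_mul_exp_neg_eq_indicator ha, integrable_indicator_iff measurableSet_Ioi]
  exact integrableOn_cpow_mul_exp_neg (by linarith) hr

lemma fourier_posCpow_mul_exp_neg {w : ℂ} (hw : 1 < w.re) :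
    𝓕 (fun x : ℝ ↦ posCpow (w - 1) x * cexp (-x)) =
      fun ξ : ℝ ↦ (1 + ((2 * Real.pi * ξ : ℝ) : ℂ) * I) ^ (-w) * Gamma w := by
  funext ξ
  have hintegrand : ∀ x : ℝ,
      cexp (((-2 * Real.pi * x * ξ : ℝ) : ℂ) * I) • (posCpow (w - 1) x * cexp (-x)) =
        posCpow (w - 1) x * cexp (-((1 + ((2 * Real.pi * ξ : ℝ) : ℂ) * I) * x)) := by
    intro x
    rw [smul_eq_mul, mul_left_comm, ← Complex.exp_add]
    push_cast
    ring_nf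
  simp only [Real.fourier_real_eq_integral_exp_smul, hintegrand]
  rw [posCpow_mul_exp_neg_eq_indicator (by simpa using hw), integral_indicator measurableSet_Ioi,
    integral_cpow_mul_exp_neg (by linarith) (by simp)]

lemma integral_one_add_mul_I_cpow_mul_exp {w : ℂ} (hw : 1 < w.re) (y : ℝ) :
    ∫ t : ℝ, (1 + (t : ℂ) * I) ^ (-w) * cexp ((1 + (t : ℂ) * I) * y) =
      2 * Real.pi / Gamma w * posCpow (w - 1) y := by
  have hw' : 0 < (w - 1).re := by simpa using hw
  have hΓ : Gamma w ≠ 0 := Gamma_ne_zero_of_re_pos (by linarith)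
  have hcont : Continuous fun x : ℝ ↦ posCpow (w - 1) x * cexp (-x) :=
    (continuous_posCpow hw').mul (by fun_prop)
  have hint : Integrable fun x : ℝ ↦ posCpow (w - 1) x * cexp (-x) := by
    simpa using integrable_posCpow_mul_exp_neg hw' (r := 1) (by simp)
  have hintF : Integrable (𝓕 fun x : ℝ ↦ posCpow (w - 1) x * cexp (-x)) := by
    rw [fourier_posCpow_mul_exp_neg hw]
    exact ((integrable_one_add_mul_I_cpow (w := -w) (by simpa using hw)).comp_mul_left'
      (by positivity)).mul_const _
  have hinv := congrFun (hcont.fourierInv_fourier_eq hint hintF) y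
  have hintegrand : ∀ ξ : ℝ, cexp (((2 * Real.pi * inner ℝ ξ y : ℝ) : ℂ) * I) •
      ((1 + ((2 * Real.pi * ξ : ℝ) : ℂ) * I) ^ (-w) * Gamma w) =
        Gamma w * cexp (-y) * ((1 + ((2 * Real.pi * ξ : ℝ) : ℂ) * I) ^ (-w) *
          cexp ((1 + ((2 * Real.pi * ξ : ℝ) : ℂ) * I) * y)) := by
    intro ξ
    have hexp : cexp (((2 * Real.pi * inner ℝ ξ y : ℝ) : ℂ) * I) =
        cexp (-y) * cexp ((1 + ((2 * Real.pi * ξ : ℝ) : ℂ) * I) * y) := by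
      rw [← Complex.exp_add, RCLike.inner_apply, conj_trivial]
      push_cast
      ring_nf
    rw [smul_eq_mul, hexp]
    ring
  rw [Real.fourierInv_eq', fourier_posCpow_mul_exp_neg hw] at hinv
  simp only [hintegrand] at hinv
  rw [integral_const_mul, Measure.integral_comp_mul_left
    (fun t : ℝ ↦ (1 + (t : ℂ) * I) ^ (-w) * cexp ((1 + (t : ℂ) * I) * y)),
    abs_of_pos (by positivity), real_smul] at hinv
  push_cast at hinv
  have hπ : (Real.pi : ℂ) ≠ 0 := ofReal_ne_zero.2 Real.pi_ne_zero
  have hexp := Complex.exp_ne_zero (-(y : ℂ))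
  field_simp at hinv ⊢
  simpa only [mul_comm I] using hinv

end LaplaceTransform

section SonineIntegral

open Complex MeasureTheory

/-- The integrand `s ^ (-ν - 1) e ^ s e ^ (-u² / (4 s))` of Sonine's representation of `J_ν(u)` at
the point `s = 1 + i t`. -/
noncomputable def sonineKernel (ν : ℂ) (u t : ℝ) : ℂ :=
  (1 + (t : ℂ) * I) ^ (-ν - 1) * cexp (1 + (t : ℂ) * I) *
    cexp (-(u : ℂ) ^ 2 / (4 * (1 + (t : ℂ) * I)))

/-- The integral in Sonine's representation of the Bessel function. It equals
`2 π (u / 2) ^ (-ν) J_ν(u)`, which extends to an even entire function of `u`. -/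
noncomputable def sonineIntegral (ν : ℂ) (u : ℝ) : ℂ := ∫ t : ℝ, sonineKernel ν u t

lemma besselJ_eq_sonineIntegral (ν : ℂ) (u : ℝ) :
    besselJ ν u = ((u : ℂ) / 2) ^ ν / (2 * Real.pi) * sonineIntegral ν u := by
  rw [besselJ, integral_mul_const]
  change _ / (2 * (Real.pi : ℂ) * I) * (sonineIntegral ν u * I) = _
  have := I_ne_zero
  field_simp

lemma sonineIntegral_neg (ν : ℂ) (u : ℝ) : sonineIntegral ν (-u) = sonineIntegral ν u := by
  simp [sonineIntegral, sonineKernel]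

lemma sonineIntegral_zero {ν : ℂ} (hν : 0 < ν.re) :
    sonineIntegral ν 0 = 2 * Real.pi / Gamma (ν + 1) := by
  have h := integral_one_add_mul_I_cpow_mul_exp (w := ν + 1) (by simpa using hν) 1
  rw [posCpow_of_nonneg _ zero_le_one, ofReal_one, one_cpow, mul_one] at h
  simp [← h, sonineIntegral, sonineKernel, sub_eq_neg_add]

lemma exp_neg_le_div_rpow {y p : ℝ} (hy : 0 < y) (hp : 0 < p) : Real.exp (-y) ≤ (p / y) ^ p := by
  have hbase : (y / p) ^ p ≤ Real.exp y := calc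
    (y / p) ^ p ≤ Real.exp (y / p) ^ p := by
      gcongr
      linarith [Real.add_one_le_exp (y / p)]
    _ = Real.exp y := by rw [← Real.exp_mul, div_mul_cancel₀ y hp.ne']
  rw [← inv_div, Real.inv_rpow (by positivity), Real.exp_neg]
  gcongr

lemma norm_exp_neg_sq_div_one_add_mul_I (u t : ℝ) :
    ‖cexp (-(u : ℂ) ^ 2 / (4 * (1 + (t : ℂ) * I)))‖ = Real.exp (-(u ^ 2 / (4 * (1 + t ^ 2)))) := by
  have hreal : -(u : ℂ) ^ 2 / (4 * (1 + (t : ℂ) * I)) =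
      ((-(u ^ 2 / (4 * (1 + t ^ 2))) : ℝ) : ℂ) * (1 - (t : ℂ) * I) := by
    have hsq : 1 + (t : ℂ) ^ 2 ≠ 0 := by exact_mod_cast (by positivity : 1 + t ^ 2 ≠ 0)
    have hne := one_add_mul_I_ne_zero t
    push_cast
    field_simp
    linear_combination -(u : ℂ) ^ 2 * (t : ℂ) ^ 2 * I_sq
  rw [Complex.norm_exp, hreal, re_ofReal_mul]
  simp

lemma norm_sonineKernel_le (ν : ℂ) {σ u : ℝ} (hσ : 0 < σ) (hu : u ≠ 0) (t : ℝ) :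
    ‖sonineKernel ν u t‖ ≤ Real.exp (Real.pi * |ν.im|) * Real.exp 1 *
      ((2 * σ) ^ (σ / 2) * |u| ^ (-σ)) * (1 + t ^ 2) ^ ((σ - ν.re - 1) / 2) := by
  have hq : 0 < 1 + t ^ 2 := by positivity
  have hexp : Real.exp (-(u ^ 2 / (4 * (1 + t ^ 2)))) ≤
      (2 * σ) ^ (σ / 2) * |u| ^ (-σ) * (1 + t ^ 2) ^ (σ / 2) := by
    refine (exp_neg_le_div_rpow (by positivity) (half_pos hσ)).trans_eq ?_
    have hbase : σ / 2 / (u ^ 2 / (4 * (1 + t ^ 2))) = 2 * σ * (u ^ 2)⁻¹ * (1 + t ^ 2) := by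
      field_simp
      ring
    have hsq : ((u ^ 2)⁻¹) ^ (σ / 2) = |u| ^ (-σ) := by
      rw [← sq_abs, ← Real.rpow_natCast |u| 2, ← Real.rpow_neg (abs_nonneg u),
        ← Real.rpow_mul (abs_nonneg u)]
      push_cast
      ring_nf
    rw [hbase, Real.mul_rpow (by positivity) hq.le, Real.mul_rpow (by positivity) (by positivity),
      hsq]
  have hpow : (1 + t ^ 2) ^ ((σ - ν.re - 1) / 2) =
      (1 + t ^ 2) ^ ((-ν - 1).re / 2) * (1 + t ^ 2) ^ (σ / 2) := by
    rw [← Real.rpow_add hq]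
    simp only [sub_re, neg_re, one_re]
    ring_nf
  calc ‖sonineKernel ν u t‖
      = ‖(1 + (t : ℂ) * I) ^ (-ν - 1)‖ * Real.exp 1 *
          Real.exp (-(u ^ 2 / (4 * (1 + t ^ 2)))) := by
        rw [sonineKernel, norm_mul, norm_mul, norm_exp_neg_sq_div_one_add_mul_I, Complex.norm_exp]
        simp
    _ ≤ Real.exp (Real.pi * |(-ν - 1).im|) * (1 + t ^ 2) ^ ((-ν - 1).re / 2) * Real.exp 1 *
          ((2 * σ) ^ (σ / 2) * |u| ^ (-σ) * (1 + t ^ 2) ^ (σ / 2)) := by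
        gcongr
        exact norm_one_add_mul_I_cpow_le t _
    _ = _ := by
        rw [hpow]
        simp only [sub_im, neg_im, one_im, sub_zero, abs_neg]
        ring

lemma exists_norm_sonineIntegral_le {ν : ℂ} {σ : ℝ} (hσ : 0 < σ) (hσν : σ < ν.re) :
    ∃ C : ℝ, ∀ u : ℝ, u ≠ 0 → ‖sonineIntegral ν u‖ ≤ C * |u| ^ (-σ) := by
  have hint := integrable_one_add_sq_rpow (r := σ - ν.re - 1) (by linarith)
  refine ⟨Real.exp (Real.pi * |ν.im|) * Real.exp 1 * (2 * σ) ^ (σ / 2) *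
    ∫ t : ℝ, (1 + t ^ 2) ^ ((σ - ν.re - 1) / 2), fun u hu ↦ ?_⟩
  refine (norm_integral_le_of_norm_le (hint.const_mul _)
    (.of_forall (norm_sonineKernel_le ν hσ hu))).trans_eq ?_
  rw [integral_const_mul]
  ring

lemma ofReal_div_cpow {r : ℝ} (hr : 0 < r) {z : ℂ} (hz : z ∈ slitPlane) (a : ℂ) :
    ((r : ℂ) / z) ^ a = (r : ℂ) ^ a * z ^ (-a) := by
  have hz0 := slitPlane_ne_zero hz
  have hr0 : (r : ℂ) ≠ 0 := ofReal_ne_zero.2 hr.ne'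
  rw [div_eq_mul_inv, cpow_def_of_ne_zero (mul_ne_zero hr0 (inv_ne_zero hz0)),
    log_ofReal_mul hr (inv_ne_zero hz0), log_inv _ (slitPlane_arg_ne_pi hz),
    cpow_def_of_ne_zero hr0, cpow_def_of_ne_zero hz0, ← Complex.exp_add, ofReal_log hr.le]
  ring_nf

lemma integrable_one_add_mul_I_cpow_mul_gaussian {w : ℂ} (hw : w.re < -1) (u : ℝ) :
    Integrable (Function.uncurry fun t x : ℝ ↦ (1 + (t : ℂ) * I) ^ w *
      (cexp ((1 + (t : ℂ) * I) * ((1 - x ^ 2 : ℝ) : ℂ)) * cexp (I * u * x)))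
      (volume.prod volume) := by
  refine ((integrable_one_add_mul_I_cpow hw).mul_prod
    (((integrable_exp_neg_mul_sq zero_lt_one).const_mul (Real.exp 1)).ofReal (𝕜 := ℂ))).mono
    ?_ (.of_forall fun z ↦ le_of_eq ?_)
  · refine Continuous.aestronglyMeasurable ?_
    simp only [Function.uncurry_def]
    exact ((continuous_one_add_mul_I_cpow w).comp continuous_fst).mul (by fun_prop)
  · simp only [Function.uncurry_def, norm_mul, Complex.norm_exp, coe_algebraMap, norm_real,
      Real.norm_eq_abs, Real.abs_exp, ← Real.exp_add, re_mul_ofReal]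
    simp [sub_eq_add_neg]

lemma integral_gaussian_eq_sonineKernel (a : ℂ) (u t : ℝ) :
    ∫ x : ℝ, (1 + (t : ℂ) * I) ^ (-(a + 1)) *
        (cexp ((1 + (t : ℂ) * I) * ((1 - x ^ 2 : ℝ) : ℂ)) * cexp (I * u * x)) =
      (Real.pi : ℂ) ^ (1 / 2 : ℂ) * sonineKernel (a + 1 / 2) u t := by
  have hintegrand : ∀ x : ℝ, (1 + (t : ℂ) * I) ^ (-(a + 1)) *
      (cexp ((1 + (t : ℂ) * I) * ((1 - x ^ 2 : ℝ) : ℂ)) * cexp (I * u * x)) =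
        (1 + (t : ℂ) * I) ^ (-(a + 1)) * cexp (1 + (t : ℂ) * I) *
          (cexp (I * u * x) * cexp (-(1 + (t : ℂ) * I) * (x : ℂ) ^ 2)) := by
    intro x
    have hexp : cexp ((1 + (t : ℂ) * I) * ((1 - x ^ 2 : ℝ) : ℂ)) =
        cexp (1 + (t : ℂ) * I) * cexp (-(1 + (t : ℂ) * I) * (x : ℂ) ^ 2) := by
      rw [← Complex.exp_add]
      push_cast
      ring_nf
    rw [hexp]
    ring
  have hpow : (1 + (t : ℂ) * I) ^ (-(a + 1 / 2) - 1) =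
      (1 + (t : ℂ) * I) ^ (-(a + 1)) * (1 + (t : ℂ) * I) ^ (-(1 / 2) : ℂ) := by
    rw [← cpow_add _ _ (one_add_mul_I_ne_zero t)]
    ring_nf
  simp only [hintegrand]
  rw [integral_const_mul, fourierIntegral_gaussian (by simp) u,
    ofReal_div_cpow Real.pi_pos (one_add_mul_I_mem_slitPlane t), sonineKernel, hpow]
  ring

/- Write `(1 - x²)₊ ^ a` as an inverse Laplace transform and integrate the resulting Gaussian in `x`
first. -/
theorem integral_exp_mul_posCpow_one_sub_sq {a : ℂ} (ha : 0 < a.re) (u : ℝ) :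
    ∫ x : ℝ, cexp (I * u * x) * posCpow a (1 - x ^ 2) =
      Gamma (a + 1) / (2 * (Real.pi : ℂ) ^ (1 / 2 : ℂ)) * sonineIntegral (a + 1 / 2) u := by
  have hlaplace : ∀ x : ℝ, ∫ t : ℝ, (1 + (t : ℂ) * I) ^ (-(a + 1)) *
      (cexp ((1 + (t : ℂ) * I) * ((1 - x ^ 2 : ℝ) : ℂ)) * cexp (I * u * x)) =
        2 * Real.pi / Gamma (a + 1) * (cexp (I * u * x) * posCpow a (1 - x ^ 2)) := by
    intro x
    simp only [← mul_assoc]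
    rw [integral_mul_const, integral_one_add_mul_I_cpow_mul_exp (by simpa using ha),
      add_sub_cancel_right]
    ring
  have hswap := integral_integral_swap
    (integrable_one_add_mul_I_cpow_mul_gaussian (w := -(a + 1)) (by simp; linarith) u)
  simp only [integral_gaussian_eq_sonineKernel, hlaplace] at hswap
  rw [integral_const_mul, integral_const_mul, ← sonineIntegral] at hswap
  have hπ : (Real.pi : ℂ) ≠ 0 := ofReal_ne_zero.2 Real.pi_ne_zero
  have hπhalf : (Real.pi : ℂ) ^ (1 / 2 : ℂ) ≠ 0 := by simp [cpow_eq_zero_iff, hπ]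
  have hπsq : (Real.pi : ℂ) ^ (1 / 2 : ℂ) * (Real.pi : ℂ) ^ (1 / 2 : ℂ) = Real.pi := by
    rw [← cpow_add _ _ hπ, add_halves, cpow_one]
  have hΓ : Gamma (a + 1) ≠ 0 := Gamma_ne_zero_of_re_pos (by simp; linarith)
  field_simp at hswap ⊢
  rw [← mul_right_inj' hπhalf]
  linear_combination
    -hswap + 2 * (∫ x : ℝ, cexp (I * u * x) * posCpow a (1 - x ^ 2)) * hπsq

end SonineIntegral

section PoissonSummation

open Complex Filter Topology MeasureTheory
open scoped FourierTransform

lemma ofReal_sqrt_cpow {x : ℝ} (hx : 0 < x) (ν : ℂ) : ((√x : ℝ) : ℂ) ^ ν = (x : ℂ) ^ (ν / 2) := by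
  have hs : 0 < √x := Real.sqrt_pos.2 hx
  conv_rhs => rw [← Real.mul_self_sqrt hx.le, ofReal_mul, mul_cpow_ofReal_nonneg hs.le hs.le,
    ← cpow_add _ _ (ofReal_ne_zero.2 hs.ne'), add_halves]

lemma besselTerm_eq_sonineIntegral (ν : ℂ) {N : ℕ} (hN : 1 ≤ N) (ℓ : ℕ+) :
    besselTerm ν N ℓ = (Real.pi : ℂ) ^ ν * (N : ℂ) ^ (ν / 2) / (2 * Real.pi) *
      sonineIntegral ν (2 * Real.pi * √N * (ℓ : ℕ)) := by
  have hN0 : (0 : ℝ) < N := by exact_mod_cast hN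
  have hℓ : ((ℓ : ℕ) : ℂ) ^ ν ≠ 0 := by simp [cpow_eq_zero_iff]
  have hhalf : ((2 * Real.pi * (ℓ : ℕ) * √N : ℝ) : ℂ) / 2 =
      ((Real.pi * (ℓ : ℕ) : ℝ) : ℂ) * (√N : ℝ) := by
    push_cast
    ring
  rw [besselTerm, besselJ_eq_sonineIntegral, hhalf, mul_cpow_ofReal_nonneg (by positivity)
    (by positivity), ofReal_sqrt_cpow hN0, ofReal_mul, mul_cpow_ofReal_nonneg (by positivity)
    (by positivity), mul_right_comm _ _ (√N)]
  simp only [ofReal_natCast]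
  field_simp

lemma summable_sonineIntegral_int {ν : ℂ} (hν : 1 < ν.re) {c : ℝ} (hc : 0 < c) :
    Summable fun n : ℤ ↦ sonineIntegral ν (c * n) := by
  obtain ⟨σ, hσ, hσν⟩ := exists_between hν
  obtain ⟨C, hC⟩ := exists_norm_sonineIntegral_le (zero_lt_one.trans hσ) hσν
  refine ((Real.summable_abs_int_rpow hσ).mul_left
    (C * c ^ (-σ))).of_norm_bounded_eventually ?_
  filter_upwards [(Set.finite_singleton (0 : ℤ)).compl_mem_cofinite] with n hn
  refine (hC _ (mul_ne_zero hc.ne' (Int.cast_ne_zero.2 hn))).trans_eq ?_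
  rw [abs_mul, abs_of_pos hc, Real.mul_rpow hc.le (abs_nonneg _), mul_assoc]

lemma summable_besselTerm {ν : ℂ} (hν : 1 < ν.re) {N : ℕ} (hN : 1 ≤ N) :
    Summable (besselTerm ν N) := by
  have hN0 : (0 : ℝ) < N := by exact_mod_cast hN
  have hinj : Function.Injective fun ℓ : ℕ+ ↦ ((ℓ : ℕ) : ℤ) :=
    Nat.cast_injective.comp PNat.coe_injective
  rw [funext (besselTerm_eq_sonineIntegral ν hN)]
  exact ((summable_sonineIntegral_int hν
    (mul_pos Real.two_pi_pos (Real.sqrt_pos.2 hN0))).comp_injective hinj).mul_left _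

lemma fourier_posCpow_sub_sq {a : ℂ} (ha : 0 < a.re) {x : ℝ} (hx : 0 < x) (ξ : ℝ) :
    𝓕 (fun v : ℝ ↦ posCpow a (x - v ^ 2)) ξ =
      (x : ℂ) ^ (a + 1 / 2) * (Gamma (a + 1) / (2 * (Real.pi : ℂ) ^ (1 / 2 : ℂ))) *
        sonineIntegral (a + 1 / 2) (2 * Real.pi * √x * ξ) := by
  have hs : 0 < √x := Real.sqrt_pos.2 hx
  set g : ℝ → ℂ := fun v ↦ cexp (((-2 * Real.pi * v * ξ : ℝ) : ℂ) * I) • posCpow a (x - v ^ 2)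
    with hg
  have hscale : ∀ y : ℝ, g (√x * y) = (x : ℂ) ^ a *
      (cexp (I * ((-(2 * Real.pi * √x * ξ) : ℝ) : ℂ) * y) * posCpow a (1 - y ^ 2)) := by
    intro y
    have hsq : x - (√x * y) ^ 2 = x * (1 - y ^ 2) := by
      rw [mul_pow, Real.sq_sqrt hx.le]
      ring
    simp only [hg, smul_eq_mul, hsq, posCpow_mul hx.le]
    push_cast
    ring_nf
  have hpow : (x : ℂ) ^ (a + 1 / 2) = (x : ℂ) ^ a * (√x : ℝ) := by
    rw [cpow_add _ _ (ofReal_ne_zero.2 hx.ne'), ← ofReal_sqrt_cpow hx 1, cpow_one]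
  calc 𝓕 (fun v : ℝ ↦ posCpow a (x - v ^ 2)) ξ
      = ∫ v : ℝ, g v := Real.fourier_real_eq_integral_exp_smul _ ξ
    _ = (√x : ℝ) * ∫ y : ℝ, g (√x * y) := by
        rw [Measure.integral_comp_mul_left, abs_of_pos (inv_pos.2 hs), real_smul, ofReal_inv,
          mul_inv_cancel_left₀ (ofReal_ne_zero.2 hs.ne')]
    _ = _ := by
        simp only [hscale]
        rw [integral_const_mul, integral_exp_mul_posCpow_one_sub_sq ha, sonineIntegral_neg, hpow]
        ring

lemma fourier_even {f : ℝ → ℂ} (hf : Function.Even f) : Function.Even (𝓕 f) := by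
  intro ξ
  rw [← Real.fourierInv_eq_fourier_neg, Real.fourierInv_eq_fourier_comp_neg]
  simp only [hf _]

lemma tsum_pnat_eq_tsum_fourier {f : ℝ → ℂ} (hf : Continuous f) (heven : Function.Even f)
    {b : ℝ} (hb : 1 < b) (hO : f =O[cocompact ℝ] fun x ↦ |x| ^ (-b))
    (hF : Summable fun n : ℤ ↦ 𝓕 f n) :
    ∑' n : ℕ+, f (n : ℕ) = (𝓕 f 0 - f 0) / 2 + ∑' n : ℕ+, 𝓕 f (n : ℕ) := by
  have hsum : Summable fun n : ℤ ↦ f n :=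
    summable_of_isBigO (Real.summable_abs_int_rpow hb) (hO.comp_tendsto Int.tendsto_coe_cofinite)
  have hpoisson := Real.tsum_eq_tsum_fourier_of_rpow_decay_of_summable hf hb hO hF 0
  simp only [zero_add, QuotientAddGroup.mk_zero, fourier_eval_zero, mul_one] at hpoisson
  rw [tsum_int_eq_zero_add_two_mul_tsum_pnat (fun n ↦ by rw [Int.cast_neg, heven]) hsum,
    tsum_int_eq_zero_add_two_mul_tsum_pnat (fun n ↦ by rw [Int.cast_neg, fourier_even heven])
      hF] at hpoisson
  simp only [Int.cast_zero, Int.cast_natCast] at hpoisson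
  linear_combination hpoisson / 2

lemma posCpow_sub_sq_isBigO {a : ℂ} (ha : 0 < a.re) (x b : ℝ) :
    (fun v : ℝ ↦ posCpow a (x - v ^ 2)) =O[cocompact ℝ] fun v ↦ |v| ^ b := by
  have hzero : (fun v : ℝ ↦ posCpow a (x - v ^ 2)) =ᶠ[cocompact ℝ] fun _ ↦ 0 := by
    filter_upwards [tendsto_norm_cocompact_atTop.eventually_ge_atTop √x] with v hv
    exact posCpow_of_nonpos ha (sub_nonpos.2 ((Real.sqrt_le_left (norm_nonneg v)).1 hv |>.trans_eq
      (sq_abs v)))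
  exact hzero.trans_isBigO (Asymptotics.isBigO_zero _ _)

lemma tsum_pnat_posCpow_sub_sq {a : ℂ} (ha : 0 < a.re) (N : ℕ) :
    ∑' m : ℕ+, posCpow a ((N : ℝ) - (m : ℕ) ^ 2) =
      ∑ m ∈ Finset.Icc 1 N.sqrt, (((N : ℝ) - m ^ 2 : ℝ) : ℂ) ^ a := by
  rw [tsum_pnat_eq_tsum_succ (f := fun m : ℕ ↦ posCpow a ((N : ℝ) - (m : ℝ) ^ 2)),
    tsum_eq_sum (s := Finset.range N.sqrt), Finset.range_eq_Ico,
    Finset.sum_Ico_add' (fun m : ℕ ↦ posCpow a ((N : ℝ) - (m : ℝ) ^ 2)) 0 N.sqrt 1]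
  · refine Finset.sum_congr rfl fun m hm ↦ posCpow_of_nonneg a (sub_nonneg.2 ?_)
    exact_mod_cast Nat.le_sqrt'.1 (Nat.lt_succ_iff.1 (Finset.mem_Ico.1 hm).2)
  · intro m hm
    refine posCpow_of_nonpos ha (sub_nonpos.2 ?_)
    have hlt : N.sqrt < m + 1 := Nat.lt_succ_iff.2 (by simpa using hm)
    exact_mod_cast (Nat.sqrt_lt'.1 hlt).le

lemma fourier_posCpow_sub_sq_zero {a : ℂ} (ha : 0 < a.re) {x : ℝ} (hx : 0 < x) :
    𝓕 (fun v : ℝ ↦ posCpow a (x - v ^ 2)) 0 = (Real.pi : ℂ) ^ (1 / 2 : ℂ) *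
      (Gamma (a + 1) / Gamma (a + 3 / 2) * (x : ℂ) ^ (a + 1 / 2)) := by
  have hπ : (Real.pi : ℂ) ≠ 0 := ofReal_ne_zero.2 Real.pi_ne_zero
  have hπhalf : (Real.pi : ℂ) ^ (1 / 2 : ℂ) ≠ 0 := by simp [cpow_eq_zero_iff, hπ]
  have hπsq : (Real.pi : ℂ) = (Real.pi : ℂ) ^ (1 / 2 : ℂ) * (Real.pi : ℂ) ^ (1 / 2 : ℂ) := by
    rw [← cpow_add _ _ hπ, add_halves, cpow_one]
  rw [fourier_posCpow_sub_sq ha hx, mul_zero, sonineIntegral_zero (by norm_num; linarith),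
    show a + 1 / 2 + 1 = a + 3 / 2 by ring]
  generalize (Real.pi : ℂ) ^ (1 / 2 : ℂ) = q at *
  rw [hπsq]
  field_simp

lemma fourier_posCpow_sub_sq_pnat {a : ℂ} (ha : 0 < a.re) {N : ℕ} (hN : 1 ≤ N) (ℓ : ℕ+) :
    𝓕 (fun v : ℝ ↦ posCpow a (N - v ^ 2)) (ℓ : ℕ) =
      Gamma (a + 1) / (Real.pi : ℂ) ^ a * (N : ℂ) ^ ((a + 1 / 2) / 2) *
        besselTerm (a + 1 / 2) N ℓ := by
  have hN0 : (N : ℂ) ≠ 0 := by exact_mod_cast Nat.one_le_iff_ne_zero.1 hN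
  have hπ : (Real.pi : ℂ) ≠ 0 := ofReal_ne_zero.2 Real.pi_ne_zero
  have hπhalf : (Real.pi : ℂ) ^ (1 / 2 : ℂ) ≠ 0 := by simp [cpow_eq_zero_iff, hπ]
  have hπa : (Real.pi : ℂ) ^ a ≠ 0 := by simp [cpow_eq_zero_iff, hπ]
  have hπsq : (Real.pi : ℂ) = (Real.pi : ℂ) ^ (1 / 2 : ℂ) * (Real.pi : ℂ) ^ (1 / 2 : ℂ) := by
    rw [← cpow_add _ _ hπ, add_halves, cpow_one]
  have hN2 : (N : ℂ) ^ (a + 1 / 2) = (N : ℂ) ^ ((a + 1 / 2) / 2) * (N : ℂ) ^ ((a + 1 / 2) / 2) := by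
    rw [← cpow_add _ _ hN0, add_halves]
  rw [fourier_posCpow_sub_sq ha (by exact_mod_cast hN), ofReal_natCast,
    besselTerm_eq_sonineIntegral _ hN, hN2, cpow_add (x := (Real.pi : ℂ)) _ _ hπ]
  generalize sonineIntegral _ _ = S
  generalize (Real.pi : ℂ) ^ (1 / 2 : ℂ) = q at *
  generalize (Real.pi : ℂ) ^ a = p at *
  rw [hπsq]
  field_simp

theorem sum_sub_sq_cpow {a : ℂ} (ha : 1 / 2 < a.re) {N : ℕ} (hN : 1 ≤ N) :
    ∑ m ∈ Finset.Icc 1 N.sqrt, (((N : ℝ) - m ^ 2 : ℝ) : ℂ) ^ a =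
      (Real.pi : ℂ) ^ (1 / 2 : ℂ) / 2 *
          (Gamma (a + 1) / Gamma (a + 3 / 2) * (N : ℂ) ^ (a + 1 / 2))
        - (N : ℂ) ^ a / 2
        + Gamma (a + 1) / (Real.pi : ℂ) ^ a * (N : ℂ) ^ ((a + 1 / 2) / 2) *
          ∑' ℓ : ℕ+, besselTerm (a + 1 / 2) N ℓ := by
  have ha0 : 0 < a.re := by linarith
  have hN0 : (0 : ℝ) < N := by exact_mod_cast hN
  have hsummable : Summable fun n : ℤ ↦ 𝓕 (fun v : ℝ ↦ posCpow a (N - v ^ 2)) n := by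
    simp only [fourier_posCpow_sub_sq ha0 hN0]
    exact (summable_sonineIntegral_int (by norm_num; linarith) (by positivity)).mul_left _
  have hpoisson := tsum_pnat_eq_tsum_fourier (f := fun v : ℝ ↦ posCpow a (N - v ^ 2))
    ((continuous_posCpow ha0).comp (by fun_prop)) (fun v ↦ by simp) one_lt_two
    (posCpow_sub_sq_isBigO ha0 N (-2)) hsummable
  rw [tsum_pnat_posCpow_sub_sq ha0, fourier_posCpow_sub_sq_zero ha0 hN0,
    tsum_congr (fourier_posCpow_sub_sq_pnat ha0 hN), tsum_mul_left] at hpoisson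
  rw [hpoisson, zero_pow two_ne_zero, sub_zero, posCpow_of_nonneg a hN0.le]
  push_cast
  ring

end PoissonSummation

section CesaroMean

open Complex
open ArithmeticFunction (vonMangoldt)

lemma floor_natCast_sub_sq {N m : ℕ} (h : m ^ 2 ≤ N) : ⌊(N : ℝ) - m ^ 2⌋₊ = N - m ^ 2 := by
  exact_mod_cast Nat.floor_natCast (R := ℝ) (N - m ^ 2)

lemma cesaroHL_eq_sum_rieszMean (k : ℝ) {N : ℕ} (hN : 1 ≤ N) :
    cesaroHL k N = (N : ℝ) ^ (-k) * ∑ m ∈ Finset.Icc 1 N.sqrt, rieszMean k (N - m ^ 2) := by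
  have hN0 : (0 : ℝ) < N := by exact_mod_cast hN
  have hfloor : ∀ m ∈ Finset.Icc 1 N.sqrt, rieszMean k (N - m ^ 2) =
      ∑ n ∈ Finset.Ioc 0 (N - m ^ 2),
        vonMangoldt n * (((N : ℝ) - m ^ 2 - n) ^ k / Real.Gamma (k + 1)) := fun m hm ↦ by
    rw [rieszMean, floor_natCast_sub_sq (Nat.le_sqrt'.1 (Finset.mem_Icc.1 hm).2)]
  rw [Finset.sum_congr rfl hfloor]
  simp only [cesaroHL, hardyLittlewoodR, Finset.sum_mul, Finset.mul_sum]
  rw [Finset.sum_sigma', Finset.sum_sigma']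
  refine Finset.sum_nbij' (fun x ↦ ⟨x.2.2, x.2.1⟩) (fun y ↦ ⟨y.2 + y.1 ^ 2, (y.2, y.1)⟩)
    ?_ ?_ ?_ (fun _ _ ↦ rfl) ?_
  · rintro ⟨n, m₁, m₂⟩ h
    simp only [Finset.mem_sigma, Finset.mem_filter, Finset.mem_product, Finset.mem_Icc,
      Finset.mem_Ioc, Nat.le_sqrt'] at h ⊢
    omega
  · rintro ⟨m₂, m₁⟩ h
    simp only [Finset.mem_sigma, Finset.mem_filter, Finset.mem_product, Finset.mem_Icc,
      Finset.mem_Ioc, Nat.le_sqrt'] at h ⊢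
    obtain ⟨⟨hm₂, hsq⟩, hm₁, hle⟩ := h
    have hself : m₂ ≤ m₂ ^ 2 := Nat.le_self_pow two_ne_zero m₂
    have hsum : m₁ + m₂ ^ 2 ≤ N := by omega
    exact ⟨⟨by omega, hsum⟩, ⟨⟨hm₁, by omega⟩, hm₂, by omega⟩, trivial⟩
  · rintro ⟨n, m₁, m₂⟩ h
    simp only [Finset.mem_sigma, Finset.mem_filter] at h
    obtain ⟨-, -, rfl⟩ := h
    rfl
  · rintro ⟨n, m₁, m₂⟩ h
    simp only [Finset.mem_sigma, Finset.mem_filter, Finset.mem_Icc] at h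
    obtain ⟨⟨-, hle⟩, -, rfl⟩ := h
    have hle' : ((m₁ + m₂ ^ 2 : ℕ) : ℝ) ≤ N := by exact_mod_cast hle
    dsimp only
    rw [one_sub_div hN0.ne', Real.div_rpow (sub_nonneg.2 hle') hN0.le, Real.rpow_neg hN0.le]
    push_cast
    rw [sub_sub, add_comm ((m₂ : ℝ) ^ 2)]
    ring

lemma summable_rieszCoeff_mul_cpow {k b : ℂ} (hk : 1 < k.re) (hb : 0 ≤ b.re) {X : ℝ}
    (hX : 0 ≤ X) : Summable fun ρ : zetaZeros ↦ rieszCoeff k ρ * (X : ℂ) ^ (b + ρ) := by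
  refine ((summable_rieszCoeff hk).norm.mul_right (max X 1 ^ (b.re + 1))).of_norm_bounded
    fun ρ ↦ ?_
  have hre : 0 < (b + ρ).re := by
    rw [add_re]
    linarith [ρ.2.2.1]
  rw [norm_mul, norm_cpow_eq_rpow_re_of_nonneg hX hre.ne']
  gcongr
  calc X ^ (b + ρ).re ≤ max X 1 ^ (b + ρ).re := by gcongr; exact le_max_left _ _
    _ ≤ max X 1 ^ (b.re + 1) := by
      gcongr
      · exact le_max_right _ _
      · rw [add_re]
        linarith [ρ.2.2.2]

lemma gammaZeroTerm_eq_rieszCoeff (w w' : ℂ) (N : ℕ) (ρ : zetaZeros) :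
    gammaZeroTerm w w' N ρ = rieszCoeff (w - 1) ρ * (N : ℂ) ^ (w' + ρ) := by
  rw [gammaZeroTerm, rieszCoeff, sub_add_cancel, mul_assoc]

lemma summable_gammaZeroTerm {w w' : ℂ} (hw : 2 < w.re) (hw' : 0 ≤ w'.re) (N : ℕ) :
    Summable (gammaZeroTerm w w' N) := by
  rw [funext (gammaZeroTerm_eq_rieszCoeff w w' N)]
  exact_mod_cast summable_rieszCoeff_mul_cpow (k := w - 1) (by rw [sub_re, one_re]; linarith) hw'
    N.cast_nonneg

lemma sub_sq_nonneg_of_mem_Icc_sqrt {N m : ℕ} (hm : m ∈ Finset.Icc 1 N.sqrt) :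
    0 ≤ (N : ℝ) - m ^ 2 :=
  sub_nonneg.2 (by exact_mod_cast Nat.le_sqrt'.1 (Finset.mem_Icc.1 hm).2)

lemma summable_rieszCoeff_mul_sum_sub_sq_cpow {k : ℂ} (hk : 1 < k.re) (N : ℕ) :
    Summable fun ρ : zetaZeros ↦ rieszCoeff k ρ *
      ∑ m ∈ Finset.Icc 1 N.sqrt, (((N : ℝ) - m ^ 2 : ℝ) : ℂ) ^ (k + ρ) := by
  simp only [Finset.mul_sum]
  exact summable_sum fun m hm ↦ summable_rieszCoeff_mul_cpow hk (by linarith)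
    (sub_sq_nonneg_of_mem_Icc_sqrt hm)

lemma cesaroHL_sub_eq_sum {k : ℝ} (hk : 1 < k) {N : ℕ} (hN : 1 ≤ N) :
    (cesaroHL k N : ℂ) - (N : ℂ) ^ (-(k : ℂ)) *
      ((∑ m ∈ Finset.Icc 1 N.sqrt, (((N : ℝ) - m ^ 2 : ℝ) : ℂ) ^ ((k : ℂ) + 1)) /
          Gamma ((k : ℂ) + 2) -
        ∑' ρ, rieszCoeff k ρ *
          ∑ m ∈ Finset.Icc 1 N.sqrt, (((N : ℝ) - m ^ 2 : ℝ) : ℂ) ^ ((k : ℂ) + ρ)) =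
    (N : ℂ) ^ (-(k : ℂ)) * ∑ m ∈ Finset.Icc 1 N.sqrt,
      ((rieszMean k (N - m ^ 2) : ℂ) -
        (((N : ℝ) - m ^ 2 : ℝ) : ℂ) ^ ((k : ℂ) + 1) / Gamma ((k : ℂ) + 2) +
        ∑' ρ, rieszCoeff k ρ * (((N : ℝ) - m ^ 2 : ℝ) : ℂ) ^ ((k : ℂ) + ρ)) := by
  have hpow : (((N : ℝ) ^ (-k) : ℝ) : ℂ) = (N : ℂ) ^ (-(k : ℂ)) := by
    rw [ofReal_cpow N.cast_nonneg]
    simp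
  have htsum : ∑' ρ, rieszCoeff k ρ *
      ∑ m ∈ Finset.Icc 1 N.sqrt, (((N : ℝ) - m ^ 2 : ℝ) : ℂ) ^ ((k : ℂ) + ρ) =
        ∑ m ∈ Finset.Icc 1 N.sqrt,
          ∑' ρ, rieszCoeff k ρ * (((N : ℝ) - m ^ 2 : ℝ) : ℂ) ^ ((k : ℂ) + ρ) := by
    simp only [Finset.mul_sum]
    exact Summable.tsum_finsetSum fun m hm ↦ summable_rieszCoeff_mul_cpow (by simpa)
      (by rw [ofReal_re]; linarith) (sub_sq_nonneg_of_mem_Icc_sqrt hm)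
  rw [cesaroHL_eq_sum_rieszMean k hN, ofReal_mul, hpow, ofReal_sum, htsum,
    Finset.sum_add_distrib, Finset.sum_sub_distrib, ← Finset.sum_div]
  ring

theorem exists_norm_cesaroHL_sub_le {k : ℝ} (hk : 1 < k) : ∃ C : ℝ, ∀ N : ℕ, 1 ≤ N →
    ‖(cesaroHL k N : ℂ) - (N : ℂ) ^ (-(k : ℂ)) *
      ((∑ m ∈ Finset.Icc 1 N.sqrt, (((N : ℝ) - m ^ 2 : ℝ) : ℂ) ^ ((k : ℂ) + 1)) /
          Gamma ((k : ℂ) + 2) -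
        ∑' ρ, rieszCoeff k ρ *
          ∑ m ∈ Finset.Icc 1 N.sqrt, (((N : ℝ) - m ^ 2 : ℝ) : ℂ) ^ ((k : ℂ) + ρ))‖ ≤
      C * (N : ℝ) ^ (1 / 2 : ℝ) := by
  obtain ⟨C, hC0, hC⟩ := exists_norm_rieszMean_sub_add_tsum_le hk
  refine ⟨2 * C, fun N hN ↦ ?_⟩
  have hN1 : (1 : ℝ) ≤ N := by exact_mod_cast hN
  have hN0 : (0 : ℝ) < N := by linarith
  have herror : ∀ m ∈ Finset.Icc 1 N.sqrt, C * ((1 + ((N : ℝ) - m ^ 2)) *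
      ((N : ℝ) - m ^ 2) ^ (k - 1)) ≤ 2 * C * (N : ℝ) ^ k := by
    intro m hm
    have hX := sub_sq_nonneg_of_mem_Icc_sqrt hm
    have hXN : (N : ℝ) - m ^ 2 ≤ N := sub_le_self _ (sq_nonneg _)
    calc C * ((1 + ((N : ℝ) - m ^ 2)) * ((N : ℝ) - m ^ 2) ^ (k - 1))
        ≤ C * ((N + N) * (N : ℝ) ^ (k - 1)) := by gcongr
      _ = 2 * C * (N : ℝ) ^ k := by
        rw [Real.rpow_sub_one hN0.ne']
        field_simp
        ring
  rw [cesaroHL_sub_eq_sum hk hN, norm_mul, norm_natCast_cpow_of_pos hN, neg_re, ofReal_re,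
    ← Real.sqrt_eq_rpow]
  calc (N : ℝ) ^ (-k) * ‖_‖
      ≤ (N : ℝ) ^ (-k) * ∑ _m ∈ Finset.Icc 1 N.sqrt, 2 * C * (N : ℝ) ^ k := by
        gcongr
        exact norm_sum_le_of_le _ fun m hm ↦
          (hC _ (sub_sq_nonneg_of_mem_Icc_sqrt hm)).trans (herror m hm)
    _ = 2 * C * (N.sqrt : ℝ) := by
        rw [Finset.sum_const, Nat.card_Icc, Nat.add_sub_cancel, nsmul_eq_mul,
          Real.rpow_neg hN0.le]
        have := (Real.rpow_pos_of_pos hN0 k).ne'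
        field_simp
    _ ≤ 2 * C * √N := by
        gcongr
        exact Real.nat_sqrt_le_real_sqrt

lemma cpow_neg_mul_rieszCoeff_mul_sum {k : ℝ} (hk : 1 < k) {N : ℕ} (hN : 1 ≤ N) (ρ : zetaZeros) :
    (N : ℂ) ^ (-(k : ℂ)) * (rieszCoeff k ρ *
        ∑ m ∈ Finset.Icc 1 N.sqrt, (((N : ℝ) - m ^ 2 : ℝ) : ℂ) ^ ((k : ℂ) + ρ)) =
      (Real.pi : ℂ) ^ (1 / 2 : ℂ) / 2 * gammaZeroTerm ((k : ℂ) + 3 / 2) (1 / 2) N ρ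
        - 1 / 2 * gammaZeroTerm ((k : ℂ) + 1) 0 N ρ
        + (N : ℂ) ^ (1 / 4 - (k : ℂ) / 2) / (Real.pi : ℂ) ^ (k : ℂ) * besselZeroTerm k N ρ := by
  have hN0 : (N : ℂ) ≠ 0 := by exact_mod_cast Nat.one_le_iff_ne_zero.1 hN
  have hπ : (Real.pi : ℂ) ≠ 0 := ofReal_ne_zero.2 Real.pi_ne_zero
  have hre : 1 < ((k : ℂ) + ρ).re := by
    rw [add_re, ofReal_re]
    linarith [ρ.2.2.1]
  have hΓ : Gamma ((k : ℂ) + 1 + ρ) ≠ 0 := Gamma_ne_zero_of_re_pos (by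
    rw [add_right_comm, add_re _ 1, one_re]
    linarith)
  have hmain : (N : ℂ) ^ ((k : ℂ) + 1 / 2 + ρ) =
      (N : ℂ) ^ (k : ℂ) * (N : ℂ) ^ (1 / 2 + (ρ : ℂ)) := by
    rw [← cpow_add _ _ hN0, add_assoc]
  have hzero : (N : ℂ) ^ ((k : ℂ) + ρ) = (N : ℂ) ^ (k : ℂ) * (N : ℂ) ^ (0 + (ρ : ℂ)) := by
    rw [← cpow_add _ _ hN0, zero_add]
  have hbessel : (N : ℂ) ^ (((k : ℂ) + 1 / 2 + ρ) / 2) =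
      (N : ℂ) ^ (k : ℂ) * (N : ℂ) ^ (1 / 4 - (k : ℂ) / 2) * (N : ℂ) ^ ((ρ : ℂ) / 2) := by
    rw [← cpow_add _ _ hN0, ← cpow_add _ _ hN0]
    ring_nf
  have hNk : (N : ℂ) ^ (k : ℂ) ≠ 0 := by simp [cpow_eq_zero_iff, hN0]
  rw [sum_sub_sq_cpow (by linarith) hN, rieszCoeff, gammaZeroTerm, gammaZeroTerm, besselZeroTerm,
    add_right_comm (k : ℂ) ρ, add_right_comm (k : ℂ) ρ, add_right_comm (k : ℂ) ρ,
    hmain, hzero, hbessel, cpow_add (k : ℂ) _ hπ, cpow_neg]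
  simp only [div_eq_mul_inv, mul_inv]
  field_simp

lemma cpow_neg_mul_sum_div_Gamma {k : ℝ} (hk : 1 < k) {N : ℕ} (hN : 1 ≤ N) :
    (N : ℂ) ^ (-(k : ℂ)) *
      ((∑ m ∈ Finset.Icc 1 N.sqrt, (((N : ℝ) - m ^ 2 : ℝ) : ℂ) ^ ((k : ℂ) + 1)) /
        Gamma ((k : ℂ) + 2)) =
      (Real.pi : ℂ) ^ (1 / 2 : ℂ) / 2 * ((N : ℂ) ^ (3 / 2 : ℂ) / Gamma ((k : ℂ) + 5 / 2))
        - 1 / 2 * ((N : ℂ) / Gamma ((k : ℂ) + 2))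
        + (N : ℂ) ^ (3 / 4 - (k : ℂ) / 2) / (Real.pi : ℂ) ^ ((k : ℂ) + 1) *
            ∑' ℓ : ℕ+, besselTerm ((k : ℂ) + 3 / 2) N ℓ := by
  have hN0 : (N : ℂ) ≠ 0 := by exact_mod_cast Nat.one_le_iff_ne_zero.1 hN
  have hΓ : Gamma ((k : ℂ) + 2) ≠ 0 := Gamma_ne_zero_of_re_pos (by
    rw [add_re, ofReal_re, re_ofNat]
    linarith)
  have hbessel : (N : ℂ) ^ (((k : ℂ) + 3 / 2) / 2) =
      (N : ℂ) ^ (k : ℂ) * (N : ℂ) ^ (3 / 4 - (k : ℂ) / 2) := by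
    rw [← cpow_add _ _ hN0]
    ring_nf
  have hNk : (N : ℂ) ^ (k : ℂ) ≠ 0 := by simp [cpow_eq_zero_iff, hN0]
  rw [sum_sub_sq_cpow (by simp; linarith) hN, show (k : ℂ) + 1 + 1 / 2 = k + 3 / 2 by ring,
    show (k : ℂ) + 1 + 3 / 2 = k + 5 / 2 by ring, show (k : ℂ) + 1 + 1 = k + 2 by ring,
    hbessel, cpow_add (x := (N : ℂ)) _ _ hN0, cpow_add (x := (N : ℂ)) _ _ hN0, cpow_one, cpow_neg]
  simp only [div_eq_mul_inv]
  field_simp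

lemma summable_besselZeroTerm {k : ℝ} (hk : 1 < k) {N : ℕ} (hN : 1 ≤ N) :
    Summable (besselZeroTerm k N) := by
  have hN0 : (N : ℂ) ≠ 0 := by exact_mod_cast Nat.one_le_iff_ne_zero.1 hN
  have hπ : (Real.pi : ℂ) ≠ 0 := ofReal_ne_zero.2 Real.pi_ne_zero
  have hc : (N : ℂ) ^ (1 / 4 - (k : ℂ) / 2) / (Real.pi : ℂ) ^ (k : ℂ) ≠ 0 :=
    div_ne_zero (by simp [cpow_eq_zero_iff, hN0]) (by simp [cpow_eq_zero_iff, hπ])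
  have hhalf : Summable (gammaZeroTerm ((k : ℂ) + 3 / 2) (1 / 2) N) :=
    summable_gammaZeroTerm (by norm_num; linarith) (by norm_num) N
  have hzero : Summable (gammaZeroTerm ((k : ℂ) + 1) 0 N) :=
    summable_gammaZeroTerm (by norm_num; linarith) le_rfl N
  have hsum := summable_rieszCoeff_mul_sum_sub_sq_cpow (k := k) (by simpa) N
  refine (summable_mul_left_iff hc).1 ?_
  refine (((hsum.mul_left ((N : ℂ) ^ (-(k : ℂ)))).sub
    (hhalf.mul_left ((Real.pi : ℂ) ^ (1 / 2 : ℂ) / 2))).add (hzero.mul_left (1 / 2))).congr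
    fun ρ ↦ ?_
  rw [cpow_neg_mul_rieszCoeff_mul_sum hk hN]
  ring

end CesaroMean

theorem theorem3 (k : ℝ) (hk : 1 < k) :
    ∃ C : ℝ, ∀ N : ℕ, 1 ≤ N →
      Summable (gammaZeroTerm ((k : ℂ) + 3 / 2) (1 / 2) N) ∧
      Summable (gammaZeroTerm ((k : ℂ) + 1) 0 N) ∧
      Summable (besselTerm ((k : ℂ) + 3 / 2) N) ∧
      (∀ ρ : zetaZeros, Summable (besselTerm ((k : ℂ) + 1 / 2 + ρ) N)) ∧
      Summable (besselZeroTerm k N) ∧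
      ‖(cesaroHL k N : ℂ) -
          ((Real.pi : ℂ) ^ (1 / 2 : ℂ) / 2 *
              ((N : ℂ) ^ (3 / 2 : ℂ) / Complex.Gamma ((k : ℂ) + 5 / 2))
            - 1 / 2 * ((N : ℂ) / Complex.Gamma ((k : ℂ) + 2))
            - (Real.pi : ℂ) ^ (1 / 2 : ℂ) / 2 *
                ∑' ρ : zetaZeros, gammaZeroTerm ((k : ℂ) + 3 / 2) (1 / 2) N ρ
            + 1 / 2 * ∑' ρ : zetaZeros, gammaZeroTerm ((k : ℂ) + 1) 0 N ρ
            + (N : ℂ) ^ (3 / 4 - (k : ℂ) / 2) / (Real.pi : ℂ) ^ ((k : ℂ) + 1) *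
                ∑' ℓ : ℕ+, besselTerm ((k : ℂ) + 3 / 2) N ℓ
            - (N : ℂ) ^ (1 / 4 - (k : ℂ) / 2) / (Real.pi : ℂ) ^ (k : ℂ) *
                ∑' ρ : zetaZeros, besselZeroTerm k N ρ)‖
        ≤ C * (N : ℝ) ^ (1 / 2 : ℝ) := by
  obtain ⟨C, hC⟩ := exists_norm_cesaroHL_sub_le hk
  refine ⟨C, fun N hN ↦ ?_⟩
  have hhalf : Summable (gammaZeroTerm ((k : ℂ) + 3 / 2) (1 / 2) N) :=
    summable_gammaZeroTerm (by norm_num; linarith) (by norm_num) N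
  have hzero : Summable (gammaZeroTerm ((k : ℂ) + 1) 0 N) :=
    summable_gammaZeroTerm (by norm_num; linarith) le_rfl N
  have hbessel := summable_besselZeroTerm hk hN
  refine ⟨hhalf, hzero, summable_besselTerm ?_ hN, fun ρ ↦ summable_besselTerm ?_ hN, hbessel, ?_⟩
  · norm_num
    linarith
  · have hρ := ρ.2.2.1
    norm_num
    linarith
  · convert hC N hN using 2
    rw [mul_sub, cpow_neg_mul_sum_div_Gamma hk hN, ← tsum_mul_left (a := (N : ℂ) ^ (-(k : ℂ))),
      tsum_congr (cpow_neg_mul_rieszCoeff_mul_sum hk hN),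
      ((hhalf.mul_left _).sub (hzero.mul_left _)).tsum_add (hbessel.mul_left _),
      (hhalf.mul_left _).tsum_sub (hzero.mul_left _), tsum_mul_left, tsum_mul_left, tsum_mul_left]
    ring
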